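/- **Setting.** Let $V=\{1,\dots,N\}$, $N\ge 1$, with symmetric conductances $\omega_{\{x,y\}}\in[0,\infty)$, $\omega_{\{x,x\}}=0$, such that the graph on $V$ with $x\sim y$ iff $\omega_{\{x,y\}}\ne 0$ is connected; let $\alpha_x\in\{1,2,\dots\}$ for $x\in V$, $\omega_L,\omega_R\ge 0$ and $\alpha_L,\alpha_R>0$ (the *geometry*). Let $\sigma\in\{-1,0,1\}$, $\varTheta=[0,1]$ if $\sigma=-1$ and $\varTheta=[0,\infty)$ otherwise, and $\theta_L,\theta_R\in\varTheta$. Let $\mathcal X=\prod_{x\in V}\{0,\dots,\alpha_x\}$ if $\sigma=-1$ and $\mathcal X=\mathbb N_0^V$ otherwise. Let $(\eta_t)_{t\ge0}$ be the Markov jump process on $\mathcal X$ with generator $$\mathcal Lf(\eta)=\sum_{\{x,y\}\subset V}\omega_{\{x,y\}}\big[\eta(x)(\alpha_y+\sigma\eta(y))(f(\eta-\delta_x+\delta_y)-f(\eta))+\eta(y)(\alpha_x+\sigma\eta(x))(f(\eta-\delta_y+\delta_x)-f(\eta))\big]$$ $$+\sum_{(S,x)\in\{(L,1),(R,N)\}}\omega_S\big[\eta(x)\,\alpha_S(1+\sigma\theta_S)(f(\eta-\delta_x)-f(\eta))+\alpha_S\theta_S(\alpha_x+\sigma\eta(x))(f(\eta+\delta_x)-f(\eta))\big].$$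 The dual process $(\xi_t)_{t\ge0}$ on $\widehat{\mathcal X}=\mathcal X\times\mathbb N_0^{\{L,R\}}$ has the same bulk part, while each particle at site $1$ jumps to $L$ at rate $\omega_L\alpha_L$, each particle at site $N$ jumps to $R$ at rate $\omega_R\alpha_R$, and particles in $L$ and $R$ stay there forever. Its law from $\zeta$ is $\widehat{\mathbb P}_\zeta$, with expectation $\widehat{\mathbb E}_\zeta$; $\widehat{\mathbb P}_\zeta(\zeta_\infty=\zeta'):=\lim_{t\to\infty}\widehat{\mathbb P}_\zeta(\zeta_t=\zeta')$; $|\xi|$ is the total number of particles of $\xi\in\widehat{\mathcal X}$, and $\le$ is the coordinatewise order on $\widehat{\mathcal X}$. Let $\nu_{x,\theta}$ be $\mathrm{Binomial}(\alpha_x,\theta)$, $\mathrm{Poisson}(\alpha_x\theta)$ or $\mathrm{Negative\text{-}Binomial}(\alpha_x,\tfrac{\theta}{1+\theta})$ for $\sigma=-1,0,1$, respectively. Put, with $0^0=1$, $$d_{x,\theta}(k,n)=\sum_{\ell=0}^{k}\binom{k}{\ell}\frac{n(n-1)\cdots(n-\ell+1)}{w_x(\ell)}(-\theta)^{k-\ell},$$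 where $w_x(\ell)=\alpha_x(\alpha_x-1)\cdots(\alpha_x-\ell+1)$, $\alpha_x^\ell$, $\alpha_x(\alpha_x+1)\cdots(\alpha_x+\ell-1)$ for $\sigma=-1,0,1$, and terms with $\ell>n$ are zero (for $\theta\neq0$ these are $(-\theta)^k$ times the Kravchuk, Charlier and Meixner polynomials ${}_2F_1(-k,-n;-\alpha_x;\tfrac1\theta)$, ${}_2F_0(-k,-n;-;-\tfrac{1}{\theta\alpha_x})$, ${}_2F_1(-k,-n;\alpha_x;-\tfrac1\theta)$). For $\beta\in\mathbb R^V$ let $\theta_x^{\beta}=\theta_R+\beta_x(\theta_L-\theta_R)$, and, whenever all $\theta_x^\beta\in\varTheta$, let $$\mu_{\theta_L,\theta_R,\beta}=\bigotimes_{x\in V}\nu_{x,\theta^\beta_x},\qquad D^{or}_{\theta_L,\theta_R,\beta}(\xi,\eta)=0^{\xi(L)}\Big(\prod_{x\in V}d_{x,\theta^\beta_x}(\xi(x),\eta(x))\Big)0^{\xi(R)}.$$ **Theorem.** Let $\beta,\beta'\in\mathbb R^V$ be such that $\theta^\beta_x,\theta^{\beta'}_x\in\varTheta$ for all $x\in V$,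 and let $\xi\in\widehat{\mathcal X}$ with $\xi(L)=\xi(R)=0$. 1. For every $t\ge0$, if $\eta_0$ is distributed according to $\mu_{\theta_L,\theta_R,\beta}$, then $D^{or}_{\theta_L,\theta_R,\beta'}(\xi,\eta_t)$ is integrable and $$\mathbb E_{\mu_{\theta_L,\theta_R,\beta}}\big[D^{or}_{\theta_L,\theta_R,\beta'}(\xi,\eta_t)\big]=(\theta_L-\theta_R)^{|\xi|}\,\psi_{t,\beta,\beta'}(\xi),$$ where $$\psi_{t,\beta,\beta'}(\xi)=\sum_{\zeta\le\xi}(-1)^{|\xi|-|\zeta|}\Big(\prod_{x\in V}\binom{\xi(x)}{\zeta(x)}(\beta'_x)^{\xi(x)-\zeta(x)}\Big)\,\widehat{\mathbb E}_\zeta\Big[\mathbf 1_{\{\zeta_t(R)=0\}}\prod_{x\in V}\beta_x^{\zeta_t(x)}\Big]$$ does not depend on $\theta_L,\theta_R$, but only on $\beta,\beta',\sigma,t,\xi$ and the geometry. 2. Assume $\max(\omega_L,\omega_R)>0$. Then $\lim_{t\to\infty}\psi_{t,\beta,\beta'}(\xi)=\psi_{\beta'}(\xi)$, where $$\psi_{\beta'}(\xi)=\sum_{\zeta\le\xi}(-1)^{|\xi|-|\zeta|}\Big(\prod_{x\in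 V}\binom{\xi(x)}{\zeta(x)}(\beta'_x)^{\xi(x)-\zeta(x)}\Big)\,\widehat{\mathbb P}_\zeta\big(\zeta_\infty(L)=|\zeta|\big)$$ does not depend on $\theta_L,\theta_R$ either; and if $\mu_{\theta_L,\theta_R}$ is a stationary probability measure of $(\eta_t)$, then $D^{or}_{\theta_L,\theta_R,\beta'}(\xi,\cdot)$ is integrable with respect to it and $$\mathbb E_{\mu_{\theta_L,\theta_R}}\big[D^{or}_{\theta_L,\theta_R,\beta'}(\xi,\eta)\big]=(\theta_L-\theta_R)^{|\xi|}\,\psi_{\beta'}(\xi).$$ -/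

import Mathlib

open MeasureTheory Filter Topology
open scoped ENNReal

noncomputable section

namespace BoundaryDriven

/-! ### Continuous-time Markov chains on a countable state space -/

section Chain

variable {S : Type*}

open Classical in
/-- The entry `(s, r)` of the rate matrix of the operator `L`: `L` applied to the indicator function
of the state `r`, evaluated at `s`. -/
def rate (L : (S → ℝ) → S → ℝ) (s r : S) : ℝ :=
  L (fun u => if u = r then 1 else 0) s

/-- The total rate at which the chain leaves the state `s`. -/
def exitRate (L : (S → ℝ) → S → ℝ) (s : S) : ℝ :=
  - rate L s s

open Classical in
/-- `transAux L n t s s'` is the probability that the jump process with generator `L`, started from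
`s`, is in `s'` at time `t` and has made at most `n` jumps up to time `t`: either it has not left
`s`, or its first jump, at a time `u ≤ t`, is to some state `r`. -/
def transAux (L : (S → ℝ) → S → ℝ) : ℕ → ℝ → S → S → ℝ≥0∞
  | 0, t, s, s' => if s = s' then ENNReal.ofReal (Real.exp (-(exitRate L s * t))) else 0
  | n + 1, t, s, s' =>
      (if s = s' then ENNReal.ofReal (Real.exp (-(exitRate L s * t))) else 0) +
        ∫⁻ u in Set.Ioc 0 t, ENNReal.ofReal (Real.exp (-(exitRate L s * u))) *
          ∑' r, (if r = s then 0 else ENNReal.ofReal (rate L s r)) * transAux L n (t - u) r s'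

/-- The transition probability `p_t(s, s')` of the (minimal) jump process with generator `L`. -/
def transProb (L : (S → ℝ) → S → ℝ) (t : ℝ) (s s' : S) : ℝ≥0∞ :=
  ⨆ n, transAux L n t s s'

variable [MeasurableSpace S]

/-- The law at time `t` of the jump process with generator `L` started from the state `s`. -/
def lawFrom (L : (S → ℝ) → S → ℝ) (t : ℝ) (s : S) : Measure S :=
  Measure.sum fun s' => transProb L t s s' • Measure.dirac s'

/-- The law at time `t` of the jump process with generator `L` and initial distribution `μ`. -/
def lawAt (L : (S → ℝ) → S → ℝ) (μ : Measure S) (t : ℝ) : Measure S :=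
  μ.bind (lawFrom L t)

/-- `μ` is a stationary probability measure of the jump process with generator `L`. -/
def IsStationaryMeasure (L : (S → ℝ) → S → ℝ) (μ : Measure S) : Prop :=
  IsProbabilityMeasure μ ∧ ∀ t : ℝ, 0 ≤ t → lawAt L μ t = μ

end Chain

/-! ### The particle systems -/

/-- The underlying geometry, with bulk `V = Fin (m + 1)`, that is `N = m + 1` sites; the first site
`1` is `0` and the last site `N` is `Fin.last m`. -/
structure Geometry (m : ℕ) where
  /-- bulk conductances -/
  ω : Fin (m + 1) → Fin (m + 1) → ℝ
  /-- site parameters -/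
  α : Fin (m + 1) → ℕ
  /-- left boundary conductance -/
  ωL : ℝ
  /-- right boundary conductance -/
  ωR : ℝ
  /-- left boundary parameter -/
  αL : ℝ
  /-- right boundary parameter -/
  αR : ℝ
  ω_symm : ∀ x y, ω x y = ω y x
  ω_nonneg : ∀ x y, 0 ≤ ω x y
  ω_diag : ∀ x, ω x x = 0
  connected : (SimpleGraph.fromRel fun x y => ω x y ≠ 0).Connected
  α_pos : ∀ x, 0 < α x
  ωL_nonneg : 0 ≤ ωL
  ωR_nonneg : 0 ≤ ωR
  αL_pos : 0 < αL
  αR_pos : 0 < αR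

variable {m : ℕ}

/-- Particle configurations in the bulk: at most `α x` particles at `x` for exclusion (`σ = -1`),
no restriction for independent walkers (`σ = 0`) and for inclusion (`σ = 1`). -/
abbrev Config (G : Geometry m) (σ : SignType) : Type :=
  {η : Fin (m + 1) → ℕ // σ = -1 → ∀ x, η x ≤ G.α x}

/-- Configurations of the dual process: the bulk configuration, the number of particles in `L` and
the number of particles in `R`. -/
abbrev DualConfig (G : Geometry m) (σ : SignType) : Type :=
  Config G σ × ℕ × ℕ

variable {G : Geometry m} {σ : SignType}

open Classical in
/-- The configuration with occupation numbers `η'` if this is admissible, and `η` otherwise.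
(The moves below that are not admissible all have rate `0`.) -/
def changeTo (η : Config G σ) (η' : Fin (m + 1) → ℕ) : Config G σ :=
  if h : σ = -1 → ∀ x, η' x ≤ G.α x then ⟨η', h⟩ else η

/-- `η - δ_x + δ_y` if there is a particle at `x`. -/
def hop (η : Config G σ) (x y : Fin (m + 1)) : Config G σ :=
  if 0 < η.1 x then changeTo η (η.1 - Pi.single x 1 + Pi.single y 1) else η

/-- `η - δ_x` if there is a particle at `x`. -/
def remove (η : Config G σ) (x : Fin (m + 1)) : Config G σ :=
  changeTo η (η.1 - Pi.single x 1)

/-- `η + δ_x`. -/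
def create (η : Config G σ) (x : Fin (m + 1)) : Config G σ :=
  changeTo η (η.1 + Pi.single x 1)

/-- The number `|ξ|` of particles of a dual configuration. -/
def size (ξ : DualConfig G σ) : ℕ :=
  ξ.2.1 + ξ.2.2 + ∑ x, ξ.1.1 x

variable (G σ)

/-- The generator of the bulk dynamics together with the two reservoirs. The sum over `x < y` is the
sum over unordered pairs of sites. -/
def generator (θL θR : ℝ) (f : Config G σ → ℝ) (η : Config G σ) : ℝ :=
  (∑ x, ∑ y ∈ Finset.Ioi x, G.ω x y *
    (η.1 x * (G.α y + (σ : ℝ) * η.1 y) * (f (hop η x y) - f η) +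
      η.1 y * (G.α x + (σ : ℝ) * η.1 x) * (f (hop η y x) - f η))) +
  G.ωL *
    (η.1 0 * (G.αL + (σ : ℝ) * (G.αL * θL)) * (f (remove η 0) - f η) +
      G.αL * θL * (G.α 0 + (σ : ℝ) * η.1 0) * (f (create η 0) - f η)) +
  G.ωR *
    (η.1 (Fin.last m) * (G.αR + (σ : ℝ) * (G.αR * θR)) * (f (remove η (Fin.last m)) - f η) +
      G.αR * θR * (G.α (Fin.last m) + (σ : ℝ) * η.1 (Fin.last m)) *
        (f (create η (Fin.last m)) - f η))

/-- The generator of the dual process, with absorbing sites `L` and `R`. -/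
def dualGenerator (f : DualConfig G σ → ℝ) (ξ : DualConfig G σ) : ℝ :=
  (∑ x, ∑ y ∈ Finset.Ioi x, G.ω x y *
    (ξ.1.1 x * (G.α y + (σ : ℝ) * ξ.1.1 y) * (f (hop ξ.1 x y, ξ.2) - f ξ) +
      ξ.1.1 y * (G.α x + (σ : ℝ) * ξ.1.1 x) * (f (hop ξ.1 y x, ξ.2) - f ξ))) +
  G.ωL * G.αL * ξ.1.1 0 * (f (remove ξ.1 0, ξ.2.1 + 1, ξ.2.2) - f ξ) +
  G.ωR * G.αR * ξ.1.1 (Fin.last m) *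
    (f (remove ξ.1 (Fin.last m), ξ.2.1, ξ.2.2 + 1) - f ξ)

/-! ### Interpolating product measures -/

/-- The set `Θ` of scale parameters: `[0, 1]` for exclusion and `[0, ∞)` otherwise. -/
def scaleSet : Set ℝ :=
  {θ | 0 ≤ θ ∧ (σ = -1 → θ ≤ 1)}

/-- `θ_R + b (θ_L - θ_R)`. -/
def interp (θL θR b : ℝ) : ℝ :=
  θR + b * (θL - θR)

/-- The weight of `n` under the single-site marginal with site parameter `a` and scale parameter
`θ`: Binomial`(a, θ)`, Poisson`(a θ)` and Negative-Binomial`(a, θ / (1 + θ))` for `σ = -1, 0, 1`. -/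
def marginalWeight (a : ℕ) (θ : ℝ) (n : ℕ) : ℝ :=
  match σ with
  | .neg => a.choose n * θ ^ n * (1 - θ) ^ (a - n)
  | .zero => Real.exp (-(a * θ)) * (a * θ) ^ n / n.factorial
  | .pos => a.ascFactorial n / n.factorial * (θ / (1 + θ)) ^ n / (1 + θ) ^ a

/-- The single-site marginal as a measure on `ℕ`. -/
def marginal (a : ℕ) (θ : ℝ) : Measure ℕ :=
  Measure.sum fun n => ENNReal.ofReal (marginalWeight σ a θ n) • Measure.dirac n

/-- The product over `x` of the marginals with scale parameters `θ_R + β_x (θ_L - θ_R)`, as a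
measure on configurations. -/
def interpolatingMeasure (θL θR : ℝ) (β : Fin (m + 1) → ℝ) : Measure (Config G σ) :=
  (Measure.pi fun x => marginal σ (G.α x) (interp θL θR (β x))).comap Subtype.val

/-! ### Interpolating orthogonal functions -/

/-- The hypergeometric polynomial `₂F₀(-k, -n; -; -u)`. -/
def hyp20 (k n : ℕ) (u : ℝ) : ℝ :=
  ∑ l ∈ Finset.range (k + 1), k.choose l * n.descFactorial l * u ^ l

/-- The hypergeometric polynomial `₂F₁(-k, -n; v; u)`, where `Γ(v + l) / Γ(v)` stands for
`v (v + 1) ⋯ (v + l - 1)`. -/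
def hyp21 (k n : ℕ) (v u : ℝ) : ℝ :=
  ∑ l ∈ Finset.range (k + 1),
    k.choose l * (n.descFactorial l / ∏ j ∈ Finset.range l, (v + j)) * u ^ l

/-- The weights `w(k)`. -/
def weight (a k : ℕ) : ℝ :=
  match σ with
  | .neg => a.descFactorial k
  | .zero => (a : ℝ) ^ k
  | .pos => a.ascFactorial k

/-- The classical single-site duality functions. -/
def classicalFn (a k n : ℕ) : ℝ :=
  n.descFactorial k / weight σ a k

/-- The orthogonal single-site duality functions with site parameter `a`; at `θ = 0` they are, by
convention and by continuity, the classical ones. -/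
def orthogonalFn (a : ℕ) (θ : ℝ) (k n : ℕ) : ℝ :=
  if θ = 0 then classicalFn σ a k n
  else
    (-θ) ^ k *
      match σ with
      | .neg => hyp21 k n (-a) (1 / θ)
      | .zero => hyp20 k n (-(1 / (θ * a)))
      | .pos => hyp21 k n a (-(1 / θ))

/-- The boundary factor of the orthogonal duality functions with scale parameter `θ`, at a reservoir
with scale parameter `θres`. -/
def boundaryFn (θres θ : ℝ) (k : ℕ) : ℝ :=
  (θres - θ) ^ k

/-- The interpolating orthogonal function. -/
def interpolatingFn (θL θR : ℝ) (β : Fin (m + 1) → ℝ) (ξ : DualConfig G σ) (η : Config G σ) : ℝ :=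
  boundaryFn θL θL ξ.2.1 *
    (∏ x, orthogonalFn σ (G.α x) (interp θL θR (β x)) (ξ.1.1 x) (η.1 x)) *
    boundaryFn θR θR ξ.2.2

/-! ### The coefficients -/

variable {G σ}

theorem finite_Iic (ξ : DualConfig G σ) : (Set.Iic ξ).Finite := by
  have h : Function.Injective
      (fun ζ : DualConfig G σ => ((ζ.1.1, ζ.2) : (Fin (m + 1) → ℕ) × ℕ × ℕ)) := by
    rintro ⟨⟨a, ha⟩, b⟩ ⟨⟨c, hc⟩, d⟩ hh
    simpa using hh
  refine (((Set.finite_Iic ξ.1.1).prod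
    ((Set.finite_Iic ξ.2.1).prod (Set.finite_Iic ξ.2.2))).preimage h.injOn).subset ?_
  intro ζ hζ
  exact ⟨hζ.1, hζ.2.1, hζ.2.2⟩

/-- The finite set of the dual configurations `ζ ≤ ξ`, for the coordinatewise order. -/
def below (ξ : DualConfig G σ) : Finset (DualConfig G σ) :=
  (finite_Iic ξ).toFinset

/-- `∏ x, binom(ξ(x), ζ(x)) (β'_x) ^ (ξ(x) - ζ(x))`, for `ζ ≤ ξ`. -/
def binomialFactor (β' : Fin (m + 1) → ℝ) (ξ ζ : DualConfig G σ) : ℝ :=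
  ∏ x, (ξ.1.1 x).choose (ζ.1.1 x) * β' x ^ (ξ.1.1 x - ζ.1.1 x)

/-- `Ê_ζ[1_{ζ_t(R) = 0} ∏ x, β_x ^ ζ_t(x)]`, for the dual process started from `ζ`. -/
def dualExpectation (β : Fin (m + 1) → ℝ) (t : ℝ) (ζ : DualConfig G σ) : ℝ :=
  ∫ ζ', (if ζ'.2.2 = 0 then ∏ x, β x ^ ζ'.1.1 x else 0) ∂(lawFrom (dualGenerator G σ) t ζ)

/-- The limit as `t → ∞` of the transition probabilities of the dual process. -/
def dualLimitProb (ζ ζ' : DualConfig G σ) : ℝ≥0∞ :=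
  limUnder atTop fun t : ℝ => transProb (dualGenerator G σ) t ζ ζ'

/-- The probability that the dual process started from `ζ` ends up with all particles in `L`. -/
def probAllLeft (ζ : DualConfig G σ) : ℝ :=
  (∑' ζ' : DualConfig G σ, if ζ'.2.1 = size ζ then dualLimitProb ζ ζ' else 0).toReal

/-- The coefficient `ψ` at time `t`. -/
def psiAt (β β' : Fin (m + 1) → ℝ) (t : ℝ) (ξ : DualConfig G σ) : ℝ :=
  ∑ ζ ∈ below ξ, (-1) ^ (size ξ - size ζ) * (binomialFactor β' ξ ζ * dualExpectation β t ζ)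

/-- The stationary coefficient `ψ`. -/
def psiStationary (β' : Fin (m + 1) → ℝ) (ξ : DualConfig G σ) : ℝ :=
  ∑ ζ ∈ below ξ, (-1) ^ (size ξ - size ζ) * (binomialFactor β' ξ ζ * probAllLeft ζ)

end BoundaryDriven

end

open BoundaryDriven

open MeasureTheory Filter Topology
open scoped ENNReal
open BoundaryDriven

noncomputable section

namespace BoundaryDriven

/-! ### Jump generators on a countable state space -/

section Generator

variable {S : Type*}

/-- `ℓ` is a finite nonnegative combination of the differences `f ↦ f r - f s`. -/
def IsJumpAt (s : S) (ℓ : (S → ℝ) → ℝ) : Prop :=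
  ∃ k : S →₀ ℝ, (∀ r, 0 ≤ k r) ∧ ∀ f, ℓ f = k.sum fun r c => c * (f r - f s)

/-- At each state, `L` has finitely many jumps, with nonnegative rates. -/
def IsJumpGenerator (L : (S → ℝ) → S → ℝ) : Prop :=
  ∀ s, IsJumpAt s fun f => L f s

theorem IsJumpAt.zero (s : S) : IsJumpAt s fun _ => 0 :=
  ⟨0, fun _ => le_rfl, fun _ => by simp⟩

theorem IsJumpAt.add {s : S} {ℓ ℓ' : (S → ℝ) → ℝ} (h : IsJumpAt s ℓ) (h' : IsJumpAt s ℓ') :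
    IsJumpAt s fun f => ℓ f + ℓ' f := by
  obtain ⟨k, hk, e⟩ := h
  obtain ⟨k', hk', e'⟩ := h'
  refine ⟨k + k', fun r => add_nonneg (hk r) (hk' r), fun f => ?_⟩
  classical
  dsimp only
  rw [Finsupp.sum_add_index' (by simp) (by intros; ring), e, e']

theorem IsJumpAt.const_mul {s : S} {ℓ : (S → ℝ) → ℝ} (h : IsJumpAt s ℓ) {c : ℝ} (hc : 0 ≤ c) :
    IsJumpAt s fun f => c * ℓ f := by
  obtain ⟨k, hk, e⟩ := h
  refine ⟨c • k, fun r => mul_nonneg hc (hk r), fun f => ?_⟩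
  dsimp only
  rw [Finsupp.sum_smul_index (by simp), e, Finsupp.mul_sum]
  exact Finsupp.sum_congr fun r _ => by ring

theorem IsJumpAt.diff (s r : S) : IsJumpAt s fun f => f r - f s := by
  refine ⟨Finsupp.single r 1, fun r' => ?_, fun f => by simp⟩
  classical
  rw [Finsupp.single_apply]
  split_ifs <;> simp

theorem IsJumpAt.mul_diff (s r : S) {c : ℝ} (hc : 0 ≤ c) :
    IsJumpAt s fun f => c * (f r - f s) :=
  (IsJumpAt.diff s r).const_mul hc

theorem IsJumpAt.sum {ι : Type*} {s : S} (A : Finset ι) {ℓ : ι → (S → ℝ) → ℝ}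
    (h : ∀ i ∈ A, IsJumpAt s (ℓ i)) : IsJumpAt s fun f => ∑ i ∈ A, ℓ i f := by
  classical
  induction A using Finset.induction_on with
  | empty => simpa using IsJumpAt.zero s
  | insert i A hi ih =>
    simp only [Finset.sum_insert hi]
    exact (h i (by simp)).add (ih fun j hj => h j (by simp [hj]))

variable {L : (S → ℝ) → S → ℝ}

theorem IsJumpGenerator.exists_finset (hL : IsJumpGenerator L) (s : S) :
    ∃ F : Finset S, s ∉ F ∧ (∀ r ≠ s, 0 ≤ rate L s r) ∧ (∀ r ∉ F, r ≠ s → rate L s r = 0) ∧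
      exitRate L s = ∑ r ∈ F, rate L s r ∧
      ∀ f, L f s = ∑ r ∈ F, rate L s r * (f r - f s) := by
  classical
  obtain ⟨k, hk, e⟩ := hL s
  have e' : ∀ f : S → ℝ, L f s = ∑ r ∈ k.support.erase s, k r * (f r - f s) := by
    intro f
    refine (e f).trans ?_
    rw [Finsupp.sum]
    by_cases h : s ∈ k.support
    · rw [← Finset.add_sum_erase _ _ h]; simp
    · rw [Finset.erase_eq_of_notMem h]
  have hr : ∀ r ≠ s, rate L s r = k r := by
    intro r hrs
    rw [rate, e' _]
    by_cases h : r ∈ k.support.erase s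
    · rw [Finset.sum_eq_single_of_mem r h]
      · simp [hrs.symm]
      · intro b _ hb; simp [hb, hrs.symm]
    · rw [Finset.sum_eq_zero]
      · simp only [Finset.mem_erase, ne_eq, hrs, not_false_eq_true, true_and,
          Finsupp.mem_support_iff, not_not] at h
        exact h.symm
      · intro b hb
        have : b ≠ r := fun hbr => h (hbr ▸ hb)
        simp [this, hrs.symm]
  refine ⟨k.support.erase s, by simp, fun r h => by rw [hr r h]; exact hk r, ?_, ?_, ?_⟩
  · intro r h1 h2
    rw [hr r h2]
    simpa [h2] using h1
  · rw [exitRate, rate, e' _, ← Finset.sum_neg_distrib]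
    refine Finset.sum_congr rfl fun r h => ?_
    have h' := Finset.ne_of_mem_erase h
    rw [hr r h']
    simp [h']
  · intro f
    rw [e' f]
    refine Finset.sum_congr rfl fun r h => ?_
    rw [hr r (Finset.ne_of_mem_erase h)]

/-- A finite set carrying all the jumps out of `s`. -/
def jumpSet (hL : IsJumpGenerator L) (s : S) : Finset S := (hL.exists_finset s).choose

theorem not_mem_jumpSet (hL : IsJumpGenerator L) (s : S) : s ∉ jumpSet hL s :=
  (hL.exists_finset s).choose_spec.1

theorem rate_nonneg (hL : IsJumpGenerator L) {s r : S} (h : r ≠ s) : 0 ≤ rate L s r :=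
  (hL.exists_finset s).choose_spec.2.1 r h

theorem rate_nonneg_of_mem (hL : IsJumpGenerator L) {s r : S} (h : r ∈ jumpSet hL s) :
    0 ≤ rate L s r :=
  rate_nonneg hL fun e => not_mem_jumpSet hL s (e ▸ h)

theorem rate_eq_zero (hL : IsJumpGenerator L) {s r : S} (h : r ∉ jumpSet hL s) (h' : r ≠ s) :
    rate L s r = 0 :=
  (hL.exists_finset s).choose_spec.2.2.1 r h h'

theorem exitRate_eq (hL : IsJumpGenerator L) (s : S) :
    exitRate L s = ∑ r ∈ jumpSet hL s, rate L s r :=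
  (hL.exists_finset s).choose_spec.2.2.2.1

theorem exitRate_nonneg (hL : IsJumpGenerator L) (s : S) : 0 ≤ exitRate L s := by
  rw [exitRate_eq hL]
  exact Finset.sum_nonneg fun r h => rate_nonneg_of_mem hL h

theorem IsJumpGenerator.apply_eq (hL : IsJumpGenerator L) (f : S → ℝ) (s : S) :
    L f s = ∑ r ∈ jumpSet hL s, rate L s r * (f r - f s) :=
  (hL.exists_finset s).choose_spec.2.2.2.2 f

theorem sum_rate_mul (hL : IsJumpGenerator L) (f : S → ℝ) (s : S) :
    ∑ r ∈ jumpSet hL s, rate L s r * f r = exitRate L s * f s + L f s := by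
  rw [hL.apply_eq, exitRate_eq hL, Finset.sum_mul, ← Finset.sum_add_distrib]
  exact Finset.sum_congr rfl fun r _ => by ring

theorem tsum_rate_mul (hL : IsJumpGenerator L) (g : S → ℝ≥0∞) (s : S)
    [∀ r : S, Decidable (r = s)] :
    ∑' r, (if r = s then 0 else ENNReal.ofReal (rate L s r)) * g r =
      ∑ r ∈ jumpSet hL s, ENNReal.ofReal (rate L s r) * g r := by
  rw [tsum_eq_sum (s := jumpSet hL s)]
  · refine Finset.sum_congr rfl fun r h => ?_
    rw [if_neg fun e : r = s => not_mem_jumpSet hL s (e ▸ h)]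
  · intro r h
    by_cases hrs : r = s
    · simp [hrs]
    · simp [hrs, rate_eq_zero hL h hrs]

theorem IsJumpGenerator.map_add (hL : IsJumpGenerator L) (f g : S → ℝ) :
    L (f + g) = L f + L g := by
  ext s
  simp only [Pi.add_apply, hL.apply_eq, ← Finset.sum_add_distrib]
  exact Finset.sum_congr rfl fun r _ => by ring

theorem IsJumpGenerator.map_smul (hL : IsJumpGenerator L) (c : ℝ) (f : S → ℝ) :
    L (c • f) = c • L f := by
  ext s
  simp only [Pi.smul_apply, smul_eq_mul, hL.apply_eq, Finset.mul_sum]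
  exact Finset.sum_congr rfl fun r _ => by ring

theorem IsJumpGenerator.const (hL : IsJumpGenerator L) (c : ℝ) (s : S) :
    L (fun _ => c) s = 0 := by
  simp [hL.apply_eq]

end Generator

/-! ### The backward equation of the minimal process -/

section Backward

variable {S : Type*} {L : (S → ℝ) → S → ℝ}

theorem measurable_lintegral_Ioc {F : ℝ → ℝ → ℝ≥0∞} (hF : Measurable (Function.uncurry F)) :
    Measurable fun t => ∫⁻ u in Set.Ioc 0 t, F t u := by
  have h : ∀ t, ∫⁻ u in Set.Ioc 0 t, F t u =
      ∫⁻ u, ({p : ℝ × ℝ | 0 < p.2 ∧ p.2 ≤ p.1}.indicator (Function.uncurry F)) (t, u) := by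
    intro t
    rw [← lintegral_indicator measurableSet_Ioc]
    rfl
  simp_rw [h]
  refine Measurable.lintegral_prod_right' (hF.indicator ?_)
  exact (measurableSet_lt measurable_const measurable_snd).inter
    (measurableSet_le measurable_snd measurable_fst)

open Classical in
theorem measurable_transAux [Countable S] (n : ℕ) (s s' : S) :
    Measurable fun t => transAux L n t s s' := by
  induction n generalizing s with
  | zero =>
    simp only [transAux]
    split_ifs <;> fun_prop
  | succ n ih =>
    simp only [transAux]
    refine Measurable.add (by split_ifs <;> fun_prop) (measurable_lintegral_Ioc
      (F := fun t u => ENNReal.ofReal (Real.exp (-(exitRate L s * u))) *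
          ∑' r, (if r = s then 0 else ENNReal.ofReal (rate L s r)) * transAux L n (t - u) r s') ?_)
    refine Measurable.mul (by fun_prop) (Measurable.tsum fun r => ?_)
    exact ((ih r).comp (measurable_fst.sub measurable_snd)).const_mul _

theorem transAux_mono (n : ℕ) (t : ℝ) (s s' : S) :
    transAux L n t s s' ≤ transAux L (n + 1) t s s' := by
  induction n generalizing t s with
  | zero =>
    simp only [transAux]
    exact le_self_add
  | succ n ih =>
    rw [transAux, transAux]
    gcongr
    exact ih _ _

/-- The expectation of `f` under the process with at most `n` jumps. -/
def truncSemigroup (L : (S → ℝ) → S → ℝ) (n : ℕ) (f : S → ℝ≥0∞) (t : ℝ) (s : S) : ℝ≥0∞ :=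
  ∑' s', transAux L n t s s' * f s'

/-- The expectation of `f` under the minimal process. -/
def semigroup (L : (S → ℝ) → S → ℝ) (f : S → ℝ≥0∞) (t : ℝ) (s : S) : ℝ≥0∞ :=
  ∑' s', transProb L t s s' * f s'

theorem truncSemigroup_zero (f : S → ℝ≥0∞) (t : ℝ) (s : S) :
    truncSemigroup L 0 f t s = ENNReal.ofReal (Real.exp (-(exitRate L s * t))) * f s := by
  rw [truncSemigroup, tsum_eq_single s]
  · simp [transAux]
  · intro r hr
    simp [transAux, hr.symm]

theorem truncSemigroup_succ [Countable S] (hL : IsJumpGenerator L) (n : ℕ) (f : S → ℝ≥0∞) (t : ℝ)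
    (s : S) :
    truncSemigroup L (n + 1) f t s =
      ENNReal.ofReal (Real.exp (-(exitRate L s * t))) * f s +
        ∫⁻ u in Set.Ioc 0 t, ENNReal.ofReal (Real.exp (-(exitRate L s * u))) *
          ∑ r ∈ jumpSet hL s, ENNReal.ofReal (rate L s r) * truncSemigroup L n f (t - u) r := by
  classical
  rw [truncSemigroup]
  simp only [transAux, add_mul]
  rw [ENNReal.tsum_add]
  congr 1
  · rw [tsum_eq_single s]
    · simp
    · intro r hr
      simp [hr.symm]
  · have hm : ∀ s', Measurable fun u => ENNReal.ofReal (Real.exp (-(exitRate L s * u))) *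
        ∑ r ∈ jumpSet hL s, ENNReal.ofReal (rate L s r) * transAux L n (t - u) r s' := by
      intro s'
      refine Measurable.mul (by fun_prop) (Finset.measurable_sum _ fun r _ => ?_)
      exact ((measurable_transAux n r s').comp (measurable_const.sub measurable_id)).const_mul _
    simp only [tsum_rate_mul hL]
    simp_rw [← lintegral_mul_const _ (hm _)]
    rw [← lintegral_tsum fun s' => ((hm s').mul_const _).aemeasurable]
    refine lintegral_congr fun u => ?_
    simp_rw [mul_assoc]
    rw [ENNReal.tsum_mul_left]
    congr 1
    simp_rw [Finset.sum_mul, truncSemigroup]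
    rw [Summable.tsum_finsetSum fun _ _ => ENNReal.summable]
    refine Finset.sum_congr rfl fun r _ => ?_
    simp_rw [mul_assoc]
    rw [ENNReal.tsum_mul_left]

theorem truncSemigroup_mono (f : S → ℝ≥0∞) (t : ℝ) (s : S) :
    Monotone fun n => truncSemigroup L n f t s := by
  refine monotone_nat_of_le_succ fun n => ?_
  exact ENNReal.tsum_le_tsum fun s' => mul_le_mul_left (transAux_mono n t s s') _

theorem measurable_truncSemigroup [Countable S] (n : ℕ) (f : S → ℝ≥0∞) (s : S) :
    Measurable fun t => truncSemigroup L n f t s :=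
  Measurable.tsum fun s' => (measurable_transAux n s s').mul_const _

theorem semigroup_eq_iSup (f : S → ℝ≥0∞) (t : ℝ) (s : S) :
    semigroup L f t s = ⨆ n, truncSemigroup L n f t s := by
  let _ : MeasurableSpace S := ⊤
  have := lintegral_iSup (μ := Measure.count) (f := fun n s' => transAux L n t s s' * f s')
    (fun n => measurable_from_top) (monotone_nat_of_le_succ fun n s' =>
      mul_le_mul_left (transAux_mono n t s s') _)
  simp only [lintegral_count] at this
  simp only [semigroup, truncSemigroup, transProb, ← this, ENNReal.iSup_mul]

theorem measurable_semigroup [Countable S] (f : S → ℝ≥0∞) (s : S) :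
    Measurable fun t => semigroup L f t s := by
  simp_rw [semigroup_eq_iSup]
  exact Measurable.iSup fun n => measurable_truncSemigroup n f s

theorem semigroup_backward [Countable S] (hL : IsJumpGenerator L) (f : S → ℝ≥0∞) (t : ℝ) (s : S) :
    semigroup L f t s =
      ENNReal.ofReal (Real.exp (-(exitRate L s * t))) * f s +
        ∫⁻ u in Set.Ioc 0 t, ENNReal.ofReal (Real.exp (-(exitRate L s * u))) *
          ∑ r ∈ jumpSet hL s, ENNReal.ofReal (rate L s r) * semigroup L f (t - u) r := by
  have hmono : Monotone fun n => fun u => ENNReal.ofReal (Real.exp (-(exitRate L s * u))) *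
      ∑ r ∈ jumpSet hL s, ENNReal.ofReal (rate L s r) * truncSemigroup L n f (t - u) r := by
    intro n k hnk u
    dsimp only
    gcongr
    exact truncSemigroup_mono f _ _ hnk
  have hmeas : ∀ n, Measurable fun u => ENNReal.ofReal (Real.exp (-(exitRate L s * u))) *
      ∑ r ∈ jumpSet hL s, ENNReal.ofReal (rate L s r) * truncSemigroup L n f (t - u) r := by
    intro n
    refine Measurable.mul (by fun_prop) (Finset.measurable_sum _ fun r _ => ?_)
    exact ((measurable_truncSemigroup n f r).comp
      (measurable_const.sub measurable_id)).const_mul _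
  rw [semigroup_eq_iSup, ← (truncSemigroup_mono f t s).iSup_nat_add 1]
  simp_rw [truncSemigroup_succ hL]
  rw [← ENNReal.add_iSup, ← lintegral_iSup hmeas hmono]
  congr 1
  refine lintegral_congr fun u => ?_
  rw [← ENNReal.mul_iSup]
  congr 1
  simp_rw [semigroup_eq_iSup, ENNReal.mul_iSup]
  rw [ENNReal.finsetSum_iSup_of_monotone]
  intro r n k hnk
  dsimp only
  gcongr
  exact truncSemigroup_mono f _ _ hnk

theorem lintegral_lawFrom [MeasurableSpace S] [MeasurableSingletonClass S] (f : S → ℝ≥0∞) (t : ℝ)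
    (s : S) : ∫⁻ s', f s' ∂(lawFrom L t s) = semigroup L f t s := by
  simp [lawFrom, semigroup, lintegral_sum_measure, lintegral_smul_measure]

end Backward

/-! ### Uniqueness for the backward equation -/

section Uniqueness

variable {S : Type*} {L : (S → ℝ) → S → ℝ}

theorem intervalIntegral_duhamel {U U' : ℝ → ℝ} (q t : ℝ) (hU : ∀ x, HasDerivAt U (U' x) x)
    (hU' : Continuous U') :
    ∫ w in (0 : ℝ)..t, Real.exp (-(q * w)) * (q * U (t - w) + U' (t - w)) =
      U t - Real.exp (-(q * t)) * U 0 := by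
  have hUc : Continuous U := continuous_iff_continuousAt.2 fun x => (hU x).continuousAt
  have hd : ∀ w ∈ Set.uIcc 0 t, HasDerivAt (fun w => -(Real.exp (-(q * w)) * U (t - w)))
      (Real.exp (-(q * w)) * (q * U (t - w) + U' (t - w))) w := by
    intro w _
    have h1 : HasDerivAt (fun w => Real.exp (-(q * w))) (Real.exp (-(q * w)) * -(q * 1)) w :=
      ((hasDerivAt_id w).const_mul q).neg.exp
    have h2 : HasDerivAt (fun w => U (t - w)) (U' (t - w) * (-1)) w :=
      (hU (t - w)).comp w ((hasDerivAt_id w).const_sub t)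
    exact (h1.mul h2).neg.congr_deriv (by ring)
  rw [intervalIntegral.integral_eq_sub_of_hasDerivAt hd (by
    apply Continuous.intervalIntegrable; fun_prop)]
  simp
  ring

theorem intervalIntegral_exp_duhamel (q c t a : ℝ) :
    ∫ w in (0 : ℝ)..t, Real.exp (-(q * w)) * ((q + c) * (Real.exp (c * (t - w)) * a)) =
      Real.exp (c * t) * a - Real.exp (-(q * t)) * a := by
  have := intervalIntegral_duhamel (U := fun t => Real.exp (c * t) * a)
    (U' := fun t => c * (Real.exp (c * t) * a)) q t (fun x => by
      have := (((hasDerivAt_id x).const_mul c).exp).mul_const a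
      exact this.congr_deriv (by simp only [id]; ring)) (by fun_prop)
  simp only [mul_zero, Real.exp_zero, one_mul] at this
  rw [← this]
  congr 1
  ext w
  ring

/-- `V ≤ W` are Lyapunov functions with exponential growth rate `c`, and `V` is negligible with
respect to `W` outside finite sets. -/
structure IsLyapunovPair (L : (S → ℝ) → S → ℝ) (c : ℝ) (V W : S → ℝ) : Prop where
  nonneg : 0 ≤ c
  one_le : ∀ s, 1 ≤ V s
  le : ∀ s, V s ≤ W s
  apply_le : ∀ s, L V s ≤ c * V s
  apply_le' : ∀ s, L W s ≤ c * W s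
  finite : ∀ ε > 0, {s | ε * W s < V s}.Finite

variable {c : ℝ} {V W : S → ℝ}

theorem truncSemigroup_le [Countable S] (hL : IsJumpGenerator L) (hV0 : ∀ s, 0 ≤ V s)
    (hV : ∀ s, L V s ≤ c * V s) (n : ℕ) (s : S) {t : ℝ} (ht : 0 ≤ t) :
    truncSemigroup L n (fun s => ENNReal.ofReal (V s)) t s ≤
      ENNReal.ofReal (Real.exp (c * t) * V s) := by
  have hpos : ∀ (s : S) (t : ℝ), 0 ≤ (exitRate L s + c) * (Real.exp (c * t) * V s) := by
    intro s t
    have h1 : 0 ≤ (exitRate L s + c) * V s := by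
      have := sum_rate_mul hL V s
      have h2 : 0 ≤ ∑ r ∈ jumpSet hL s, rate L s r * V r :=
        Finset.sum_nonneg fun r hr => mul_nonneg (rate_nonneg_of_mem hL hr) (hV0 r)
      have := hV s
      linarith
    nlinarith [Real.exp_pos (c * t)]
  have hint : ∀ (s : S) {t : ℝ}, 0 ≤ t →
      0 ≤ Real.exp (c * t) * V s - Real.exp (-(exitRate L s * t)) * V s := by
    intro s t ht
    rw [← intervalIntegral_exp_duhamel]
    exact intervalIntegral.integral_nonneg ht fun w _ => mul_nonneg (Real.exp_nonneg _) (hpos _ _)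
  induction n generalizing s t with
  | zero =>
    rw [truncSemigroup_zero, ← ENNReal.ofReal_mul (Real.exp_nonneg _)]
    exact ENNReal.ofReal_le_ofReal (by linarith [hint s ht])
  | succ n ih =>
    rw [truncSemigroup_succ hL, ← ENNReal.ofReal_mul (Real.exp_nonneg _)]
    have key : ∫⁻ u in Set.Ioc 0 t, ENNReal.ofReal (Real.exp (-(exitRate L s * u))) *
          ∑ r ∈ jumpSet hL s, ENNReal.ofReal (rate L s r) *
            truncSemigroup L n (fun s => ENNReal.ofReal (V s)) (t - u) r ≤
        ENNReal.ofReal (Real.exp (c * t) * V s - Real.exp (-(exitRate L s * t)) * V s) := by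
      rw [← intervalIntegral_exp_duhamel, intervalIntegral.integral_of_le ht,
        ofReal_integral_eq_lintegral_ofReal]
      · refine setLIntegral_mono' measurableSet_Ioc fun u hu => ?_
        rw [ENNReal.ofReal_mul (Real.exp_nonneg _)]
        gcongr
        calc ∑ r ∈ jumpSet hL s, ENNReal.ofReal (rate L s r) *
              truncSemigroup L n (fun s => ENNReal.ofReal (V s)) (t - u) r
            ≤ ∑ r ∈ jumpSet hL s, ENNReal.ofReal (rate L s r) *
              ENNReal.ofReal (Real.exp (c * (t - u)) * V r) := by
              gcongr with r hr
              exact ih r (by linarith [hu.2])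
          _ = ENNReal.ofReal (∑ r ∈ jumpSet hL s, rate L s r * (Real.exp (c * (t - u)) * V r)) := by
              rw [ENNReal.ofReal_sum_of_nonneg]
              · refine Finset.sum_congr rfl fun r hr => ?_
                rw [← ENNReal.ofReal_mul (rate_nonneg_of_mem hL hr)]
              · intro r hr
                exact mul_nonneg (rate_nonneg_of_mem hL hr) (mul_nonneg (Real.exp_nonneg _) (hV0 r))
          _ ≤ _ := by
              refine ENNReal.ofReal_le_ofReal ?_
              have : ∑ r ∈ jumpSet hL s, rate L s r * (Real.exp (c * (t - u)) * V r) =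
                  Real.exp (c * (t - u)) * ∑ r ∈ jumpSet hL s, rate L s r * V r := by
                rw [Finset.mul_sum]
                exact Finset.sum_congr rfl fun r _ => by ring
              rw [this, sum_rate_mul hL, mul_left_comm, add_mul]
              have := hV s
              gcongr
      · have hc : Continuous fun w => Real.exp (-(exitRate L s * w)) *
            ((exitRate L s + c) * (Real.exp (c * (t - w)) * V s)) := by fun_prop
        exact (hc.intervalIntegrable 0 t).1
      · exact ae_of_all _ fun w => mul_nonneg (Real.exp_nonneg _) (hpos _ _)
    refine (add_le_add le_rfl key).trans ?_
    rw [← ENNReal.ofReal_add (mul_nonneg (Real.exp_nonneg _) (hV0 s)) (hint s ht)]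
    exact ENNReal.ofReal_le_ofReal (by linarith)

theorem semigroup_le [Countable S] (hL : IsJumpGenerator L) (hV0 : ∀ s, 0 ≤ V s)
    (hV : ∀ s, L V s ≤ c * V s) (s : S) {t : ℝ} (ht : 0 ≤ t) :
    semigroup L (fun s => ENNReal.ofReal (V s)) t s ≤ ENNReal.ofReal (Real.exp (c * t) * V s) := by
  rw [semigroup_eq_iSup]
  exact iSup_le fun n => truncSemigroup_le hL hV0 hV n s ht

theorem semigroup_mono {f g : S → ℝ≥0∞} (h : ∀ s, f s ≤ g s) (t : ℝ) (s : S) :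
    semigroup L f t s ≤ semigroup L g t s :=
  ENNReal.tsum_le_tsum fun s' => by gcongr; exact h s'

theorem semigroup_const_mul (K : ℝ≥0∞) (f : S → ℝ≥0∞) (t : ℝ) (s : S) :
    semigroup L (fun s => K * f s) t s = K * semigroup L f t s := by
  simp only [semigroup, ← ENNReal.tsum_mul_left]
  exact tsum_congr fun _ => by ring

theorem semigroup_le_mul [Countable S] (hL : IsJumpGenerator L) (hVW : IsLyapunovPair L c V W)
    {f : S → ℝ} {K : ℝ} (hK : 0 ≤ K) (hf : ∀ s, f s ≤ K * V s) (s : S) {t : ℝ} (ht : 0 ≤ t) :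
    semigroup L (fun s => ENNReal.ofReal (f s)) t s ≤
      ENNReal.ofReal (K * (Real.exp (c * t) * V s)) := by
  have hV0 : ∀ s, 0 ≤ V s := fun s => zero_le_one.trans (hVW.one_le s)
  calc _ ≤ semigroup L (fun s => ENNReal.ofReal K * ENNReal.ofReal (V s)) t s := by
        refine semigroup_mono (fun s => ?_) t s
        rw [← ENNReal.ofReal_mul hK]
        exact ENNReal.ofReal_le_ofReal (hf s)
    _ ≤ _ := by
        rw [semigroup_const_mul, ENNReal.ofReal_mul hK]
        gcongr
        exact semigroup_le hL hV0 hVW.apply_le s ht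

/-- The backward equation for a nonnegative real function dominated by `V`. -/
theorem toReal_semigroup_backward [Countable S] (hL : IsJumpGenerator L)
    (hVW : IsLyapunovPair L c V W) {f : S → ℝ} (hf0 : ∀ s, 0 ≤ f s) {K : ℝ} (hK : 0 ≤ K)
    (hf : ∀ s, f s ≤ K * V s) (s : S) {t : ℝ} (ht : 0 ≤ t) :
    IntervalIntegrable (fun w => Real.exp (-(exitRate L s * w)) * ∑ r ∈ jumpSet hL s,
        rate L s r * (semigroup L (fun s => ENNReal.ofReal (f s)) (t - w) r).toReal) volume 0 t ∧
      (semigroup L (fun s => ENNReal.ofReal (f s)) t s).toReal =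
        Real.exp (-(exitRate L s * t)) * f s +
        ∫ w in (0 : ℝ)..t, Real.exp (-(exitRate L s * w)) * ∑ r ∈ jumpSet hL s,
          rate L s r * (semigroup L (fun s => ENNReal.ofReal (f s)) (t - w) r).toReal := by
  have hle := fun (r : S) (t : ℝ) (ht : 0 ≤ t) => semigroup_le_mul hL hVW hK hf r ht
  set p := semigroup L (fun s => ENNReal.ofReal (f s)) with hp
  have hfin : ∀ r t, 0 ≤ t → p t r ≠ ⊤ := fun r t ht =>
    ne_top_of_le_ne_top ENNReal.ofReal_ne_top (hle r t ht)
  have hmeasE : Measurable fun u => ENNReal.ofReal (Real.exp (-(exitRate L s * u))) *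
          ∑ r ∈ jumpSet hL s, ENNReal.ofReal (rate L s r) * p (t - u) r := by
    refine Measurable.mul (by fun_prop) (Finset.measurable_sum _ fun r _ => ?_)
    exact ((measurable_semigroup _ r).comp (measurable_const.sub measurable_id)).const_mul _
  have hpt : ∀ u ∈ Set.Ioc 0 t, ENNReal.ofReal (Real.exp (-(exitRate L s * u))) *
          ∑ r ∈ jumpSet hL s, ENNReal.ofReal (rate L s r) * p (t - u) r =
      ENNReal.ofReal (Real.exp (-(exitRate L s * u)) *
        ∑ r ∈ jumpSet hL s, rate L s r * (p (t - u) r).toReal) := by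
    intro u hu
    rw [ENNReal.ofReal_mul (Real.exp_nonneg _), ENNReal.ofReal_sum_of_nonneg]
    · congr 1
      refine Finset.sum_congr rfl fun r hr => ?_
      rw [ENNReal.ofReal_mul (rate_nonneg_of_mem hL hr),
        ENNReal.ofReal_toReal (hfin r _ (by linarith [hu.2]))]
    · intro r hr
      exact mul_nonneg (rate_nonneg_of_mem hL hr) ENNReal.toReal_nonneg
  have hback := semigroup_backward hL (fun s => ENNReal.ofReal (f s)) t s
  rw [← hp] at hback
  have hIfin : ∫⁻ u in Set.Ioc 0 t, ENNReal.ofReal (Real.exp (-(exitRate L s * u))) *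
          ∑ r ∈ jumpSet hL s, ENNReal.ofReal (rate L s r) * p (t - u) r ≠ ⊤ := by
    refine ne_top_of_le_ne_top (hfin s t ht) ?_
    rw [hback]
    exact le_add_self
  have hnn : ∀ u, 0 ≤ Real.exp (-(exitRate L s * u)) *
        ∑ r ∈ jumpSet hL s, rate L s r * (p (t - u) r).toReal := fun u =>
    mul_nonneg (Real.exp_nonneg _) (Finset.sum_nonneg fun r hr =>
      mul_nonneg (rate_nonneg_of_mem hL hr) ENNReal.toReal_nonneg)
  have hmeasR : Measurable fun u => Real.exp (-(exitRate L s * u)) *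
        ∑ r ∈ jumpSet hL s, rate L s r * (p (t - u) r).toReal := by
    refine Measurable.mul (by fun_prop) (Finset.measurable_sum _ fun r _ => ?_)
    exact ((measurable_semigroup _ r).comp
      (measurable_const.sub measurable_id)).ennreal_toReal.const_mul _
  rw [setLIntegral_congr_fun measurableSet_Ioc hpt] at hback hIfin
  constructor
  · rw [intervalIntegrable_iff_integrableOn_Ioc_of_le ht]
    refine ⟨hmeasR.aestronglyMeasurable, ?_⟩
    rw [hasFiniteIntegral_iff_ofReal (ae_of_all _ hnn)]
    exact hIfin.lt_top
  · rw [hback, ENNReal.toReal_add (by finiteness) hIfin, ENNReal.toReal_mul,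
      ENNReal.toReal_ofReal (Real.exp_nonneg _), ENNReal.toReal_ofReal (hf0 s),
      intervalIntegral.integral_of_le ht,
      integral_eq_lintegral_of_nonneg_ae (ae_of_all _ hnn) hmeasR.aestronglyMeasurable]

/-- A solution of the homogeneous backward equation with zero initial condition which is dominated
by `V` is dominated by any multiple of `W`. -/
theorem abs_le_of_backward (hL : IsJumpGenerator L) (hVW : IsLyapunovPair L c V W) {T : ℝ}
    {h : ℝ → S → ℝ} {K : ℝ} (hK : 0 ≤ K) (hbound : ∀ t ∈ Set.Icc 0 T, ∀ s, |h t s| ≤ K * V s)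
    (heq : ∀ t ∈ Set.Icc 0 T, ∀ s, h t s = ∫ w in (0 : ℝ)..t, Real.exp (-(exitRate L s * w)) *
      ∑ r ∈ jumpSet hL s, rate L s r * h (t - w) r) {t : ℝ} (ht : t ∈ Set.Icc 0 T) (s : S) :
    h t s = 0 := by
  have hc := hVW.nonneg
  have hV1 : ∀ s, 0 < V s := fun s => zero_lt_one.trans_le (hVW.one_le s)
  have hW1 : ∀ s, 0 < W s := fun s => (hV1 s).trans_le (hVW.le s)
  -- contraction at each state
  have step : ∀ M, 0 ≤ M → (∀ t ∈ Set.Icc 0 T, ∀ s, |h t s| ≤ M * (Real.exp ((c + 1) * t) * W s)) →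
      ∀ t ∈ Set.Icc 0 T, ∀ s, |h t s| ≤ (exitRate L s + c) / (exitRate L s + c + 1) *
        (M * (Real.exp ((c + 1) * t) * W s)) := by
    intro M hM hM' t ht s
    have hq := exitRate_nonneg hL s
    have hpt : ∀ w ∈ Set.Icc 0 t, ‖Real.exp (-(exitRate L s * w)) *
        ∑ r ∈ jumpSet hL s, rate L s r * h (t - w) r‖ ≤
        (exitRate L s + c) / (exitRate L s + c + 1) * M * (Real.exp (-(exitRate L s * w)) *
          ((exitRate L s + (c + 1)) * (Real.exp ((c + 1) * (t - w)) * W s))) := by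
      intro w hw
      rw [norm_mul, Real.norm_of_nonneg (Real.exp_nonneg _)]
      have h1 : ‖∑ r ∈ jumpSet hL s, rate L s r * h (t - w) r‖ ≤
          M * Real.exp ((c + 1) * (t - w)) * ((exitRate L s + c) * W s) := by
        calc ‖∑ r ∈ jumpSet hL s, rate L s r * h (t - w) r‖
            ≤ ∑ r ∈ jumpSet hL s, ‖rate L s r * h (t - w) r‖ := norm_sum_le _ _
          _ ≤ ∑ r ∈ jumpSet hL s, rate L s r * (M * (Real.exp ((c + 1) * (t - w)) * W r)) := by
              refine Finset.sum_le_sum fun r hr => ?_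
              rw [norm_mul, Real.norm_of_nonneg (rate_nonneg_of_mem hL hr)]
              exact mul_le_mul_of_nonneg_left
                (hM' _ ⟨by linarith [hw.2], by linarith [hw.1, ht.2]⟩ r)
                (rate_nonneg_of_mem hL hr)
          _ = M * Real.exp ((c + 1) * (t - w)) * ∑ r ∈ jumpSet hL s, rate L s r * W r := by
              rw [Finset.mul_sum]
              exact Finset.sum_congr rfl fun r _ => by ring
          _ ≤ _ := by
              rw [sum_rate_mul hL]
              have := hVW.apply_le' s
              have h3 : exitRate L s * W s + L W s ≤ (exitRate L s + c) * W s := by linarith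
              gcongr
      refine (mul_le_mul_of_nonneg_left h1 (Real.exp_nonneg _)).trans_eq ?_
      field_simp
      ring
    rw [heq t ht s]
    have h2 := intervalIntegral.norm_integral_le_of_norm_le ht.1
      (ae_of_all volume fun w hw => hpt w ⟨hw.1.le, hw.2⟩)
      (Continuous.intervalIntegrable (by fun_prop) 0 t)
    rw [intervalIntegral.integral_const_mul, intervalIntegral_exp_duhamel] at h2
    refine h2.trans ?_
    rw [mul_assoc]
    have := (mul_pos (Real.exp_pos (-(exitRate L s * t))) (hW1 s)).le
    gcongr
    linarith
  -- comparison with small multiples of `W`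
  have small : ∀ ε > 0, |h t s| ≤ ε * (Real.exp ((c + 1) * t) * W s) := by
    intro ε hε
    obtain ⟨Q, hQ0, hQ⟩ : ∃ Q, 0 ≤ Q ∧ ∀ s, ε / (K + 1) * W s < V s → exitRate L s ≤ Q := by
      obtain ⟨Q, hQ⟩ := ((hVW.finite (ε / (K + 1)) (by positivity)).image (exitRate L)).bddAbove
      refine ⟨max Q 0, le_max_right _ _, fun s hs => le_max_of_le_left (hQ ⟨s, hs, rfl⟩)⟩
    set ρ := (Q + c) / (Q + c + 1) with hρ
    have hρ0 : 0 ≤ ρ := by positivity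
    have hρ1 : ρ < 1 := by rw [hρ, div_lt_one (by positivity)]; linarith
    have hexp : ∀ t ∈ Set.Icc 0 T, 1 ≤ Real.exp ((c + 1) * t) := fun t ht =>
      Real.one_le_exp (mul_nonneg (by linarith) ht.1)
    have iter : ∀ n : ℕ, ∀ t ∈ Set.Icc 0 T, ∀ s,
        |h t s| ≤ max ε (ρ ^ n * K) * (Real.exp ((c + 1) * t) * W s) := by
      intro n
      induction n with
      | zero =>
        intro t ht s
        calc |h t s| ≤ K * V s := hbound t ht s
          _ ≤ K * (1 * W s) := by rw [one_mul]; gcongr; exact hVW.le s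
          _ ≤ max ε (ρ ^ 0 * K) * (Real.exp ((c + 1) * t) * W s) := by
              have := hexp t ht
              have := hW1 s
              gcongr
              simp
      | succ n ih =>
        intro t ht s
        have hWs := hW1 s
        have he := hexp t ht
        by_cases hs : ε / (K + 1) * W s < V s
        · refine (step _ (le_max_of_le_left hε.le) ih t ht s).trans ?_
          rw [← mul_assoc]
          gcongr
          have hq := exitRate_nonneg hL s
          have h1 : (exitRate L s + c) / (exitRate L s + c + 1) ≤ ρ := by
            rw [hρ, div_le_div_iff₀ (by positivity) (by positivity)]
            nlinarith [hQ s hs]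
          have hmax : 0 ≤ max ε (ρ ^ n * K) := le_max_of_le_left hε.le
          refine (mul_le_mul_of_nonneg_right h1 hmax).trans ?_
          rw [mul_max_of_nonneg _ _ hρ0]
          refine max_le_max ?_ (le_of_eq (by ring))
          nlinarith
        · rw [not_lt] at hs
          calc |h t s| ≤ K * V s := hbound t ht s
            _ ≤ (K + 1) * (ε / (K + 1) * W s) := by
                have := hV1 s
                gcongr
                linarith
            _ = ε * (1 * W s) := by field_simp
            _ ≤ _ := by
                gcongr
                exact le_max_left _ _
    have hlim : Tendsto (fun n : ℕ => max ε (ρ ^ n * K) * (Real.exp ((c + 1) * t) * W s)) atTop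
        (𝓝 (max ε (0 * K) * (Real.exp ((c + 1) * t) * W s))) :=
      (tendsto_const_nhds.max
        ((tendsto_pow_atTop_nhds_zero_of_lt_one hρ0 hρ1).mul_const K)).mul_const _
    have := ge_of_tendsto' hlim fun n => iter n t ht s
    rwa [zero_mul, max_eq_left hε.le] at this
  have hA : 0 < Real.exp ((c + 1) * t) * W s := mul_pos (Real.exp_pos _) (hW1 s)
  rw [← abs_eq_zero]
  refine le_antisymm (le_of_forall_pos_le_add fun δ hδ => ?_) (abs_nonneg _)
  have := small (δ / (Real.exp ((c + 1) * t) * W s)) (by positivity)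
  rwa [div_mul_cancel₀ _ hA.ne', ← zero_add δ] at this

/-- A solution of `∂ₜ u = L u` which is dominated by `V` is given by the minimal process. -/
theorem integral_lawFrom_eq [Countable S] [MeasurableSpace S] [MeasurableSingletonClass S]
    (hL : IsJumpGenerator L) (hVW : IsLyapunovPair L c V W) {u : ℝ → S → ℝ}
    (hu : ∀ s t, HasDerivAt (fun t => u t s) (L (u t) s) t)
    (hub : ∀ T, ∃ C, ∀ t ∈ Set.Icc 0 T, ∀ s, |u t s| ≤ C * V s) {t : ℝ} (ht : 0 ≤ t) (s : S) :
    Integrable (u 0) (lawFrom L t s) ∧ ∫ s', u 0 s' ∂(lawFrom L t s) = u t s := by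
  obtain ⟨C, hC⟩ := hub t
  have hV1 : ∀ s, 0 < V s := fun s => zero_lt_one.trans_le (hVW.one_le s)
  have hC0 : 0 ≤ C := by
    have := (abs_nonneg _).trans (hC t ⟨ht, le_rfl⟩ s)
    exact nonneg_of_mul_nonneg_left this (hV1 s)
  have hf : ∀ s, |u 0 s| ≤ C * V s := hC 0 ⟨le_rfl, ht⟩
  have hpos0 : ∀ s, 0 ≤ max (u 0 s) 0 := fun s => le_max_right _ _
  have hneg0 : ∀ s, 0 ≤ max (-u 0 s) 0 := fun s => le_max_right _ _
  have hposC : ∀ s, max (u 0 s) 0 ≤ C * V s := fun s =>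
    max_le ((le_abs_self _).trans (hf s)) ((abs_nonneg _).trans (hf s))
  have hnegC : ∀ s, max (-u 0 s) 0 ≤ C * V s := fun s =>
    max_le ((neg_le_abs _).trans (hf s)) ((abs_nonneg _).trans (hf s))
  have hpos := fun (s : S) (t : ℝ) (ht : 0 ≤ t) =>
    toReal_semigroup_backward hL hVW hpos0 hC0 hposC s ht
  have hneg := fun (s : S) (t : ℝ) (ht : 0 ≤ t) =>
    toReal_semigroup_backward hL hVW hneg0 hC0 hnegC s ht
  have hposle := fun (r : S) (t : ℝ) (ht : 0 ≤ t) => semigroup_le_mul hL hVW hC0 hposC r ht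
  have hnegle := fun (r : S) (t : ℝ) (ht : 0 ≤ t) => semigroup_le_mul hL hVW hC0 hnegC r ht
  have hmeas : Measurable (u 0) := measurable_of_countable _
  have hintegrable : Integrable (u 0) (lawFrom L t s) := by
    refine ⟨hmeas.aestronglyMeasurable, ?_⟩
    rw [hasFiniteIntegral_iff_norm, lintegral_lawFrom]
    exact (semigroup_le_mul hL hVW hC0 (fun s => hf s) s ht).trans_lt ENNReal.ofReal_lt_top
  refine ⟨hintegrable, ?_⟩
  rw [integral_eq_lintegral_pos_part_sub_lintegral_neg_part hintegrable, lintegral_lawFrom,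
    lintegral_lawFrom]
  have e1 : ∀ a : ℝ, ENNReal.ofReal a = ENNReal.ofReal (max a 0) := fun a => by
    rcases le_total a 0 with h | h
    · rw [max_eq_right h, ENNReal.ofReal_of_nonpos h, ENNReal.ofReal_zero]
    · rw [max_eq_left h]
  rw [show (fun s => ENNReal.ofReal (u 0 s)) = fun s => ENNReal.ofReal (max (u 0 s) 0) from
      funext fun s => e1 _,
    show (fun s => ENNReal.ofReal (-u 0 s)) = fun s => ENNReal.ofReal (max (-u 0 s) 0) from
      funext fun s => e1 _]
  set pp := semigroup L fun s => ENNReal.ofReal (max (u 0 s) 0)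
  set pm := semigroup L fun s => ENNReal.ofReal (max (-u 0 s) 0)
  have hcont : ∀ s, Continuous fun t => u t s := fun s =>
    continuous_iff_continuousAt.2 fun t => (hu s t).continuousAt
  have hJ : ∀ (s : S) (x : ℝ), ∑ r ∈ jumpSet hL s, rate L s r * u x r =
      exitRate L s * u x s + L (u x) s := fun s x => sum_rate_mul hL (u x) s
  have hLc : ∀ s, Continuous fun x => L (u x) s := by
    intro s
    simp_rw [hL.apply_eq]
    exact continuous_finsetSum _ fun r _ =>
      continuous_const.mul ((hcont r).sub (hcont s))
  have hui : ∀ (s : S) (t : ℝ), IntervalIntegrable (fun w => Real.exp (-(exitRate L s * w)) *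
      ∑ r ∈ jumpSet hL s, rate L s r * u (t - w) r) volume 0 t := by
    intro s t
    refine Continuous.intervalIntegrable (Continuous.mul (by fun_prop) ?_) 0 t
    exact continuous_finsetSum _ fun r _ =>
      continuous_const.mul ((hcont r).comp (continuous_const.sub continuous_id))
  have key := abs_le_of_backward hL hVW (T := t) (K := C + C * Real.exp (c * t))
    (h := fun t s => u t s - ((pp t s).toReal - (pm t s).toReal)) (by positivity) ?_ ?_
    (t := t) ⟨ht, le_rfl⟩ s
  · linarith
  · intro x hx r
    have b1 : (pp x r).toReal ≤ C * Real.exp (c * t) * V r := by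
      refine (ENNReal.toReal_le_of_le_ofReal (by have := hV1 r; positivity)
        (hposle r x hx.1)).trans ?_
      rw [← mul_assoc]
      have := hV1 r
      gcongr
      · exact hVW.nonneg
      · exact hx.2
    have b2 : (pm x r).toReal ≤ C * Real.exp (c * t) * V r := by
      refine (ENNReal.toReal_le_of_le_ofReal (by have := hV1 r; positivity)
        (hnegle r x hx.1)).trans ?_
      rw [← mul_assoc]
      have := hV1 r
      gcongr
      · exact hVW.nonneg
      · exact hx.2
    have b3 : |(pp x r).toReal - (pm x r).toReal| ≤ C * Real.exp (c * t) * V r :=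
      abs_sub_le_of_nonneg_of_le ENNReal.toReal_nonneg b1 ENNReal.toReal_nonneg b2
    calc _ ≤ |u x r| + |(pp x r).toReal - (pm x r).toReal| := abs_sub _ _
      _ ≤ C * V r + C * Real.exp (c * t) * V r := add_le_add (hC x hx r) b3
      _ = _ := by ring
  · intro x hx r
    have hu' : u x r = Real.exp (-(exitRate L r * x)) * u 0 r +
        ∫ w in (0 : ℝ)..x, Real.exp (-(exitRate L r * w)) *
          ∑ r' ∈ jumpSet hL r, rate L r r' * u (x - w) r' := by
      simp_rw [hJ]
      rw [intervalIntegral_duhamel (U := fun t => u t r) (U' := fun t => L (u t) r) (exitRate L r) x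
        (hu r) (hLc r)]
      ring
    rw [(hpos r x hx.1).2, (hneg r x hx.1).2, hu']
    have hsplit := intervalIntegral.integral_sub (hui r x)
      ((hpos r x hx.1).1.sub (hneg r x hx.1).1)
    rw [intervalIntegral.integral_sub (hpos r x hx.1).1 (hneg r x hx.1).1] at hsplit
    have hrw : ∫ w in (0 : ℝ)..x, Real.exp (-(exitRate L r * w)) *
          ∑ r' ∈ jumpSet hL r, rate L r r' *
            (u (x - w) r' - ((pp (x - w) r').toReal - (pm (x - w) r').toReal)) = _ :=
      Eq.trans (intervalIntegral.integral_congr fun w _ => by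
        simp only [mul_sub, Finset.sum_sub_distrib]) hsplit
    rw [hrw]
    have := max_zero_sub_max_neg_zero_eq_self (u 0 r)
    linear_combination (-Real.exp (-(exitRate L r * x))) * this

end Uniqueness

/-! ### Binomial shifts of sequences -/

section BinomialShift

/-- The binomial transform `k ↦ ∑ l ≤ k, binom(k, l) (-θ) ^ (k - l) c(l)`. -/
def binomialShift (θ : ℝ) (c : ℕ → ℝ) (k : ℕ) : ℝ :=
  ∑ l ∈ Finset.range (k + 1), k.choose l * (-θ) ^ (k - l) * c l

variable (θ : ℝ) (c : ℕ → ℝ) (k : ℕ)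

theorem binomialShift_congr {c c' : ℕ → ℝ} {k : ℕ} (h : ∀ l ≤ k, c l = c' l) :
    binomialShift θ c k = binomialShift θ c' k :=
  Finset.sum_congr rfl fun l hl => by rw [h l (by simpa [Nat.lt_succ_iff] using hl)]

theorem binomialShift_add (c c' : ℕ → ℝ) :
    binomialShift θ (fun l => c l + c' l) k = binomialShift θ c k + binomialShift θ c' k := by
  simp only [binomialShift, mul_add, Finset.sum_add_distrib]

theorem binomialShift_mul_left (b : ℝ) :
    binomialShift θ (fun l => b * c l) k = b * binomialShift θ c k := by
  simp only [binomialShift, Finset.mul_sum]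
  exact Finset.sum_congr rfl fun _ _ => by ring

theorem binomialShift_succ :
    binomialShift θ (fun l => c (l + 1)) k = binomialShift θ c (k + 1) + θ * binomialShift θ c k := by
  have h1 : binomialShift θ c (k + 1) = (∑ l ∈ Finset.range (k + 1),
      ((k.choose l : ℝ) * (-θ) ^ (k - l) * c (l + 1) +
        k.choose (l + 1) * (-θ) ^ (k - l) * c (l + 1))) + (-θ) ^ (k + 1) * c 0 := by
    rw [binomialShift, Finset.sum_range_succ']
    congr 1
    · refine Finset.sum_congr rfl fun l _ => ?_
      rw [Nat.choose_succ_succ, Nat.add_sub_add_right]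
      push_cast
      ring
    · simp
  have h2 : θ * binomialShift θ c k = -((∑ l ∈ Finset.range (k + 1),
      (k.choose (l + 1) : ℝ) * (-θ) ^ (k - l) * c (l + 1)) + (-θ) ^ (k + 1) * c 0) := by
    rw [Finset.sum_range_succ, Nat.choose_succ_self]
    rw [binomialShift, Finset.sum_range_succ', mul_add, Finset.mul_sum, neg_add]
    simp only [Nat.cast_zero, zero_mul, add_zero, Nat.choose_zero_right, Nat.cast_one, one_mul,
      Nat.sub_zero]
    rw [← Finset.sum_neg_distrib]
    congr 1
    · refine Finset.sum_congr rfl fun l hl => ?_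
      obtain ⟨j, rfl⟩ := Nat.exists_eq_add_of_lt (Finset.mem_range.1 hl)
      rw [show l + j + 1 - (l + 1) = j by omega, show l + j + 1 - l = j + 1 by omega]
      ring
    · ring
  rw [h1, h2, Finset.sum_add_distrib, binomialShift]
  ring

theorem binomialShift_mul_self :
    binomialShift θ (fun l => l * c l) k =
      k * (binomialShift θ c k + θ * binomialShift θ c (k - 1)) := by
  cases k with
  | zero => simp [binomialShift]
  | succ k =>
    rw [Nat.add_sub_cancel, ← binomialShift_succ, binomialShift, Finset.sum_range_succ',
      binomialShift, Finset.mul_sum]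
    simp only [Nat.cast_zero, zero_mul, mul_zero, add_zero]
    refine Finset.sum_congr rfl fun l _ => ?_
    have : ((k + 1 : ℕ) : ℝ) * k.choose l = (k + 1).choose (l + 1) * (l + 1 : ℕ) := by
      exact_mod_cast Nat.add_one_mul_choose_eq k l
    rw [Nat.add_sub_add_right]
    linear_combination (-(-θ) ^ (k - l) * c (l + 1)) * this

theorem binomialShift_mul_pred :
    binomialShift θ (fun l => l * c (l - 1)) k = k * binomialShift θ c (k - 1) := by
  rw [binomialShift_mul_self θ (fun l => c (l - 1))]
  cases k with
  | zero => simp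
  | succ k =>
    rw [Nat.add_sub_cancel, ← binomialShift_succ]
    simp

theorem binomialShift_binomialShift (δ : ℝ) :
    binomialShift δ (binomialShift θ c) k = binomialShift (θ + δ) c k := by
  induction k generalizing c with
  | zero => simp [binomialShift]
  | succ k ih =>
    have h1 := binomialShift_succ δ (binomialShift θ c) k
    have h2 := binomialShift_succ (θ + δ) c k
    have h3 : (fun l => binomialShift θ c (l + 1)) =
        fun l => binomialShift θ (fun l => c (l + 1)) l + -θ * binomialShift θ c l := by
      ext l
      rw [binomialShift_succ]
      ring
    rw [h3, binomialShift_add, binomialShift_mul_left, ih, ih] at h1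
    linarith

end BinomialShift

/-! ### Single-site duality functions -/

section Site

variable (σ : SignType)

/-- The single-site orthogonal duality functions, as shifts of the classical ones. -/
def siteFn (a : ℕ) (θ : ℝ) (k n : ℕ) : ℝ :=
  binomialShift θ (fun l => classicalFn σ a l n) k

theorem siteFn_add (a : ℕ) (θ δ : ℝ) (k n : ℕ) :
    siteFn σ a (θ + δ) k n = binomialShift δ (fun l => siteFn σ a θ l n) k :=
  (binomialShift_binomialShift θ _ k δ).symm

theorem siteFn_zero (a k n : ℕ) : siteFn σ a 0 k n = classicalFn σ a k n := by
  rw [siteFn, binomialShift, Finset.sum_range_succ, Finset.sum_eq_zero]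
  · simp
  · intro l hl
    have : k - l ≠ 0 := by have := Finset.mem_range.1 hl; omega
    simp [this]

theorem prod_range_neg_add (a l : ℕ) :
    ∏ j ∈ Finset.range l, (-(a : ℝ) + j) = (-1) ^ l * a.descFactorial l := by
  induction l with
  | zero => simp
  | succ l ih =>
    rw [Finset.prod_range_succ, ih, Nat.descFactorial_succ]
    rcases le_or_gt l a with h | h
    · push_cast [h]; ring
    · rw [Nat.descFactorial_eq_zero_iff_lt.2 h]; simp

theorem prod_range_add (a l : ℕ) :
    ∏ j ∈ Finset.range l, ((a : ℝ) + j) = a.ascFactorial l := by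
  induction l with
  | zero => simp
  | succ l ih =>
    rw [Finset.prod_range_succ, ih, Nat.ascFactorial_succ]
    push_cast
    ring

theorem orthogonalFn_eq_siteFn {a : ℕ} (ha : 0 < a) (θ : ℝ) (k n : ℕ) :
    orthogonalFn σ a θ k n = siteFn σ a θ k n := by
  unfold orthogonalFn
  split_ifs with hθ
  · rw [hθ, siteFn_zero]
  have ha' : (a : ℝ) ≠ 0 := by positivity
  have hpow : ∀ l ∈ Finset.range (k + 1), (-θ) ^ k = (-θ) ^ (k - l) * ((-1) ^ l * θ ^ l) := by
    intro l hl
    rw [← mul_pow, neg_one_mul, ← pow_add,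
      Nat.sub_add_cancel (Nat.lt_succ_iff.1 (Finset.mem_range.1 hl))]
  have hsq : ∀ l : ℕ, ((-1 : ℝ) ^ l) * (-1) ^ l = 1 := fun l => by rw [← mul_pow]; simp
  rcases σ with _ | _ | _
  · simp only [hyp20, siteFn, binomialShift, classicalFn, weight, Finset.mul_sum]
    refine Finset.sum_congr rfl fun l hl => ?_
    rw [hpow l hl, neg_eq_neg_one_mul (1 / (θ * a)), mul_pow, div_pow, mul_pow, one_pow]
    field_simp
    linear_combination (-θ) ^ (k - l) * (k.choose l : ℝ) * n.descFactorial l * hsq l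
  · simp only [hyp21, siteFn, binomialShift, classicalFn, weight, Finset.mul_sum]
    refine Finset.sum_congr rfl fun l hl => ?_
    rw [hpow l hl, prod_range_neg_add, div_pow, one_pow]
    have : ((-1 : ℝ) ^ l)⁻¹ = (-1) ^ l := inv_eq_of_mul_eq_one_left (hsq l)
    rw [div_eq_mul_inv (n.descFactorial l : ℝ) (_ * _), mul_inv, this]
    field_simp
    linear_combination (-θ) ^ (k - l) * (k.choose l : ℝ) * n.descFactorial l / (a.descFactorial l) * hsq l
  · simp only [hyp21, siteFn, binomialShift, classicalFn, weight, Finset.mul_sum]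
    refine Finset.sum_congr rfl fun l hl => ?_
    rw [hpow l hl, prod_range_add, neg_eq_neg_one_mul (1 / θ), mul_pow, div_pow, one_pow]
    field_simp
    linear_combination (-θ) ^ (k - l) * (k.choose l : ℝ) * n.descFactorial l / (a.ascFactorial l) * hsq l

variable {σ} {a : ℕ}

theorem cast_descFactorial_succ (n l : ℕ) :
    (n.descFactorial (l + 1) : ℝ) = (n - l) * n.descFactorial l := by
  rw [Nat.descFactorial_succ]
  rcases le_or_gt l n with h | h
  · push_cast [h]; ring
  · rw [Nat.descFactorial_eq_zero_iff_lt.2 h]; simp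

theorem weight_succ (σ : SignType) (a l : ℕ) :
    weight σ a (l + 1) = weight σ a l * (a + (σ : ℝ) * l) := by
  rcases σ with _ | _ | _ <;> simp only [weight]
  · simp [pow_succ]
  · rw [cast_descFactorial_succ]
    simp
    ring
  · rw [Nat.ascFactorial_succ]
    simp
    ring

theorem siteCoeff_pos (ha : 0 < a) {l : ℕ} (h : σ = -1 → l < a) : 0 < (a : ℝ) + σ * l := by
  have ha' : (0 : ℝ) < a := by positivity
  rcases σ with _ | _ | _
  · simpa
  · have : (l : ℝ) < a := by exact_mod_cast h rfl
    simpa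
  · simp; positivity

theorem siteCoeff_nonneg {l : ℕ} (h : σ = -1 → l ≤ a) : 0 ≤ (a : ℝ) + σ * l := by
  rcases σ with _ | _ | _
  · simp
  · have : (l : ℝ) ≤ a := by exact_mod_cast h rfl
    simpa
  · simp; positivity

theorem siteCoeff_eq_zero (ha : 0 < a) {l : ℕ} (h : σ = -1 → l ≤ a) (h0 : (a : ℝ) + σ * l = 0) :
    σ = -1 ∧ l = a := by
  by_contra hc
  refine (siteCoeff_pos (σ := σ) (l := l) ha fun hs => ?_).ne' h0
  exact lt_of_le_of_ne (h hs) fun e => hc ⟨hs, e⟩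

theorem weight_pos (ha : 0 < a) {l : ℕ} (h : σ = -1 → l ≤ a) : 0 < weight σ a l := by
  induction l with
  | zero => rcases σ with _ | _ | _ <;> simp [weight]
  | succ l ih =>
    rw [weight_succ]
    exact mul_pos (ih fun hs => (Nat.lt_of_succ_le (h hs)).le) (siteCoeff_pos ha fun hs => h hs)

theorem mul_classicalFn (ha : 0 < a) {l n : ℕ} (hl : σ = -1 → l ≤ a) (hn : σ = -1 → n ≤ a) :
    n * classicalFn σ a l n =
      (a + σ * l) * classicalFn σ a (l + 1) n + l * classicalFn σ a l n := by
  have hw := (weight_pos ha hl).ne'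
  simp only [classicalFn, weight_succ, cast_descFactorial_succ]
  by_cases h0 : (a : ℝ) + σ * l = 0
  · obtain ⟨hs, rfl⟩ := siteCoeff_eq_zero ha hl h0
    rw [h0]
    rcases (hn hs).eq_or_lt with rfl | h
    · ring
    · rw [Nat.descFactorial_eq_zero_iff_lt.2 h]; simp
  · field_simp
    ring

theorem mul_classicalFn_pred (l n : ℕ) :
    n * classicalFn σ a l (n - 1) = n * classicalFn σ a l n + -1 * (l * classicalFn σ a l n) := by
  cases n with
  | zero => cases l <;> simp [classicalFn]
  | succ n =>
    have h1 := cast_descFactorial_succ (n + 1) l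
    rw [Nat.succ_descFactorial_succ] at h1
    push_cast at h1
    simp only [classicalFn, Nat.add_sub_cancel]
    push_cast
    rw [← mul_div_assoc, h1]
    ring

theorem mul_classicalFn_succ (ha : 0 < a) {l n : ℕ} (hl : σ = -1 → l ≤ a) :
    (a + (σ : ℝ) * n) * classicalFn σ a l (n + 1) =
      (a + (σ : ℝ) * n) * classicalFn σ a l n + (σ * (l * classicalFn σ a l n) +
        l * classicalFn σ a (l - 1) n) := by
  cases l with
  | zero => simp [classicalFn]
  | succ l =>
    have h1 : ((n + 1).descFactorial (l + 1) : ℝ) =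
        n.descFactorial (l + 1) + (l + 1) * n.descFactorial l := by
      rw [Nat.succ_descFactorial_succ, cast_descFactorial_succ]
      push_cast
      ring
    have hw := (weight_pos (σ := σ) (l := l) ha fun hs => (Nat.lt_of_succ_le (hl hs)).le).ne'
    have hw' := (siteCoeff_pos (σ := σ) (l := l) ha fun hs => hl hs).ne'
    simp only [classicalFn, weight_succ, h1, cast_descFactorial_succ, Nat.add_sub_cancel]
    field_simp
    push_cast
    ring

theorem mul_siteFn (ha : 0 < a) (θ : ℝ) {k n : ℕ} (hk : σ = -1 → k ≤ a) (hn : σ = -1 → n ≤ a) :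
    n * siteFn σ a θ k n = (a + σ * k) * siteFn σ a θ (k + 1) n +
      (k + θ * (a + 2 * σ * k)) * siteFn σ a θ k n +
      θ * (1 + σ * θ) * (k * siteFn σ a θ (k - 1) n) := by
  set c := fun l => classicalFn σ a l n with hc
  have h : binomialShift θ (fun l => (n : ℝ) * c l) k = binomialShift θ (fun l =>
      (a : ℝ) * c (l + 1) + ((σ : ℝ) * (l * c (l + 1)) + l * c l)) k := by
    refine binomialShift_congr θ fun l hl => ?_
    have := mul_classicalFn (σ := σ) (l := l) ha (fun hs => hl.trans (hk hs)) hn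
    simp only [hc]
    linear_combination this
  rw [binomialShift_mul_left, binomialShift_add, binomialShift_mul_left, binomialShift_succ,
    binomialShift_add, binomialShift_mul_left, binomialShift_mul_self θ (fun l => c (l + 1)),
    binomialShift_mul_self, binomialShift_succ, binomialShift_succ] at h
  simp only [siteFn, ← hc]
  cases k with
  | zero => simp at h ⊢; linear_combination h
  | succ k =>
    simp only [Nat.add_sub_cancel] at h ⊢
    linear_combination h

theorem mul_siteFn_pred (θ : ℝ) (k n : ℕ) :
    n * siteFn σ a θ k (n - 1) = n * siteFn σ a θ k n -
      (k * siteFn σ a θ k n + θ * (k * siteFn σ a θ (k - 1) n)) := by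
  have h : binomialShift θ (fun l => (n : ℝ) * classicalFn σ a l (n - 1)) k = _ :=
    binomialShift_congr θ fun l _ => mul_classicalFn_pred l n
  rw [binomialShift_mul_left, binomialShift_add, binomialShift_mul_left, binomialShift_mul_left,
    binomialShift_mul_self] at h
  simp only [siteFn]
  linear_combination h

theorem mul_siteFn_succ (ha : 0 < a) (θ : ℝ) {k n : ℕ} (hk : σ = -1 → k ≤ a) :
    (a + (σ : ℝ) * n) * siteFn σ a θ k (n + 1) = (a + (σ : ℝ) * n) * siteFn σ a θ k n +
      (σ * (k * siteFn σ a θ k n) + (1 + σ * θ) * (k * siteFn σ a θ (k - 1) n)) := by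
  have h : binomialShift θ (fun l => (a + (σ : ℝ) * n) * classicalFn σ a l (n + 1)) k = _ :=
    binomialShift_congr θ fun l hl => mul_classicalFn_succ (n := n) ha fun hs => hl.trans (hk hs)
  rw [binomialShift_mul_left, binomialShift_add, binomialShift_mul_left, binomialShift_add,
    binomialShift_mul_left, binomialShift_mul_self,
    binomialShift_mul_pred θ (fun l => classicalFn σ a l n)] at h
  simp only [siteFn]
  linear_combination h

end Site

/-! ### Moves of a configuration -/

section Moves

variable {m : ℕ} {G : Geometry m} {σ : SignType}

theorem changeTo_val {η : Config G σ} {η' : Fin (m + 1) → ℕ}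
    (h : σ = -1 → ∀ x, η' x ≤ G.α x) : (changeTo η η').1 = η' := by
  rw [changeTo, dif_pos h]

theorem hop_val {η : Config G σ} {x y : Fin (m + 1)} (hx : 0 < η.1 x)
    (hy : σ = -1 → η.1 y < G.α y) (hxy : x ≠ y) :
    (hop η x y).1 = Function.update (Function.update η.1 x (η.1 x - 1)) y (η.1 y + 1) := by
  have e : η.1 - Pi.single x 1 + Pi.single y 1 =
      Function.update (Function.update η.1 x (η.1 x - 1)) y (η.1 y + 1) := by
    ext z
    by_cases hz : z = y
    · subst hz; simp [hxy.symm]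
    · by_cases hz' : z = x
      · subst hz'; simp [hz]
      · simp [hz, hz']
  rw [hop, if_pos hx, changeTo_val, e]
  intro hs z
  rw [e]
  by_cases hz : z = y
  · subst hz; simpa using hy hs
  · by_cases hz' : z = x
    · subst hz'
      have := η.2 hs z
      simp [hz]; omega
    · simpa [hz, hz'] using η.2 hs z

theorem remove_val (η : Config G σ) (x : Fin (m + 1)) :
    (remove η x).1 = Function.update η.1 x (η.1 x - 1) := by
  have e : η.1 - Pi.single x 1 = Function.update η.1 x (η.1 x - 1) := by
    ext z
    by_cases hz : z = x
    · subst hz; simp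
    · simp [hz]
  rw [remove, changeTo_val, e]
  exact fun hs z => (Nat.sub_le _ _).trans (η.2 hs z)

theorem create_val {η : Config G σ} {x : Fin (m + 1)} (hx : σ = -1 → η.1 x < G.α x) :
    (create η x).1 = Function.update η.1 x (η.1 x + 1) := by
  have e : η.1 + Pi.single x 1 = Function.update η.1 x (η.1 x + 1) := by
    ext z
    by_cases hz : z = x
    · subst hz; simp
    · simp [hz]
  rw [create, changeTo_val, e]
  intro hs z
  rw [e]
  by_cases hz : z = x
  · subst hz; simpa using hx hs
  · simpa [hz] using η.2 hs z

/-- Either the rate of a jump onto `y` vanishes, or there is room at `y`. -/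
theorem siteCoeff_eq_zero_or (η : Config G σ) (y : Fin (m + 1)) :
    (G.α y : ℝ) + σ * η.1 y = 0 ∨ (σ = -1 → η.1 y < G.α y) := by
  by_cases h : σ = -1 ∧ η.1 y = G.α y
  · left
    rw [h.2, show (σ : ℝ) = -1 by rw [h.1]; simp]
    ring
  · right
    intro hs
    exact lt_of_le_of_ne (η.2 hs y) fun e => h ⟨hs, e⟩

theorem siteCoeff_config_nonneg (η : Config G σ) (y : Fin (m + 1)) :
    0 ≤ (G.α y : ℝ) + σ * η.1 y :=
  siteCoeff_nonneg fun hs => η.2 hs y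

/-- A quantity multiplied by the rate of a hop may be computed on the moved configuration. -/
theorem hop_rate_mul_congr (η : Config G σ) {x y : Fin (m + 1)} (hxy : x ≠ y) {A B : ℝ}
    (h : 0 < η.1 x → (hop η x y).1 =
      Function.update (Function.update η.1 x (η.1 x - 1)) y (η.1 y + 1) → A = B) :
    η.1 x * (G.α y + (σ : ℝ) * η.1 y) * A = η.1 x * (G.α y + (σ : ℝ) * η.1 y) * B := by
  rcases Nat.eq_zero_or_pos (η.1 x) with h0 | h0
  · simp [h0]
  · rcases siteCoeff_eq_zero_or η y with h1 | h1
    · rw [h1]; ring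
    · rw [h h0 (hop_val h0 h1 hxy)]

variable (φ : Fin (m + 1) → ℕ → ℝ)

theorem prod_update (f : Fin (m + 1) → ℕ) (x : Fin (m + 1)) (n : ℕ) :
    ∏ z, φ z (Function.update f x n z) = φ x n * ∏ z ∈ Finset.univ.erase x, φ z (f z) := by
  rw [← Finset.mul_prod_erase _ _ (Finset.mem_univ x)]
  congr 1
  · simp
  · refine Finset.prod_congr rfl fun z hz => ?_
    rw [Function.update_of_ne (Finset.ne_of_mem_erase hz)]

theorem prod_hop (η : Config G σ) {x y : Fin (m + 1)} (hxy : x ≠ y) :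
    η.1 x * (G.α y + (σ : ℝ) * η.1 y) * ∏ z, φ z ((hop η x y).1 z) =
      (η.1 x * φ x (η.1 x - 1)) * ((G.α y + (σ : ℝ) * η.1 y) * φ y (η.1 y + 1)) *
        ∏ z ∈ (Finset.univ.erase y).erase x, φ z (η.1 z) := by
  rw [hop_rate_mul_congr η hxy (B := φ y (η.1 y + 1) * (φ x (η.1 x - 1) *
      ∏ z ∈ (Finset.univ.erase y).erase x, φ z (η.1 z)))]
  · ring
  · intro _ h
    rw [h, prod_update, ← Finset.mul_prod_erase _ _ (show x ∈ Finset.univ.erase y by simp [hxy])]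
    congr 2
    · simp
    · refine Finset.prod_congr rfl fun z hz => ?_
      rw [Function.update_of_ne (Finset.ne_of_mem_erase hz)]

theorem prod_remove (η : Config G σ) (x : Fin (m + 1)) :
    ∏ z, φ z ((remove η x).1 z) = φ x (η.1 x - 1) * ∏ z ∈ Finset.univ.erase x, φ z (η.1 z) := by
  rw [remove_val, prod_update]

theorem prod_create (η : Config G σ) (x : Fin (m + 1)) :
    (G.α x + (σ : ℝ) * η.1 x) * ∏ z, φ z ((create η x).1 z) =
      ((G.α x + (σ : ℝ) * η.1 x) * φ x (η.1 x + 1)) * ∏ z ∈ Finset.univ.erase x, φ z (η.1 z) := by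
  rcases siteCoeff_eq_zero_or η x with h1 | h1
  · rw [h1]; ring
  · rw [create_val h1, prod_update]
    ring

end Moves

/-! ### Duality of the generators -/

section Duality

variable {m : ℕ} (G : Geometry m) (σ : SignType)

/-- The orthogonal duality function with the same scale parameter `θ` at all sites. -/
def dualityFn (θL θR θ : ℝ) (ξ : DualConfig G σ) (η : Config G σ) : ℝ :=
  (θL - θ) ^ ξ.2.1 * (∏ x, siteFn σ (G.α x) θ (ξ.1.1 x) (η.1 x)) * (θR - θ) ^ ξ.2.2

variable {G σ}

theorem bulk_duality (θ : ℝ) (k η : Config G σ) {x y : Fin (m + 1)} (hxy : x ≠ y) :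
    (η.1 x * (G.α y + (σ : ℝ) * η.1 y) *
        ((∏ z, siteFn σ (G.α z) θ (k.1 z) ((hop η x y).1 z)) -
          ∏ z, siteFn σ (G.α z) θ (k.1 z) (η.1 z)) +
      η.1 y * (G.α x + (σ : ℝ) * η.1 x) *
        ((∏ z, siteFn σ (G.α z) θ (k.1 z) ((hop η y x).1 z)) -
          ∏ z, siteFn σ (G.α z) θ (k.1 z) (η.1 z))) =
    (k.1 x * (G.α y + (σ : ℝ) * k.1 y) *
        ((∏ z, siteFn σ (G.α z) θ ((hop k x y).1 z) (η.1 z)) -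
          ∏ z, siteFn σ (G.α z) θ (k.1 z) (η.1 z)) +
      k.1 y * (G.α x + (σ : ℝ) * k.1 x) *
        ((∏ z, siteFn σ (G.α z) θ ((hop k y x).1 z) (η.1 z)) -
          ∏ z, siteFn σ (G.α z) θ (k.1 z) (η.1 z))) := by
  have e1 := prod_hop (fun z n => siteFn σ (G.α z) θ (k.1 z) n) η hxy
  have e2 := prod_hop (fun z n => siteFn σ (G.α z) θ (k.1 z) n) η hxy.symm
  have e3 := prod_hop (fun z n => siteFn σ (G.α z) θ n (η.1 z)) k hxy
  have e4 := prod_hop (fun z n => siteFn σ (G.α z) θ n (η.1 z)) k hxy.symm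
  have e5 : ∏ z, siteFn σ (G.α z) θ (k.1 z) (η.1 z) =
      siteFn σ (G.α y) θ (k.1 y) (η.1 y) * (siteFn σ (G.α x) θ (k.1 x) (η.1 x) *
        ∏ z ∈ (Finset.univ.erase y).erase x, siteFn σ (G.α z) θ (k.1 z) (η.1 z)) := by
    rw [Finset.mul_prod_erase _ (fun z => siteFn σ (G.α z) θ (k.1 z) (η.1 z))
        (show x ∈ Finset.univ.erase y by simp [hxy]),
      Finset.mul_prod_erase _ (fun z => siteFn σ (G.α z) θ (k.1 z) (η.1 z)) (Finset.mem_univ y)]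
  rw [Finset.erase_right_comm] at e2 e4
  simp only [mul_sub, e1, e2, e3, e4, e5]
  have hkx : σ = -1 → k.1 x ≤ G.α x := fun hs => k.2 hs x
  have hky : σ = -1 → k.1 y ≤ G.α y := fun hs => k.2 hs y
  have rx := mul_siteFn (G.α_pos x) θ hkx (fun hs => η.2 hs x)
  have ry := mul_siteFn (G.α_pos y) θ hky (fun hs => η.2 hs y)
  rw [mul_siteFn_pred, mul_siteFn_pred, mul_siteFn_succ (G.α_pos x) θ hkx,
    mul_siteFn_succ (G.α_pos y) θ hky]
  generalize ∏ z ∈ (Finset.univ.erase y).erase x, siteFn σ (G.α z) θ (k.1 z) (η.1 z) = R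
  linear_combination (k.1 y * siteFn σ (G.α y) θ (k.1 y - 1) (η.1 y)) * R * rx +
    (k.1 x * siteFn σ (G.α x) θ (k.1 x - 1) (η.1 x)) * R * ry

theorem boundary_duality (a θS θ : ℝ) (k η : Config G σ) (x : Fin (m + 1)) :
    η.1 x * (a + (σ : ℝ) * (a * θS)) *
        ((∏ z, siteFn σ (G.α z) θ (k.1 z) ((remove η x).1 z)) -
          ∏ z, siteFn σ (G.α z) θ (k.1 z) (η.1 z)) +
      a * θS * (G.α x + (σ : ℝ) * η.1 x) *
        ((∏ z, siteFn σ (G.α z) θ (k.1 z) ((create η x).1 z)) -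
          ∏ z, siteFn σ (G.α z) θ (k.1 z) (η.1 z)) =
    a * k.1 x * ((θS - θ) * (∏ z, siteFn σ (G.α z) θ ((remove k x).1 z) (η.1 z)) -
      ∏ z, siteFn σ (G.α z) θ (k.1 z) (η.1 z)) := by
  have e1 := prod_remove (fun z n => siteFn σ (G.α z) θ (k.1 z) n) η x
  have e2 := prod_create (fun z n => siteFn σ (G.α z) θ (k.1 z) n) η x
  have e3 := prod_remove (fun z n => siteFn σ (G.α z) θ n (η.1 z)) k x
  have e5 := (Finset.mul_prod_erase _ (fun z => siteFn σ (G.α z) θ (k.1 z) (η.1 z))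
    (Finset.mem_univ x)).symm
  have hkx : σ = -1 → k.1 x ≤ G.α x := fun hs => k.2 hs x
  have r1 := mul_siteFn_pred (σ := σ) (a := G.α x) θ (k.1 x) (η.1 x)
  rw [mul_siteFn_succ (G.α_pos x) θ hkx] at e2
  simp only [e1, e3] at e2 ⊢
  rw [e5]
  generalize ∏ z ∈ Finset.univ.erase x, siteFn σ (G.α z) θ (k.1 z) (η.1 z) = R at *
  linear_combination (a + (σ : ℝ) * (a * θS)) * R * r1 + a * θS * e2

theorem generator_duality (θL θR θ : ℝ) (ξ : DualConfig G σ) (η : Config G σ) :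
    generator G σ θL θR (dualityFn G σ θL θR θ ξ) η =
      dualGenerator G σ (fun ζ => dualityFn G σ θL θR θ ζ η) ξ := by
  simp only [generator, dualGenerator, dualityFn]
  congr 1
  · congr 1
    · refine Finset.sum_congr rfl fun x _ => Finset.sum_congr rfl fun y hy => ?_
      have := bulk_duality θ ξ.1 η (Finset.mem_Ioi.1 hy).ne
      linear_combination (G.ω x y * (θL - θ) ^ ξ.2.1 * (θR - θ) ^ ξ.2.2) * this
    · have := boundary_duality G.αL θL θ ξ.1 η 0
      rw [pow_succ]
      linear_combination (G.ωL * (θL - θ) ^ ξ.2.1 * (θR - θ) ^ ξ.2.2) * this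
  · have := boundary_duality G.αR θR θ ξ.1 η (Fin.last m)
    rw [pow_succ]
    linear_combination (G.ωR * (θL - θ) ^ ξ.2.1 * (θR - θ) ^ ξ.2.2) * this

end Duality

section Particles

variable {m : ℕ} {G : Geometry m} {σ : SignType}

theorem isJumpGenerator_generator {θL θR : ℝ} (hθL : θL ∈ scaleSet σ) (hθR : θR ∈ scaleSet σ) :
    IsJumpGenerator (generator G σ θL θR) := by
  have hrem : ∀ {a θ : ℝ}, 0 < a → θ ∈ scaleSet σ → 0 ≤ a + (σ : ℝ) * (a * θ) := by
    intro a θ ha hθ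
    rcases σ with _ | _ | _
    · simpa using ha.le
    · have h1 : θ ≤ 1 := hθ.2 rfl
      simp
      nlinarith
    · have h1 : 0 ≤ θ := hθ.1
      simp
      positivity
  have hα := siteCoeff_config_nonneg (G := G) (σ := σ)
  have hL := G.αL_pos
  have hR := G.αR_pos
  intro η
  refine IsJumpAt.add (IsJumpAt.add ?_ (IsJumpAt.const_mul (IsJumpAt.add ?_ ?_) G.ωL_nonneg))
    (IsJumpAt.const_mul (IsJumpAt.add ?_ ?_) G.ωR_nonneg)
  · refine IsJumpAt.sum _ fun x _ => IsJumpAt.sum _ fun y _ =>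
      IsJumpAt.const_mul (IsJumpAt.add ?_ ?_) (G.ω_nonneg x y)
    · exact IsJumpAt.mul_diff _ _ (mul_nonneg (Nat.cast_nonneg _) (hα η y))
    · exact IsJumpAt.mul_diff _ _ (mul_nonneg (Nat.cast_nonneg _) (hα η x))
  · exact IsJumpAt.mul_diff _ _ (mul_nonneg (Nat.cast_nonneg _) (hrem hL hθL))
  · exact IsJumpAt.mul_diff _ _ (mul_nonneg (mul_nonneg hL.le hθL.1) (hα η _))
  · exact IsJumpAt.mul_diff _ _ (mul_nonneg (Nat.cast_nonneg _) (hrem hR hθR))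
  · exact IsJumpAt.mul_diff _ _ (mul_nonneg (mul_nonneg hR.le hθR.1) (hα η _))

theorem isJumpGenerator_dualGenerator : IsJumpGenerator (dualGenerator G σ) := by
  have hα := siteCoeff_config_nonneg (G := G) (σ := σ)
  intro ξ
  refine IsJumpAt.add (IsJumpAt.add ?_ ?_) ?_
  · refine IsJumpAt.sum _ fun x _ => IsJumpAt.sum _ fun y _ =>
      IsJumpAt.const_mul (IsJumpAt.add ?_ ?_) (G.ω_nonneg x y)
    · exact IsJumpAt.mul_diff _ (hop ξ.1 x y, ξ.2) (mul_nonneg (Nat.cast_nonneg _) (hα ξ.1 y))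
    · exact IsJumpAt.mul_diff _ (hop ξ.1 y x, ξ.2) (mul_nonneg (Nat.cast_nonneg _) (hα ξ.1 x))
  · exact IsJumpAt.mul_diff _ (remove ξ.1 0, ξ.2.1 + 1, ξ.2.2)
      (mul_nonneg (mul_nonneg G.ωL_nonneg G.αL_pos.le) (Nat.cast_nonneg _))
  · exact IsJumpAt.mul_diff _ (remove ξ.1 (Fin.last m), ξ.2.1, ξ.2.2 + 1)
      (mul_nonneg (mul_nonneg G.ωR_nonneg G.αR_pos.le) (Nat.cast_nonneg _))

/-- The number of particles in the bulk. -/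
def total (η : Config G σ) : ℕ := ∑ x, η.1 x

theorem sum_update_add (f : Fin (m + 1) → ℕ) (x : Fin (m + 1)) (n : ℕ) :
    ∑ z, Function.update f x n z + f x = ∑ z, f z + n := by
  rw [Finset.sum_update_of_mem (Finset.mem_univ x), ← Finset.add_sum_erase _ f (Finset.mem_univ x),
    Finset.sdiff_singleton_eq_erase]
  ring

theorem total_hop {η : Config G σ} {x y : Fin (m + 1)} (hxy : x ≠ y) (hx : 0 < η.1 x)
    (h : (hop η x y).1 = Function.update (Function.update η.1 x (η.1 x - 1)) y (η.1 y + 1)) :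
    total (hop η x y) = total η := by
  have h1 := sum_update_add (Function.update η.1 x (η.1 x - 1)) y (η.1 y + 1)
  have h2 := sum_update_add η.1 x (η.1 x - 1)
  rw [Function.update_of_ne hxy.symm] at h1
  rw [total, total, h]
  omega

theorem total_remove {η : Config G σ} {x : Fin (m + 1)} (hx : 0 < η.1 x) :
    total (remove η x) + 1 = total η := by
  have h2 := sum_update_add η.1 x (η.1 x - 1)
  rw [total, total, remove_val]
  omega

theorem total_remove_le (η : Config G σ) (x : Fin (m + 1)) : total (remove η x) ≤ total η := by
  rcases Nat.eq_zero_or_pos (η.1 x) with h | h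
  · have h2 := sum_update_add η.1 x (η.1 x - 1)
    rw [total, total, remove_val]
    omega
  · have := total_remove h
    omega

theorem total_create {η : Config G σ} {x : Fin (m + 1)} (hx : σ = -1 → η.1 x < G.α x) :
    total (create η x) = total η + 1 := by
  have h2 := sum_update_add η.1 x (η.1 x + 1)
  rw [total, total, create_val hx]
  omega

theorem le_total (η : Config G σ) (x : Fin (m + 1)) : η.1 x ≤ total η :=
  Finset.single_le_sum (fun _ _ => Nat.zero_le _) (Finset.mem_univ x)

theorem finite_total_le (K : ℕ) : {η : Config G σ | total η ≤ K}.Finite := by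
  refine ((Set.finite_Iic (fun _ : Fin (m + 1) => K)).preimage
    (Subtype.val_injective (p := fun η : Fin (m + 1) → ℕ =>
      σ = -1 → ∀ x, η x ≤ G.α x)).injOn).subset ?_
  exact fun η (hη : total η ≤ K) x => (le_total η x).trans hη

theorem finite_size_le (K : ℕ) : {ξ : DualConfig G σ | size ξ ≤ K}.Finite := by
  refine ((finite_total_le K).prod ((Set.finite_Iic K).prod (Set.finite_Iic K))).subset ?_
  intro ξ (hξ : size ξ ≤ K)
  rw [size] at hξ
  simp only [Set.mem_prod, Set.mem_ofPred_eq, Set.mem_Iic, total]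
  omega

/-! ### Lyapunov functions -/

/-- The Lyapunov function `(N + 1) ⋯ (N + p)`, where `N` is the number of particles. -/
def lyapunov (p : ℕ) (η : Config G σ) : ℝ := (total η + 1).ascFactorial p

theorem ascFactorial_succ_base (N p : ℕ) :
    ((N + 2).ascFactorial p : ℝ) * (N + 1) = (N + 1).ascFactorial p * (N + 1 + p) := by
  have h : (N + 1) * (N + 2).ascFactorial p = (N + 1 + p) * (N + 1).ascFactorial p :=
    Nat.succ_ascFactorial _ _
  have h' : ((N + 1 : ℕ) : ℝ) * (N + 2).ascFactorial p =
    ((N + 1 + p : ℕ) : ℝ) * (N + 1).ascFactorial p := by exact_mod_cast h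
  push_cast at h'
  linarith

theorem one_le_lyapunov (p : ℕ) (η : Config G σ) : 1 ≤ lyapunov p η := by
  have : 0 < (total η + 1).ascFactorial p := Nat.ascFactorial_pos _ _
  rw [lyapunov]
  exact_mod_cast this

theorem lyapunov_succ (p : ℕ) (η : Config G σ) :
    lyapunov (p + 1) η = (total η + 1 + p) * lyapunov p η := by
  rw [lyapunov, Nat.ascFactorial_succ, lyapunov]
  push_cast
  ring

theorem lyapunov_mono {p : ℕ} {η η' : Config G σ} (h : total η ≤ total η') :
    lyapunov p η ≤ lyapunov p η' := by
  simp only [lyapunov]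
  exact_mod_cast Nat.ascFactorial_le p (by omega)

theorem generator_lyapunov_le {θL θR : ℝ} (hθL : θL ∈ scaleSet σ) (hθR : θR ∈ scaleSet σ)
    (p : ℕ) (η : Config G σ) :
    generator G σ θL θR (lyapunov p) η ≤
      (G.ωL * (G.αL * θL * (G.α 0 + 1)) + G.ωR * (G.αR * θR * (G.α (Fin.last m) + 1))) * p *
        lyapunov p η := by
  have hbulk : ∀ x y : Fin (m + 1), x ≠ y →
      η.1 x * (G.α y + (σ : ℝ) * η.1 y) * (lyapunov p (hop η x y) - lyapunov p η) = 0 := by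
    intro x y hxy
    rw [hop_rate_mul_congr η hxy (B := 0), mul_zero]
    intro h0 h
    rcases Nat.eq_zero_or_pos (η.1 x) with h1 | h1
    · omega
    · rw [lyapunov, lyapunov, total_hop hxy h1 h, sub_self]
  have hbd : ∀ (ω a θ : ℝ) (x : Fin (m + 1)), 0 ≤ ω → 0 < a → θ ∈ scaleSet σ →
      ω * (η.1 x * (a + (σ : ℝ) * (a * θ)) * (lyapunov p (remove η x) - lyapunov p η) +
        a * θ * (G.α x + (σ : ℝ) * η.1 x) * (lyapunov p (create η x) - lyapunov p η)) ≤
      ω * (a * θ * (G.α x + 1)) * p * lyapunov p η := by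
    intro ω a θ x hω ha hθ
    have hrem : 0 ≤ a + (σ : ℝ) * (a * θ) := by
      rcases σ with _ | _ | _
      · simpa using ha.le
      · have h1 : θ ≤ 1 := hθ.2 rfl
        simp
        nlinarith
      · have h1 : 0 ≤ θ := hθ.1
        simp
        positivity
    have h1 : η.1 x * (a + (σ : ℝ) * (a * θ)) * (lyapunov p (remove η x) - lyapunov p η) ≤ 0 :=
      mul_nonpos_of_nonneg_of_nonpos (mul_nonneg (Nat.cast_nonneg _) hrem)
        (sub_nonpos.2 (lyapunov_mono (total_remove_le η x)))
    have hV := one_le_lyapunov p η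
    have h2 : (G.α x + (σ : ℝ) * η.1 x) * (lyapunov p (create η x) - lyapunov p η) ≤
        (G.α x + 1) * p * lyapunov p η := by
      rcases siteCoeff_eq_zero_or η x with h0 | h0
      · rw [h0, zero_mul]
        positivity
      · have hN : (0 : ℝ) < total η + 1 := by positivity
        have hdiff : lyapunov p (create η x) - lyapunov p η = p * lyapunov p η / (total η + 1) := by
          have := ascFactorial_succ_base (total η) p
          rw [eq_div_iff hN.ne', lyapunov, lyapunov, total_create h0]
          linear_combination this
        have hle : (G.α x : ℝ) + σ * η.1 x ≤ (G.α x + 1) * (total η + 1) := by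
          have h3 : (η.1 x : ℝ) ≤ total η := by exact_mod_cast le_total η x
          have h4 : (σ : ℝ) * η.1 x ≤ total η := by
            refine le_trans ?_ h3
            have : (0 : ℝ) ≤ η.1 x := Nat.cast_nonneg _
            rcases σ with _ | _ | _ <;> simp
          have h5 : (0 : ℝ) ≤ G.α x * total η := by positivity
          nlinarith
        rw [hdiff]
        calc _ ≤ (G.α x + 1) * (total η + 1) * (p * lyapunov p η / (total η + 1)) := by
              gcongr
          _ = _ := by field_simp
    have h3 : a * θ * ((G.α x + (σ : ℝ) * η.1 x) * (lyapunov p (create η x) - lyapunov p η)) ≤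
        a * θ * ((G.α x + 1) * p * lyapunov p η) :=
      mul_le_mul_of_nonneg_left h2 (mul_nonneg ha.le hθ.1)
    calc _ ≤ ω * (0 + a * θ * ((G.α x + 1) * p * lyapunov p η)) := by
          refine mul_le_mul_of_nonneg_left (add_le_add h1 ?_) hω
          rwa [mul_assoc]
      _ = _ := by ring
  rw [generator, Finset.sum_eq_zero]
  · have e1 := hbd G.ωL G.αL θL 0 G.ωL_nonneg G.αL_pos hθL
    have e2 := hbd G.ωR G.αR θR (Fin.last m) G.ωR_nonneg G.αR_pos hθR
    rw [zero_add]
    linarith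
  · intro x _
    refine Finset.sum_eq_zero fun y hy => ?_
    have hxy := (Finset.mem_Ioi.1 hy).ne
    rw [hbulk x y hxy, hbulk y x hxy.symm, add_zero, mul_zero]

theorem isLyapunovPair_generator {θL θR : ℝ} (hθL : θL ∈ scaleSet σ) (hθR : θR ∈ scaleSet σ)
    (p : ℕ) : IsLyapunovPair (generator G σ θL θR)
      ((G.ωL * (G.αL * θL * (G.α 0 + 1)) + G.ωR * (G.αR * θR * (G.α (Fin.last m) + 1))) *
        (p + 1 : ℕ)) (lyapunov p) (lyapunov (p + 1)) := by
  have hb : 0 ≤ G.ωL * (G.αL * θL * (G.α 0 + 1)) +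
      G.ωR * (G.αR * θR * (G.α (Fin.last m) + 1)) := by
    have h1 := G.αL_pos
    have h2 := G.αR_pos
    have h3 := G.ωL_nonneg
    have h4 := G.ωR_nonneg
    have h5 := hθL.1
    have h6 := hθR.1
    positivity
  constructor
  · exact mul_nonneg hb (Nat.cast_nonneg _)
  · exact one_le_lyapunov p
  · intro η
    have := one_le_lyapunov p η
    rw [lyapunov_succ]
    have h1 : (0 : ℝ) ≤ total η := Nat.cast_nonneg _
    have h2 : (0 : ℝ) ≤ p := Nat.cast_nonneg _
    nlinarith
  · intro η
    refine (generator_lyapunov_le hθL hθR p η).trans ?_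
    have := one_le_lyapunov p η
    gcongr
    omega
  · exact generator_lyapunov_le hθL hθR (p + 1)
  · intro ε hε
    obtain ⟨K, hK⟩ := exists_nat_gt (1 / ε)
    refine (finite_total_le K).subset fun η hη => ?_
    rw [Set.mem_ofPred_eq, lyapunov_succ] at hη
    have := one_le_lyapunov p η
    have h1 : ε * (total η + 1 + p) < 1 := by
      by_contra hc
      rw [not_lt] at hc
      nlinarith
    have h2 : (total η : ℝ) < K := by
      refine lt_trans ?_ hK
      rw [lt_div_iff₀ hε]
      have : 0 ≤ ε * (1 + p) := by positivity
      linarith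
    exact (by exact_mod_cast h2.le : total η ≤ K)

/-- Functions of polynomial growth in the number of particles. -/
def PolyGrowth (f : Config G σ → ℝ) : Prop :=
  ∃ (C : ℝ) (p : ℕ), 0 ≤ C ∧ ∀ η, |f η| ≤ C * (total η + 1) ^ p

theorem PolyGrowth.const (c : ℝ) : PolyGrowth fun _ : Config G σ => c :=
  ⟨|c|, 0, abs_nonneg _, fun η => by simp⟩

theorem PolyGrowth.mul {f g : Config G σ → ℝ} (hf : PolyGrowth f) (hg : PolyGrowth g) :
    PolyGrowth fun η => f η * g η := by
  obtain ⟨C, p, hC, h⟩ := hf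
  obtain ⟨C', p', hC', h'⟩ := hg
  refine ⟨C * C', p + p', mul_nonneg hC hC', fun η => ?_⟩
  rw [abs_mul, pow_add, mul_mul_mul_comm]
  exact mul_le_mul (h η) (h' η) (abs_nonneg _) (by positivity)

theorem PolyGrowth.add {f g : Config G σ → ℝ} (hf : PolyGrowth f) (hg : PolyGrowth g) :
    PolyGrowth fun η => f η + g η := by
  obtain ⟨C, p, hC, h⟩ := hf
  obtain ⟨C', p', hC', h'⟩ := hg
  refine ⟨C + C', p + p', add_nonneg hC hC', fun η => ?_⟩
  have h1 : (1 : ℝ) ≤ total η + 1 := by simp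
  calc |f η + g η| ≤ |f η| + |g η| := abs_add_le _ _
    _ ≤ C * (total η + 1) ^ p + C' * (total η + 1) ^ p' := add_le_add (h η) (h' η)
    _ ≤ C * (total η + 1) ^ (p + p') + C' * (total η + 1) ^ (p + p') := by
        gcongr <;> first | exact h1 | omega
    _ = _ := by ring

theorem PolyGrowth.abs {f : Config G σ → ℝ} (hf : PolyGrowth f) : PolyGrowth fun η => |f η| := by
  obtain ⟨C, p, hC, h⟩ := hf
  exact ⟨C, p, hC, fun η => by rw [abs_abs]; exact h η⟩

theorem PolyGrowth.sum {ι : Type*} (A : Finset ι) {f : ι → Config G σ → ℝ}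
    (h : ∀ i ∈ A, PolyGrowth (f i)) : PolyGrowth fun η => ∑ i ∈ A, f i η := by
  classical
  induction A using Finset.induction_on with
  | empty => simpa using PolyGrowth.const 0
  | insert i A hi ih =>
    simp only [Finset.sum_insert hi]
    exact (h i (by simp)).add (ih fun j hj => h j (by simp [hj]))

theorem PolyGrowth.prod {ι : Type*} (A : Finset ι) {f : ι → Config G σ → ℝ}
    (h : ∀ i ∈ A, PolyGrowth (f i)) : PolyGrowth fun η => ∏ i ∈ A, f i η := by
  classical
  induction A using Finset.induction_on with
  | empty => simpa using PolyGrowth.const 1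
  | insert i A hi ih =>
    simp only [Finset.prod_insert hi]
    exact (h i (by simp)).mul (ih fun j hj => h j (by simp [hj]))

theorem PolyGrowth.exists_lyapunov {f : Config G σ → ℝ} (hf : PolyGrowth f) :
    ∃ (C : ℝ) (p : ℕ), 0 ≤ C ∧ ∀ η, |f η| ≤ C * lyapunov p η := by
  obtain ⟨C, p, hC, h⟩ := hf
  refine ⟨C, p, hC, fun η => (h η).trans ?_⟩
  gcongr
  have := Nat.pow_succ_le_ascFactorial (total η + 1) p
  rw [lyapunov]
  exact_mod_cast this

theorem polyGrowth_siteFn (a : ℕ) (θ : ℝ) (k : ℕ) (x : Fin (m + 1)) :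
    PolyGrowth fun η : Config G σ => siteFn σ a θ k (η.1 x) := by
  unfold siteFn binomialShift
  refine PolyGrowth.sum _ fun l _ => (PolyGrowth.const _).mul ?_
  refine ⟨|weight σ a l|⁻¹, l, by positivity, fun η => ?_⟩
  unfold classicalFn
  rw [abs_div, div_eq_inv_mul, Nat.abs_cast]
  gcongr
  have h1 : (η.1 x).descFactorial l ≤ (total η + 1) ^ l :=
    (Nat.descFactorial_le_pow _ _).trans (Nat.pow_le_pow_left (by have := le_total η x; omega) l)
  exact_mod_cast h1

theorem polyGrowth_dualityFn (θL θR θ : ℝ) (ξ : DualConfig G σ) :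
    PolyGrowth (dualityFn G σ θL θR θ ξ) :=
  ((PolyGrowth.const _).mul (PolyGrowth.prod _ fun x _ => polyGrowth_siteFn _ _ _ x)).mul
    (PolyGrowth.const _)

/-! ### The dual semigroup -/

/-- The generator of the dual process only involves configurations with the same number of
particles. -/
theorem dualGenerator_congr {f f' : DualConfig G σ → ℝ} {ξ : DualConfig G σ}
    (h : ∀ ζ, size ζ = size ξ → f ζ = f' ζ) : dualGenerator G σ f ξ = dualGenerator G σ f' ξ := by
  have hhop : ∀ x y : Fin (m + 1), x ≠ y →
      ξ.1.1 x * (G.α y + (σ : ℝ) * ξ.1.1 y) * (f (hop ξ.1 x y, ξ.2) - f ξ) =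
      ξ.1.1 x * (G.α y + (σ : ℝ) * ξ.1.1 y) * (f' (hop ξ.1 x y, ξ.2) - f' ξ) := by
    intro x y hxy
    refine hop_rate_mul_congr ξ.1 hxy fun h0 hv => ?_
    rw [h ξ rfl, h]
    have := total_hop hxy h0 hv
    simp only [total] at this
    simp only [size, this]
  have hrem : ∀ (x : Fin (m + 1)) (c : ℝ) (i j : ℕ), i + j = ξ.2.1 + ξ.2.2 + 1 →
      c * ξ.1.1 x * (f (remove ξ.1 x, i, j) - f ξ) =
      c * ξ.1.1 x * (f' (remove ξ.1 x, i, j) - f' ξ) := by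
    intro x c i j hij
    rcases Nat.eq_zero_or_pos (ξ.1.1 x) with h0 | h0
    · simp [h0]
    · rw [h ξ rfl, h]
      have := total_remove h0
      simp only [total] at this
      simp only [size]
      omega
  simp only [dualGenerator]
  rw [hrem 0 (G.ωL * G.αL) _ _ (by ring), hrem (Fin.last m) (G.ωR * G.αR) _ _ (by ring)]
  congr 2
  refine Finset.sum_congr rfl fun x _ => Finset.sum_congr rfl fun y hy => ?_
  have hxy := (Finset.mem_Ioi.1 hy).ne
  rw [hhop x y hxy, hhop y x hxy.symm]

theorem dualGenerator_eq_zero {f : DualConfig G σ → ℝ} {ξ : DualConfig G σ} (c : ℝ)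
    (h : ∀ ζ, size ζ = size ξ → f ζ = c) : dualGenerator G σ f ξ = 0 := by
  rw [dualGenerator_congr (f' := fun _ => c) h]
  exact isJumpGenerator_dualGenerator.const c ξ

theorem isLyapunovPair_dualGenerator :
    IsLyapunovPair (dualGenerator G σ) 0 (fun _ => 1) (fun ξ => 1 + size ξ) := by
  refine ⟨le_rfl, fun _ => le_rfl, fun ξ => by simp, fun ξ => ?_, fun ξ => ?_, fun ε hε => ?_⟩
  · rw [dualGenerator_eq_zero 1 fun _ _ => rfl]; simp
  · rw [dualGenerator_eq_zero (1 + size ξ) fun ζ hζ => by rw [hζ]]; simp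
  · obtain ⟨K, hK⟩ := exists_nat_gt (1 / ε)
    refine (finite_size_le K).subset fun ξ hξ => ?_
    rw [Set.mem_ofPred_eq] at hξ
    have h2 : (size ξ : ℝ) < K := by
      refine lt_trans ?_ hK
      rw [lt_div_iff₀ hε]
      linarith
    exact (by exact_mod_cast h2.le : size ξ ≤ K)

variable (G σ) in
/-- The dual configurations with `n` particles. -/
abbrev SizeClass (n : ℕ) : Type := {ξ : DualConfig G σ // size ξ = n}

instance (n : ℕ) : Finite (SizeClass G σ n) :=
  ((finite_size_le n).subset fun _ h => le_of_eq h : {ξ : DualConfig G σ | size ξ = n}.Finite)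

instance (n : ℕ) : Fintype (SizeClass G σ n) := Fintype.ofFinite _

/-- Extension by zero. -/
def extendZero {n : ℕ} (f : SizeClass G σ n → ℝ) (ζ : DualConfig G σ) : ℝ :=
  if h : size ζ = n then f ⟨ζ, h⟩ else 0

theorem extendZero_of_size {n : ℕ} (f : SizeClass G σ n → ℝ) {ζ : DualConfig G σ}
    (h : size ζ = n) : extendZero f ζ = f ⟨ζ, h⟩ := dif_pos h

variable (G σ) in
/-- The generator of the dual process with `n` particles. -/
def dualOp (n : ℕ) : (SizeClass G σ n → ℝ) →L[ℝ] (SizeClass G σ n → ℝ) :=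
  LinearMap.toContinuousLinearMap
    { toFun := fun f ξ => dualGenerator G σ (extendZero f) ξ.1
      map_add' := fun f g => by
        have : extendZero (f + g) = extendZero f + extendZero g := by
          ext ζ
          simp only [extendZero, Pi.add_apply]
          split_ifs <;> simp
        ext ξ
        rw [this, isJumpGenerator_dualGenerator.map_add]
        rfl
      map_smul' := fun c f => by
        have : extendZero (c • f) = c • extendZero f := by
          ext ζ
          simp only [extendZero, Pi.smul_apply]
          split_ifs <;> simp
        ext ξ
        rw [this, isJumpGenerator_dualGenerator.map_smul]
        rfl }

theorem dualOp_apply {n : ℕ} (f : SizeClass G σ n → ℝ) (ξ : SizeClass G σ n) :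
    dualOp G σ n f ξ = dualGenerator G σ (extendZero f) ξ.1 := rfl

theorem dualOp_restrict {n : ℕ} (f : DualConfig G σ → ℝ) :
    dualOp G σ n (fun ζ => f ζ.1) = fun ζ => dualGenerator G σ f ζ.1 := by
  ext ξ
  rw [dualOp_apply]
  refine dualGenerator_congr fun ζ hζ => ?_
  rw [extendZero_of_size _ (hζ.trans ξ.2)]

variable (G σ) in
/-- The semigroup of the dual process with `n` particles. -/
def dualFlow (n : ℕ) (t : ℝ) : (SizeClass G σ n → ℝ) →L[ℝ] (SizeClass G σ n → ℝ) :=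
  NormedSpace.exp (t • dualOp G σ n)

theorem dualFlow_zero (n : ℕ) : dualFlow G σ n 0 = 1 := by
  rw [dualFlow, zero_smul, NormedSpace.exp_zero]

theorem hasDerivAt_dualFlow (n : ℕ) (f : SizeClass G σ n → ℝ) (ξ : SizeClass G σ n) (t : ℝ) :
    HasDerivAt (fun t => dualFlow G σ n t f ξ) (dualFlow G σ n t (dualOp G σ n f) ξ) t := by
  have h := hasDerivAt_exp_smul_const (𝕂 := ℝ) (dualOp G σ n) t
  have h2 := h.clm_apply (hasDerivAt_const t f)
  have h3 := (hasDerivAt_pi.1 h2) ξ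
  exact h3.congr_deriv (by simp [dualFlow])

theorem hasDerivAt_dualFlow' (n : ℕ) (f : SizeClass G σ n → ℝ) (ξ : SizeClass G σ n) (t : ℝ) :
    HasDerivAt (fun t => dualFlow G σ n t f ξ) (dualOp G σ n (dualFlow G σ n t f) ξ) t := by
  have h := hasDerivAt_exp_smul_const' (𝕂 := ℝ) (dualOp G σ n) t
  have h2 := h.clm_apply (hasDerivAt_const t f)
  have h3 := (hasDerivAt_pi.1 h2) ξ
  exact h3.congr_deriv (by simp [dualFlow])

theorem exists_dualFlow_le (n : ℕ) (T : ℝ) :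
    ∃ C, 0 ≤ C ∧ ∀ t ∈ Set.Icc 0 T, ∀ f ξ, |dualFlow G σ n t f ξ| ≤ C * ‖f‖ := by
  have hc : Continuous fun t => dualFlow G σ n t := continuous_iff_continuousAt.2 fun t =>
    (hasDerivAt_exp_smul_const (𝕂 := ℝ) (dualOp G σ n) t).continuousAt
  obtain ⟨C, hC⟩ := isCompact_Icc.exists_bound_of_continuousOn (s := Set.Icc 0 T) hc.continuousOn
  refine ⟨max C 0, le_max_right _ _, fun t ht f ξ => ?_⟩
  calc |dualFlow G σ n t f ξ| ≤ ‖dualFlow G σ n t f‖ := norm_le_pi_norm (dualFlow G σ n t f) ξ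
    _ ≤ ‖dualFlow G σ n t‖ * ‖f‖ := ContinuousLinearMap.le_opNorm _ _
    _ ≤ max C 0 * ‖f‖ := by
        gcongr
        exact (hC t ht).trans (le_max_left _ _)

theorem integral_dualLaw_const {t : ℝ} (ht : 0 ≤ t) {f : DualConfig G σ → ℝ}
    (hb : ∃ C, ∀ ξ, |f ξ| ≤ C) (hf : ∀ ξ, dualGenerator G σ f ξ = 0) (ξ : DualConfig G σ) :
    Integrable f (lawFrom (dualGenerator G σ) t ξ) ∧
      ∫ ζ, f ζ ∂(lawFrom (dualGenerator G σ) t ξ) = f ξ := by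
  obtain ⟨C, hC⟩ := hb
  exact integral_lawFrom_eq isJumpGenerator_dualGenerator isLyapunovPair_dualGenerator
    (u := fun _ => f) (fun s t => by rw [hf]; exact hasDerivAt_const _ _)
    (fun T => ⟨C, fun t _ s => by simpa using hC s⟩) ht ξ

theorem isProbabilityMeasure_of_integral_one {S : Type*} [MeasurableSpace S] {μ : Measure S}
    (h : Integrable (fun _ : S => (1 : ℝ)) μ ∧ ∫ _, (1 : ℝ) ∂μ = 1) : IsProbabilityMeasure μ := by
  have hfin : IsFiniteMeasure μ := by
    refine ⟨?_⟩
    have := h.1.2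
    rw [hasFiniteIntegral_iff_enorm] at this
    simpa using this
  refine ⟨?_⟩
  have := h.2
  rw [integral_const, smul_eq_mul, mul_one, measureReal_def] at this
  rw [← ENNReal.toReal_eq_one_iff]
  exact this

theorem isProbabilityMeasure_dualLaw {t : ℝ} (ht : 0 ≤ t) (ξ : DualConfig G σ) :
    IsProbabilityMeasure (lawFrom (dualGenerator G σ) t ξ) :=
  isProbabilityMeasure_of_integral_one <| integral_dualLaw_const ht (f := fun _ => 1)
    ⟨1, by simp⟩ (fun ξ => isJumpGenerator_dualGenerator.const 1 ξ) ξ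

theorem ae_size_eq {t : ℝ} (ht : 0 ≤ t) (ξ : DualConfig G σ) :
    ∀ᵐ ζ ∂(lawFrom (dualGenerator G σ) t ξ), size ζ = size ξ := by
  have := isProbabilityMeasure_dualLaw ht ξ
  have h := integral_dualLaw_const ht (f := fun ζ => if size ζ = size ξ then 0 else 1)
    ⟨1, fun ζ => by split_ifs <;> simp⟩ (fun ζ =>
      dualGenerator_eq_zero (if size ζ = size ξ then 0 else 1) fun ζ' h => by rw [h]) ξ
  rw [if_pos rfl, integral_eq_zero_iff_of_nonneg (fun ζ => by dsimp; split_ifs <;> simp) h.1] at h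
  filter_upwards [h.2] with ζ hζ
  by_contra hc
  simp [hc] at hζ

theorem integral_dualLaw (f : DualConfig G σ → ℝ) {t : ℝ} (ht : 0 ≤ t) {n : ℕ}
    (ξ : SizeClass G σ n) :
    Integrable f (lawFrom (dualGenerator G σ) t ξ.1) ∧
      ∫ ζ, f ζ ∂(lawFrom (dualGenerator G σ) t ξ.1) = dualFlow G σ n t (fun ζ => f ζ.1) ξ := by
  have h := integral_lawFrom_eq isJumpGenerator_dualGenerator isLyapunovPair_dualGenerator
    (u := fun t => extendZero (dualFlow G σ n t fun ζ => f ζ.1)) (fun ζ t => ?_) (fun T => ?_)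
    ht ξ.1
  · have hae : extendZero (dualFlow G σ n 0 fun ζ => f ζ.1)
        =ᵐ[lawFrom (dualGenerator G σ) t ξ.1] f := by
      filter_upwards [ae_size_eq ht ξ.1] with ζ hζ
      rw [extendZero_of_size _ (hζ.trans ξ.2), dualFlow_zero]
      rfl
    refine ⟨h.1.congr hae, ?_⟩
    rw [← integral_congr_ae hae, h.2, extendZero_of_size _ ξ.2]
  · by_cases hζ : size ζ = n
    · have h1 : (fun t => extendZero (dualFlow G σ n t fun ζ => f ζ.1) ζ) =
          fun t => dualFlow G σ n t (fun ζ => f ζ.1) ⟨ζ, hζ⟩ := by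
        ext t
        rw [extendZero_of_size _ hζ]
      rw [h1]
      exact hasDerivAt_dualFlow' n _ ⟨ζ, hζ⟩ t
    · have h1 : (fun t => extendZero (dualFlow G σ n t fun ζ => f ζ.1) ζ) = fun _ => 0 := by
        ext t
        rw [extendZero, dif_neg hζ]
      rw [h1, dualGenerator_eq_zero 0 fun ζ' hζ' => by
        rw [extendZero, dif_neg (by rw [hζ']; exact hζ)]]
      exact hasDerivAt_const _ _
  · obtain ⟨C, hC0, hC⟩ := exists_dualFlow_le (G := G) (σ := σ) n T
    refine ⟨C * ‖fun ζ : SizeClass G σ n => f ζ.1‖, fun t ht ζ => ?_⟩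
    rw [mul_one, extendZero]
    split_ifs with hζ
    · exact hC t ht _ _
    · rw [abs_zero]
      positivity

/-! ### Duality of the processes -/

theorem integral_dualityFn {θL θR : ℝ} (hθL : θL ∈ scaleSet σ) (hθR : θR ∈ scaleSet σ) (θ : ℝ)
    (ξ : DualConfig G σ) (η : Config G σ) {t : ℝ} (ht : 0 ≤ t) :
    Integrable (dualityFn G σ θL θR θ ξ) (lawFrom (generator G σ θL θR) t η) ∧
      ∫ η', dualityFn G σ θL θR θ ξ η' ∂(lawFrom (generator G σ θL θR) t η) =
        ∫ ζ, dualityFn G σ θL θR θ ζ η ∂(lawFrom (dualGenerator G σ) t ξ) := by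
  set D := dualityFn G σ θL θR θ
  obtain ⟨n, hn⟩ : ∃ n, size ξ = n := ⟨_, rfl⟩
  obtain ⟨K, p, hK, hD⟩ := (PolyGrowth.sum (Finset.univ (α := SizeClass G σ n))
    fun ζ _ => (polyGrowth_dualityFn θL θR θ ζ.1).abs).exists_lyapunov
  have hnorm : ∀ η, ‖fun ζ : SizeClass G σ n => D ζ.1 η‖ ≤ K * lyapunov p η := by
    intro η
    have hp := one_le_lyapunov p η
    refine (pi_norm_le_iff_of_nonneg (by positivity)).2 fun ζ => ?_
    refine le_trans ?_ ((le_abs_self _).trans (hD η))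
    exact Finset.single_le_sum (f := fun ζ : SizeClass G σ n => |D ζ.1 η|)
      (fun _ _ => abs_nonneg _) (Finset.mem_univ ζ)
  have hgen := isJumpGenerator_generator (G := G) hθL hθR
  have h := integral_lawFrom_eq hgen (isLyapunovPair_generator hθL hθR p)
    (u := fun t η => dualFlow G σ n t (fun ζ => D ζ.1 η) ⟨ξ, hn⟩) (fun η t => ?_) (fun T => ?_) ht η
  · simp only [dualFlow_zero] at h
    rw [(integral_dualLaw (fun ζ => D ζ η) ht ⟨ξ, hn⟩).2]
    exact h
  · refine (hasDerivAt_dualFlow n _ _ t).congr_deriv ?_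
    rw [dualOp_restrict fun ζ => D ζ η]
    have h1 : (fun ζ : SizeClass G σ n => dualGenerator G σ (fun ζ => D ζ η) ζ.1) =
        ∑ r ∈ jumpSet hgen η, rate (generator G σ θL θR) η r •
          ((fun ζ : SizeClass G σ n => D ζ.1 r) - fun ζ : SizeClass G σ n => D ζ.1 η) := by
      ext ζ
      rw [← generator_duality, hgen.apply_eq]
      simp [D]
    rw [h1, hgen.apply_eq, map_sum]
    simp
  · obtain ⟨C, hC0, hC⟩ := exists_dualFlow_le (G := G) (σ := σ) n T
    refine ⟨C * K, fun t ht η => (hC t ht _ _).trans ?_⟩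
    rw [mul_assoc]
    exact mul_le_mul_of_nonneg_left (hnorm η) hC0

theorem isProbabilityMeasure_law {θL θR : ℝ} (hθL : θL ∈ scaleSet σ) (hθR : θR ∈ scaleSet σ)
    (η : Config G σ) {t : ℝ} (ht : 0 ≤ t) :
    IsProbabilityMeasure (lawFrom (generator G σ θL θR) t η) :=
  isProbabilityMeasure_of_integral_one <|
    integral_lawFrom_eq (isJumpGenerator_generator hθL hθR) (isLyapunovPair_generator hθL hθR 0)
    (u := fun _ _ => 1) (fun s t => by
      rw [(isJumpGenerator_generator hθL hθR).const]; exact hasDerivAt_const _ _)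
    (fun T => ⟨1, fun t _ s => by simpa using one_le_lyapunov 0 s⟩) ht η

end Particles

section Absorption

variable {m : ℕ} {G : Geometry m} {σ : SignType}

/-! ### Absorption of the dual particles -/

variable (G) in
/-- The rate at which a dual particle at `x` is absorbed. -/
def killRate (x : Fin (m + 1)) : ℝ :=
  (if x = 0 then G.ωL * G.αL else 0) + (if x = Fin.last m then G.ωR * G.αR else 0)

theorem killRate_nonneg (x : Fin (m + 1)) : 0 ≤ killRate G x := by
  have hL := mul_nonneg G.ωL_nonneg G.αL_pos.le
  have hR := mul_nonneg G.ωR_nonneg G.αR_pos.le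
  rw [killRate]
  split_ifs <;> linarith

theorem exists_killRate_pos (h : 0 < max G.ωL G.ωR) : ∃ x, 0 < killRate G x := by
  have hL := mul_nonneg G.ωL_nonneg G.αL_pos.le
  have hR := mul_nonneg G.ωR_nonneg G.αR_pos.le
  rcases lt_max_iff.1 h with h | h
  · refine ⟨0, ?_⟩
    have := mul_pos h G.αL_pos
    rw [killRate, if_pos rfl]
    split_ifs <;> linarith
  · refine ⟨Fin.last m, ?_⟩
    have := mul_pos h G.αR_pos
    rw [killRate, if_pos (rfl : Fin.last m = Fin.last m)]
    split_ifs <;> linarith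

variable (G) in
/-- The generator of a single dual particle in the bulk, killed at the boundary. -/
def walkOp : (Fin (m + 1) → ℝ) →ₗ[ℝ] (Fin (m + 1) → ℝ) where
  toFun h x := ∑ y, G.ω x y * G.α y * (h y - h x) - killRate G x * h x
  map_add' h h' := by
    ext x
    simp only [Pi.add_apply, add_sub_add_comm, mul_add, Finset.sum_add_distrib]
  map_smul' c h := by
    ext x
    simp only [Pi.smul_apply, smul_eq_mul, RingHom.id_apply, mul_sub, Finset.mul_sum]
    congr 1
    · exact Finset.sum_congr rfl fun y _ => by ring
    · ring

theorem walkOp_apply (h : Fin (m + 1) → ℝ) (x : Fin (m + 1)) :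
    walkOp G h x = ∑ y, G.ω x y * G.α y * (h y - h x) - killRate G x * h x := rfl

/-- The minimum principle. -/
theorem nonneg_of_walkOp_nonpos (hG : 0 < max G.ωL G.ωR) {h : Fin (m + 1) → ℝ}
    (hh : ∀ x, walkOp G h x ≤ 0) (x : Fin (m + 1)) : 0 ≤ h x := by
  obtain ⟨x₀, hx₀⟩ := Finite.exists_min h
  by_contra hx
  have hneg : h x₀ < 0 := (hx₀ x).trans_lt (not_le.1 hx)
  have hmin : ∀ x, h x = h x₀ →
      killRate G x = 0 ∧ ∀ y, G.ω x y ≠ 0 → h y = h x₀ := by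
    intro x hxe
    have hterm : ∀ y ∈ Finset.univ, 0 ≤ G.ω x y * G.α y * (h y - h x) := fun y _ =>
      mul_nonneg (mul_nonneg (G.ω_nonneg x y) (Nat.cast_nonneg _))
        (by rw [hxe]; exact sub_nonneg.2 (hx₀ y))
    have hs := Finset.sum_nonneg hterm
    have hk : 0 ≤ killRate G x * -h x :=
      mul_nonneg (killRate_nonneg x) (by rw [hxe]; exact (neg_pos.2 hneg).le)
    have := hh x
    rw [walkOp_apply] at this
    have hs0 : ∑ y, G.ω x y * G.α y * (h y - h x) = 0 := by linarith
    have hk0 : killRate G x * h x = 0 := by linarith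
    constructor
    · exact (mul_eq_zero.1 hk0).resolve_right (by rw [hxe]; exact hneg.ne)
    · intro y hy
      have h0 := (Finset.sum_eq_zero_iff_of_nonneg hterm).1 hs0 y (Finset.mem_univ y)
      have hα : (G.α y : ℝ) ≠ 0 := by exact_mod_cast (G.α_pos y).ne'
      have := (mul_eq_zero.1 h0).resolve_left (mul_ne_zero hy hα)
      rw [← hxe]
      linarith
  have hall : ∀ y, h y = h x₀ := by
    intro y
    obtain ⟨w⟩ := G.connected.preconnected x₀ y
    have : ∀ {u v : Fin (m + 1)}, (SimpleGraph.fromRel fun x y => G.ω x y ≠ 0).Walk u v →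
        h u = h x₀ → h v = h x₀ := by
      intro u v w
      induction w with
      | nil => exact id
      | cons hadj _ ih =>
        intro hu
        rw [SimpleGraph.fromRel_adj] at hadj
        refine ih ((hmin _ hu).2 _ ?_)
        rcases hadj.2 with h1 | h1
        · exact h1
        · rwa [G.ω_symm]
    exact this w rfl
  obtain ⟨y, hy⟩ := exists_killRate_pos hG
  exact hy.ne' (hmin y (hall y)).1

/-- The expected absorption times of a single dual particle. -/
theorem exists_absorptionTime (hG : 0 < max G.ωL G.ωR) :
    ∃ h : Fin (m + 1) → ℝ, (∀ x, 0 ≤ h x) ∧ ∀ x, walkOp G h x = -1 := by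
  have hinj : Function.Injective (walkOp G) := by
    rw [injective_iff_map_eq_zero]
    intro h hh
    ext x
    have h1 := nonneg_of_walkOp_nonpos hG (h := h) (fun x => by simp [hh]) x
    have h2 := nonneg_of_walkOp_nonpos hG (h := -h) (fun x => by simp [hh]) x
    simp only [Pi.neg_apply, Pi.zero_apply] at h2 ⊢
    linarith
  obtain ⟨h, hh⟩ := (LinearMap.injective_iff_surjective.1 hinj) fun _ => -1
  have hh' : ∀ x, walkOp G h x = -1 := fun x => congrFun hh x
  exact ⟨h, nonneg_of_walkOp_nonpos hG fun x => by rw [hh']; norm_num, hh'⟩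

/-- The bulk particles counted with weights `h`. -/
def weightedTotal (h : Fin (m + 1) → ℝ) (ξ : DualConfig G σ) : ℝ := ∑ x, ξ.1.1 x * h x

theorem sum_update_mul (f : Fin (m + 1) → ℕ) (x : Fin (m + 1)) (n : ℕ) (h : Fin (m + 1) → ℝ) :
    ∑ z, (Function.update f x n z : ℝ) * h z = ∑ z, (f z : ℝ) * h z + (n - f x) * h x := by
  rw [← Finset.add_sum_erase _ _ (Finset.mem_univ x),
    ← Finset.add_sum_erase _ (fun z => (f z : ℝ) * h z) (Finset.mem_univ x),
    Finset.sum_congr rfl fun z hz => by rw [Function.update_of_ne (Finset.ne_of_mem_erase hz)]]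
  simp
  ring

theorem sum_Ioi_add (g : Fin (m + 1) → Fin (m + 1) → ℝ) (hg : ∀ x, g x x = 0) :
    ∑ x, ∑ y ∈ Finset.Ioi x, (g x y + g y x) = ∑ x, ∑ y, g x y := by
  have h1 : ∀ x, ∑ y, g x y = ∑ y ∈ Finset.Ioi x, g x y + ∑ y ∈ Finset.Iio x, g x y := by
    intro x
    have hd : Disjoint (Finset.Ioi x) (Finset.Iio x) := by
      rw [Finset.disjoint_left]
      intro y hy hy'
      exact lt_asymm (Finset.mem_Ioi.1 hy) (Finset.mem_Iio.1 hy')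
    rw [← Finset.sum_union hd]
    symm
    refine Finset.sum_subset (Finset.subset_univ _) fun y _ hy => ?_
    simp only [Finset.mem_union, Finset.mem_Ioi, Finset.mem_Iio, not_or, not_lt] at hy
    rw [le_antisymm hy.1 hy.2, hg]
  simp_rw [h1, Finset.sum_add_distrib]
  congr 1
  exact Finset.sum_comm' fun x y => by simp

theorem dualGenerator_weightedTotal (h : Fin (m + 1) → ℝ) (ξ : DualConfig G σ) :
    dualGenerator G σ (weightedTotal h) ξ = ∑ x, ξ.1.1 x * walkOp G h x := by
  have hhop : ∀ x y : Fin (m + 1), x ≠ y →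
      ξ.1.1 x * (G.α y + (σ : ℝ) * ξ.1.1 y) *
        (weightedTotal h (hop ξ.1 x y, ξ.2) - weightedTotal h ξ) =
      ξ.1.1 x * (G.α y + (σ : ℝ) * ξ.1.1 y) * (h y - h x) := by
    intro x y hxy
    refine hop_rate_mul_congr ξ.1 hxy fun h0 hv => ?_
    rw [weightedTotal, weightedTotal, hv, sum_update_mul, sum_update_mul,
      Function.update_of_ne hxy.symm, Nat.cast_sub h0]
    push_cast
    ring
  have hrem : ∀ (x : Fin (m + 1)) (c : ℝ) (p : ℕ × ℕ),
      c * ξ.1.1 x * (weightedTotal h (remove ξ.1 x, p) - weightedTotal h ξ) =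
      -(c * ξ.1.1 x * h x) := by
    intro x c p
    rcases Nat.eq_zero_or_pos (ξ.1.1 x) with h0 | h0
    · simp [h0]
    · rw [weightedTotal, weightedTotal, remove_val, sum_update_mul, Nat.cast_sub h0]
      push_cast
      ring
  have hbulk : ∑ x, ∑ y ∈ Finset.Ioi x, G.ω x y *
      (ξ.1.1 x * (G.α y + (σ : ℝ) * ξ.1.1 y) *
          (weightedTotal h (hop ξ.1 x y, ξ.2) - weightedTotal h ξ) +
        ξ.1.1 y * (G.α x + (σ : ℝ) * ξ.1.1 x) *
          (weightedTotal h (hop ξ.1 y x, ξ.2) - weightedTotal h ξ)) =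
      ∑ x, ∑ y, ξ.1.1 x * (G.ω x y * G.α y * (h y - h x)) := by
    rw [← sum_Ioi_add _ fun x => by simp]
    refine Finset.sum_congr rfl fun x _ => Finset.sum_congr rfl fun y hy => ?_
    have hxy := (Finset.mem_Ioi.1 hy).ne
    rw [hhop x y hxy, hhop y x hxy.symm, G.ω_symm y x]
    ring
  rw [dualGenerator, hbulk, hrem, hrem]
  simp only [walkOp_apply, killRate, mul_sub (_ : ℝ) (∑ y, _), Finset.sum_sub_distrib,
    Finset.mul_sum, add_mul, mul_add, Finset.sum_add_distrib, ite_mul, zero_mul, mul_ite, mul_zero,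
    Finset.sum_ite_eq', Finset.mem_univ, if_true]
  ring

theorem weightedTotal_one (ξ : DualConfig G σ) :
    weightedTotal (fun _ => 1) ξ = total ξ.1 := by
  simp [weightedTotal, total]

theorem dualFlow_mono {n : ℕ} {f g : DualConfig G σ → ℝ} (ξ : SizeClass G σ n)
    (h : ∀ ζ, size ζ = n → f ζ ≤ g ζ) {t : ℝ} (ht : 0 ≤ t) :
    dualFlow G σ n t (fun ζ => f ζ.1) ξ ≤ dualFlow G σ n t (fun ζ => g ζ.1) ξ := by
  rw [← (integral_dualLaw f ht ξ).2, ← (integral_dualLaw g ht ξ).2]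
  refine integral_mono_ae (integral_dualLaw f ht ξ).1 (integral_dualLaw g ht ξ).1 ?_
  filter_upwards [ae_size_eq ht ξ.1] with ζ hζ using h ζ (hζ.trans ξ.2)

theorem mul_dualFlow_total_le (h : Fin (m + 1) → ℝ) (h0 : ∀ x, 0 ≤ h x)
    (hh : ∀ x, walkOp G h x = -1) {n : ℕ} (ξ : SizeClass G σ n) {t : ℝ} (ht : 0 ≤ t) :
    t * dualFlow G σ n t (fun ζ => (total ζ.1.1 : ℝ)) ξ ≤ weightedTotal h ξ.1 := by
  set F : DualConfig G σ → ℝ := weightedTotal h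
  set N : DualConfig G σ → ℝ := fun ζ => total ζ.1
  set N' : DualConfig G σ → ℝ := dualGenerator G σ N
  have hF : dualOp G σ n (fun ζ => F ζ.1) = -fun ζ => N ζ.1 := by
    rw [dualOp_restrict]
    ext ζ
    rw [dualGenerator_weightedTotal]
    simp [hh, N, total]
  have hN : dualOp G σ n (fun ζ => N ζ.1) = fun ζ => N' ζ.1 := dualOp_restrict N
  have hN' : ∀ ζ, N' ζ ≤ 0 := by
    intro ζ
    have e : N = weightedTotal fun _ => 1 := funext fun ζ => (weightedTotal_one ζ).symm
    simp only [N', e]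
    rw [dualGenerator_weightedTotal]
    refine Finset.sum_nonpos fun x _ => mul_nonpos_of_nonneg_of_nonpos (Nat.cast_nonneg _) ?_
    rw [walkOp_apply]
    simpa using killRate_nonneg x
  have hd : ∀ t, HasDerivAt (fun t => dualFlow G σ n t (fun ζ => F ζ.1) ξ +
      t * dualFlow G σ n t (fun ζ => N ζ.1) ξ) (t * dualFlow G σ n t (fun ζ => N' ζ.1) ξ) t := by
    intro t
    refine ((hasDerivAt_dualFlow n _ ξ t).add
      ((hasDerivAt_id t).mul (hasDerivAt_dualFlow n _ ξ t))).congr_deriv ?_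
    rw [hF, hN, map_neg, Pi.neg_apply]
    simp
  have hanti := antitoneOn_of_deriv_nonpos (convex_Ici (0 : ℝ))
    (continuous_iff_continuousAt.2 fun t => (hd t).continuousAt).continuousOn
    (fun t _ => (hd t).differentiableAt.differentiableWithinAt) (fun t ht => by
      rw [interior_Ici] at ht
      rw [(hd t).deriv]
      refine mul_nonpos_of_nonneg_of_nonpos ht.le ?_
      have := dualFlow_mono ξ (f := N') (g := fun _ => 0) (fun ζ _ => hN' ζ) ht.le
      refine this.trans_eq ?_
      exact congrFun (map_zero (dualFlow G σ n t)) ξ)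
  have := hanti (Set.self_mem_Ici) (Set.mem_Ici.2 ht) ht
  simp only [dualFlow_zero, zero_mul, add_zero] at this
  have hpos : 0 ≤ dualFlow G σ n t (fun ζ => F ζ.1) ξ := by
    have h2 := dualFlow_mono ξ (f := fun _ => 0) (g := F)
      (fun ζ _ => Finset.sum_nonneg fun x _ => mul_nonneg (Nat.cast_nonneg _) (h0 x)) ht
    refine le_trans (Eq.le ?_) h2
    exact (congrFun (map_zero (dualFlow G σ n t)) ξ).symm
  have h3 : (1 : (SizeClass G σ n → ℝ) →L[ℝ] (SizeClass G σ n → ℝ)) (fun ζ => F ζ.1) ξ = F ξ.1 :=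
    rfl
  rw [h3] at this
  linarith

theorem tendsto_dualFlow_total (hG : 0 < max G.ωL G.ωR) {n : ℕ} (ξ : SizeClass G σ n) :
    Tendsto (fun t => dualFlow G σ n t (fun ζ => (total ζ.1.1 : ℝ)) ξ) atTop (𝓝 0) := by
  obtain ⟨h, h0, hh⟩ := exists_absorptionTime hG
  have hlim : Tendsto (fun t : ℝ => weightedTotal h ξ.1 / t) atTop (𝓝 0) :=
    tendsto_const_nhds.div_atTop tendsto_id
  refine tendsto_of_tendsto_of_tendsto_of_le_of_le' tendsto_const_nhds hlim ?_ ?_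
  · filter_upwards [eventually_ge_atTop 0] with t ht
    have h2 := dualFlow_mono ξ (f := fun _ => 0) (g := fun ζ => (total ζ.1 : ℝ))
      (fun ζ _ => Nat.cast_nonneg _) ht
    refine le_trans (Eq.le ?_) h2
    exact (congrFun (map_zero (dualFlow G σ n t)) ξ).symm
  · filter_upwards [eventually_gt_atTop 0] with t ht
    rw [le_div_iff₀ ht, mul_comm]
    exact mul_dualFlow_total_le h h0 hh ξ ht.le

/-- The indicator of all `n` particles being in `L`. -/
def allLeft (n : ℕ) (ζ : DualConfig G σ) : ℝ := if ζ.2.1 = n then 1 else 0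

theorem exists_tendsto_allLeft {n : ℕ} (ξ : SizeClass G σ n) :
    ∃ a, 0 ≤ a ∧
      Tendsto (fun t => dualFlow G σ n t (fun ζ => allLeft n ζ.1) ξ) atTop (𝓝 a) := by
  set f := fun t => dualFlow G σ n t (fun ζ => allLeft n ζ.1) ξ with hf
  have hd : ∀ t, HasDerivAt f
      (dualFlow G σ n t (fun ζ => dualGenerator G σ (allLeft n) ζ.1) ξ) t := by
    intro t
    rw [← dualOp_restrict]
    exact hasDerivAt_dualFlow n _ ξ t
  have hgen : ∀ ζ : DualConfig G σ, size ζ = n → 0 ≤ dualGenerator G σ (allLeft n) ζ := by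
    intro ζ hζ
    rw [isJumpGenerator_dualGenerator.apply_eq]
    by_cases h : ζ.2.1 = n
    · have hbulk : ∀ x, ζ.1.1 x = 0 := by
        rw [size] at hζ
        have h0 : ∑ x, ζ.1.1 x = 0 := by omega
        intro x
        exact (Finset.sum_eq_zero_iff.1 h0) x (Finset.mem_univ x)
      rw [← isJumpGenerator_dualGenerator.apply_eq]
      simp [dualGenerator, hbulk]
    · refine Finset.sum_nonneg fun r hr =>
        mul_nonneg (rate_nonneg_of_mem isJumpGenerator_dualGenerator hr) ?_
      simp only [allLeft, if_neg h, sub_zero]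
      split_ifs <;> simp
  have hmono : MonotoneOn f (Set.Ici 0) := monotoneOn_of_deriv_nonneg (convex_Ici (0 : ℝ))
    (continuous_iff_continuousAt.2 fun t => (hd t).continuousAt).continuousOn
    (fun t _ => (hd t).differentiableAt.differentiableWithinAt) (fun t ht => by
      rw [interior_Ici] at ht
      rw [(hd t).deriv]
      refine le_trans (Eq.le ?_)
        (dualFlow_mono ξ (f := fun _ => 0) (g := dualGenerator G σ (allLeft n)) hgen ht.le)
      exact (congrFun (map_zero (dualFlow G σ n t)) ξ).symm)
  have hle : ∀ t, 0 ≤ t → f t ≤ 1 := by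
    intro t ht
    have := isProbabilityMeasure_dualLaw ht ξ.1
    refine (dualFlow_mono ξ (f := allLeft n) (g := fun _ => 1) (fun ζ _ => ?_) ht).trans_eq ?_
    · rw [allLeft]
      split_ifs <;> norm_num
    · rw [← (integral_dualLaw (fun _ => 1) ht ξ).2]
      simp
  have hge : 0 ≤ f 0 := by
    simp only [hf, dualFlow_zero]
    change 0 ≤ allLeft n ξ.1
    rw [allLeft]
    split_ifs <;> norm_num
  have hmono' : Monotone fun t => f (max t 0) := fun s t hst =>
    hmono (Set.mem_Ici.2 (le_max_right _ _)) (Set.mem_Ici.2 (le_max_right _ _))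
      (max_le_max hst le_rfl)
  have hlim := tendsto_atTop_ciSup hmono'
    ⟨1, by rintro _ ⟨t, rfl⟩; exact hle _ (le_max_right _ _)⟩
  refine ⟨_, ?_, hlim.congr' ?_⟩
  · refine ge_of_tendsto' hlim fun t => hge.trans ?_
    exact hmono (Set.self_mem_Ici) (Set.mem_Ici.2 (le_max_right _ _)) (le_max_right _ _)
  · filter_upwards [eventually_ge_atTop 0] with t ht
    rw [max_eq_left ht]

theorem lawFrom_singleton {S : Type*} [MeasurableSpace S] [MeasurableSingletonClass S]
    (L : (S → ℝ) → S → ℝ) (t : ℝ) (s s' : S) : lawFrom L t s {s'} = transProb L t s s' := by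
  rw [← lintegral_indicator_one (measurableSet_singleton s'), lintegral_lawFrom, semigroup,
    tsum_eq_single s']
  · simp
  · intro r hr
    simp [hr]

theorem probAllLeft_eq {n : ℕ} (ξ : SizeClass G σ n) {a : ℝ} (ha : 0 ≤ a)
    (h : Tendsto (fun t => dualFlow G σ n t (fun ζ => allLeft n ζ.1) ξ) atTop (𝓝 a)) :
    probAllLeft ξ.1 = a := by
  set ζ₀ : DualConfig G σ := (⟨fun _ => 0, fun _ _ => Nat.zero_le _⟩, n, 0) with hζ₀
  have hsize₀ : size ζ₀ = n := by simp [size, hζ₀]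
  have huniq : ∀ ζ : DualConfig G σ, size ζ = n → ζ.2.1 = n → ζ = ζ₀ := by
    rintro ⟨⟨ζ, hζ'⟩, i, j⟩ h1 h2
    simp only [size] at h1 h2
    have h3 : ∑ x, ζ x = 0 := by omega
    have h4 : ζ = fun _ => 0 := funext fun x => (Finset.sum_eq_zero_iff.1 h3) x (Finset.mem_univ x)
    have h5 : j = 0 := by omega
    subst h2 h5 h4
    rfl
  have hlim₀ : dualLimitProb ξ.1 ζ₀ = ENNReal.ofReal a := by
    refine Tendsto.limUnder_eq ((ENNReal.tendsto_ofReal h).congr' ?_)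
    filter_upwards [eventually_ge_atTop 0] with t ht
    have := isProbabilityMeasure_dualLaw ht ξ.1
    rw [← lawFrom_singleton, ← (integral_dualLaw (allLeft n) ht ξ).2]
    have hae : allLeft n =ᵐ[lawFrom (dualGenerator G σ) t ξ.1] ({ζ₀} : Set _).indicator 1 := by
      filter_upwards [ae_size_eq ht ξ.1] with ζ hζ
      by_cases hζn : ζ.2.1 = n
      · rw [huniq ζ (hζ.trans ξ.2) hζn]
        simp [allLeft, hζ₀]
      · have : ζ ≠ ζ₀ := fun e => hζn (by rw [e])
        simp [allLeft, hζn, this]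
    rw [integral_congr_ae hae, integral_indicator_one (measurableSet_singleton _),
      ofReal_measureReal]
  have hlim : ∀ ζ : DualConfig G σ, size ζ ≠ n → dualLimitProb ξ.1 ζ = 0 := by
    intro ζ hζ
    refine Tendsto.limUnder_eq (tendsto_const_nhds.congr' ?_)
    filter_upwards [eventually_ge_atTop 0] with t ht
    rw [← lawFrom_singleton]
    symm
    refine measure_mono_null ?_ (ae_iff.1 (ae_size_eq ht ξ.1))
    rintro _ rfl
    exact fun e => hζ (e.trans ξ.2)
  rw [probAllLeft, tsum_eq_single ζ₀]
  · rw [if_pos (by rw [ξ.2]), hlim₀, ENNReal.toReal_ofReal ha]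
  · intro ζ hζ
    rw [ξ.2]
    split_ifs with h1
    · by_cases h2 : size ζ = n
      · exact absurd (huniq ζ h2 h1) hζ
      · exact hlim ζ h2
    · rfl

/-- Convergence of the dual expectations to the expectations after absorption. -/
theorem tendsto_integral_dualLaw (hG : 0 < max G.ωL G.ωR) (ξ : DualConfig G σ)
    (f : DualConfig G σ → ℝ) (c : ℝ)
    (hf : ∀ ζ, size ζ = size ξ → total ζ.1 = 0 → f ζ = if ζ.2.1 = size ξ then c else 0) :
    Tendsto (fun t => ∫ ζ, f ζ ∂(lawFrom (dualGenerator G σ) t ξ)) atTop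
      (𝓝 (c * probAllLeft ξ)) := by
  obtain ⟨n, hn⟩ : ∃ n, size ξ = n := ⟨_, rfl⟩
  rw [hn] at hf
  obtain ⟨a, ha, hlim⟩ := exists_tendsto_allLeft (⟨ξ, hn⟩ : SizeClass G σ n)
  rw [show probAllLeft ξ = a from probAllLeft_eq (⟨ξ, hn⟩ : SizeClass G σ n) ha hlim]
  set C : ℝ := ∑ ζ : SizeClass G σ n, |f ζ.1 - c * allLeft n ζ.1| with hC
  have hbound : ∀ ζ : DualConfig G σ, size ζ = n →
      |f ζ - c * allLeft n ζ| ≤ C * total ζ.1 := by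
    intro ζ hζ
    have hle : |f ζ - c * allLeft n ζ| ≤ C :=
      Finset.single_le_sum (f := fun ζ : SizeClass G σ n => |f ζ.1 - c * allLeft n ζ.1|)
        (fun _ _ => abs_nonneg _) (Finset.mem_univ ⟨ζ, hζ⟩)
    rcases Nat.eq_zero_or_pos (total ζ.1) with h0 | h0
    · rw [hf ζ hζ h0, allLeft, h0]
      split_ifs <;> simp
    · have h1 : (1 : ℝ) ≤ total ζ.1 := by exact_mod_cast h0
      have hC0 : 0 ≤ C := (abs_nonneg _).trans hle
      nlinarith
  have hdiff : Tendsto (fun t => ∫ ζ, f ζ ∂(lawFrom (dualGenerator G σ) t ξ) -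
      c * dualFlow G σ n t (fun ζ => allLeft n ζ.1) ⟨ξ, hn⟩) atTop (𝓝 0) := by
    have h1 := (tendsto_dualFlow_total hG (⟨ξ, hn⟩ : SizeClass G σ n)).const_mul C
    rw [mul_zero] at h1
    refine squeeze_zero_norm' ?_ h1
    filter_upwards [eventually_ge_atTop 0] with t ht
    have i1 := integral_dualLaw f ht (⟨ξ, hn⟩ : SizeClass G σ n)
    have i2 := integral_dualLaw (allLeft n) ht (⟨ξ, hn⟩ : SizeClass G σ n)
    have i3 := integral_dualLaw (fun ζ => (total ζ.1 : ℝ)) ht (⟨ξ, hn⟩ : SizeClass G σ n)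
    rw [← i2.2, ← i3.2, ← integral_const_mul, ← integral_const_mul,
      ← integral_sub i1.1 (i2.1.const_mul c)]
    refine norm_integral_le_of_norm_le (i3.1.const_mul C) ?_
    filter_upwards [ae_size_eq ht ξ] with ζ hζ using hbound ζ (hζ.trans hn)
  have hsum := hdiff.add (hlim.const_mul c)
  rw [zero_add] at hsum
  simpa using hsum

end Absorption

/-! ### Factorial moments of the marginals -/

section Marginals

variable {σ : SignType} {a : ℕ} {θ : ℝ}

theorem marginalWeight_nonneg (hθ : θ ∈ scaleSet σ) (n : ℕ) : 0 ≤ marginalWeight σ a θ n := by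
  have h0 : 0 ≤ θ := hθ.1
  rcases σ with _ | _ | _ <;> simp only [marginalWeight]
  · positivity
  · have h1 : 0 ≤ 1 - θ := sub_nonneg.2 (hθ.2 rfl)
    positivity
  · positivity

theorem hasSum_marginalWeight (hθ : θ ∈ scaleSet σ) (ha : σ = 1 → 0 < a) :
    HasSum (marginalWeight σ a θ) 1 := by
  have h0 : 0 ≤ θ := hθ.1
  rcases σ with _ | _ | _
  · have h := (NormedSpace.expSeries_div_hasSum_exp (𝔸 := ℝ) (a * θ)).mul_left
      (Real.exp (-(a * θ)))
    rw [← Real.exp_eq_exp_ℝ, ← Real.exp_add, neg_add_cancel, Real.exp_zero] at h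
    convert! h using 2 with n
    simp only [marginalWeight]
    ring
  · have h := add_pow θ (1 - θ) a
    rw [add_sub_cancel, one_pow] at h
    have h2 : HasSum (marginalWeight SignType.neg a θ)
        (∑ n ∈ Finset.range (a + 1), marginalWeight SignType.neg a θ n) := by
      refine hasSum_sum_of_ne_finset_zero fun n hn => ?_
      simp only [marginalWeight]
      rw [Nat.choose_eq_zero_of_lt (by simpa using hn)]
      simp
    convert! h2 using 1
    rw [h]
    refine Finset.sum_congr rfl fun n _ => ?_
    simp only [marginalWeight]
    ring
  · obtain ⟨b, rfl⟩ : ∃ b, a = b + 1 := ⟨a - 1, by have := ha rfl; omega⟩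
    have h1 : 0 < 1 + θ := by linarith
    have hr : ‖θ / (1 + θ)‖ < 1 := by
      rw [Real.norm_of_nonneg (by positivity), div_lt_one h1]
      linarith
    have h := (hasSum_choose_mul_geometric_of_norm_lt_one b hr).mul_right (1 / (1 + θ) ^ (b + 1))
    have e : 1 / (1 - θ / (1 + θ)) ^ (b + 1) * (1 / (1 + θ) ^ (b + 1)) = 1 := by
      rw [show 1 - θ / (1 + θ) = 1 / (1 + θ) by field_simp; ring, one_div_pow, one_div_one_div,
        mul_one_div_cancel (by positivity)]
    rw [e] at h
    convert! h using 2 with n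
    simp only [marginalWeight]
    rw [Nat.ascFactorial_eq_factorial_mul_choose, show (b + n).choose n = (n + b).choose b by
      rw [add_comm b n, Nat.choose_symm_add]]
    push_cast
    field_simp

theorem hasSum_marginalWeight_mul (hθ : θ ∈ scaleSet σ) (ha : 0 < a) {k : ℕ}
    (hk : σ = -1 → k ≤ a) :
    HasSum (fun n => marginalWeight σ a θ n * classicalFn σ a k n) (θ ^ k) := by
  have h0 : 0 ≤ θ := hθ.1
  have hw := weight_pos ha hk
  obtain ⟨b, hb, hshift⟩ : ∃ b : ℕ, (σ = 1 → 0 < b) ∧ ∀ n,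
      marginalWeight σ a θ (n + k) * classicalFn σ a k (n + k) =
        θ ^ k * marginalWeight σ b θ n := by
    rcases σ with _ | _ | _
    · refine ⟨a, fun h => by simp at h, fun n => ?_⟩
      have hf := Nat.factorial_mul_descFactorial (Nat.le_add_left k n)
      rw [Nat.add_sub_cancel] at hf
      have hd : 0 < (n + k).descFactorial k := Nat.descFactorial_pos.2 (Nat.le_add_left k n)
      simp only [marginalWeight, classicalFn, weight]
      rw [← hf]
      push_cast
      field_simp
      ring
    · have hka : k ≤ a := hk rfl
      refine ⟨a - k, fun h => by simp at h, fun n => ?_⟩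
      simp only [marginalWeight, classicalFn, weight] at hw ⊢
      have hc : a.choose (n + k) * (n + k).descFactorial k =
          a.descFactorial k * (a - k).choose n := by
        have := Nat.choose_mul (n := a) (k := n + k) (s := k) (Nat.le_add_left k n)
        rw [Nat.add_sub_cancel] at this
        rw [Nat.descFactorial_eq_factorial_mul_choose, Nat.descFactorial_eq_factorial_mul_choose,
          mul_left_comm, this]
        ring
      have hc' : (a.choose (n + k) : ℝ) * (n + k).descFactorial k =
          a.descFactorial k * (a - k).choose n := by exact_mod_cast hc
      rw [show a - (n + k) = a - k - n by omega, pow_add]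
      field_simp
      linear_combination (θ ^ n * θ ^ k * (1 - θ) ^ (a - k - n)) * hc'
    · refine ⟨a + k, fun _ => by omega, fun n => ?_⟩
      simp only [marginalWeight, classicalFn, weight] at hw ⊢
      have hf := Nat.factorial_mul_descFactorial (Nat.le_add_left k n)
      rw [Nat.add_sub_cancel] at hf
      have hd : 0 < (n + k).descFactorial k := Nat.descFactorial_pos.2 (Nat.le_add_left k n)
      have h1 : 0 < 1 + θ := by linarith
      rw [← hf, add_comm n k, ← Nat.ascFactorial_mul_ascFactorial, div_pow, div_pow]
      rw [add_comm n k] at hd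
      push_cast
      field_simp
      ring
  rw [← hasSum_nat_add_iff' k]
  simp_rw [hshift]
  rw [Finset.sum_eq_zero, sub_zero]
  · simpa using (hasSum_marginalWeight hθ hb).mul_left (θ ^ k)
  · intro n hn
    rw [classicalFn.eq_def, Nat.descFactorial_eq_zero_iff_lt.2 (Finset.mem_range.1 hn)]
    simp

theorem classicalFn_nonneg (k n : ℕ) : 0 ≤ classicalFn σ a k n := by
  unfold classicalFn
  refine div_nonneg (Nat.cast_nonneg _) ?_
  rcases σ with _ | _ | _ <;> simp only [weight] <;> positivity

theorem integral_marginal_classicalFn (hθ : θ ∈ scaleSet σ) (ha : 0 < a) {k : ℕ}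
    (hk : σ = -1 → k ≤ a) :
    Integrable (classicalFn σ a k) (marginal σ a θ) ∧
      ∫ n, classicalFn σ a k n ∂(marginal σ a θ) = θ ^ k := by
  have hsum := hasSum_marginalWeight_mul hθ ha hk
  have hl : ∫⁻ n, ENNReal.ofReal (classicalFn σ a k n) ∂(marginal σ a θ) =
      ENNReal.ofReal (θ ^ k) := by
    rw [marginal, lintegral_sum_measure, ← hsum.tsum_eq, ENNReal.ofReal_tsum_of_nonneg
      (fun n => mul_nonneg (marginalWeight_nonneg hθ n) (classicalFn_nonneg k n)) hsum.summable]
    refine tsum_congr fun n => ?_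
    rw [lintegral_smul_measure, lintegral_dirac, smul_eq_mul,
      ENNReal.ofReal_mul (marginalWeight_nonneg hθ n)]
  have hm : Measurable (classicalFn σ a k) := measurable_of_countable _
  have hnn : 0 ≤ᵐ[marginal σ a θ] classicalFn σ a k := ae_of_all _ (classicalFn_nonneg k)
  refine ⟨⟨hm.aestronglyMeasurable, ?_⟩, ?_⟩
  · rw [hasFiniteIntegral_iff_ofReal hnn, hl]
    exact ENNReal.ofReal_lt_top
  · rw [integral_eq_lintegral_of_nonneg_ae hnn hm.aestronglyMeasurable, hl,
      ENNReal.toReal_ofReal (pow_nonneg hθ.1 k)]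

theorem isProbabilityMeasure_marginal (hθ : θ ∈ scaleSet σ) (ha : 0 < a) :
    IsProbabilityMeasure (marginal σ a θ) := by
  have h := integral_marginal_classicalFn (k := 0) hθ ha (fun _ => Nat.zero_le _)
  have e : classicalFn σ a 0 = fun _ => 1 := by
    ext n
    rcases σ with _ | _ | _ <;> simp [classicalFn, weight]
  rw [e, pow_zero] at h
  exact isProbabilityMeasure_of_integral_one h

theorem integral_marginal_siteFn (hθ : θ ∈ scaleSet σ) (ha : 0 < a) (θ' : ℝ) {k : ℕ}
    (hk : σ = -1 → k ≤ a) :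
    Integrable (siteFn σ a θ' k) (marginal σ a θ) ∧
      ∫ n, siteFn σ a θ' k n ∂(marginal σ a θ) = (θ - θ') ^ k := by
  have h : ∀ l ∈ Finset.range (k + 1), Integrable
      (fun n => (k.choose l : ℝ) * (-θ') ^ (k - l) * classicalFn σ a l n) (marginal σ a θ) ∧
      ∫ n, (k.choose l : ℝ) * (-θ') ^ (k - l) * classicalFn σ a l n ∂(marginal σ a θ) =
        k.choose l * (-θ') ^ (k - l) * θ ^ l := by
    intro l hl
    have := integral_marginal_classicalFn (k := l) hθ ha
      (fun hs => (Nat.lt_succ_iff.1 (Finset.mem_range.1 hl)).trans (hk hs))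
    exact ⟨this.1.const_mul _, by rw [integral_const_mul, this.2]⟩
  constructor
  · exact integrable_finsetSum _ fun l hl => (h l hl).1
  · simp only [siteFn, binomialShift]
    rw [integral_finsetSum _ fun l hl => (h l hl).1, Finset.sum_congr rfl fun l hl => (h l hl).2,
      sub_eq_add_neg, add_pow]
    exact Finset.sum_congr rfl fun l _ => by ring

theorem ae_marginal_le (hσ : σ = -1) : ∀ᵐ n ∂(marginal σ a θ), n ≤ a := by
  subst hσ
  rw [marginal, Measure.ae_sum_iff]
  intro n
  by_cases hn : n ≤ a
  · refine Measure.ae_smul_measure ?_ _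
    rw [ae_dirac_eq]
    exact hn
  · have : marginalWeight (-1) a θ n = 0 := by
      change (a.choose n : ℝ) * θ ^ n * (1 - θ) ^ (a - n) = 0
      rw [Nat.choose_eq_zero_of_lt (not_le.1 hn)]
      simp
    simp [this]

end Marginals

/-! ### The interpolating product measures -/

section Product

variable {m : ℕ} {G : Geometry m} {σ : SignType} {θL θR : ℝ} {β : Fin (m + 1) → ℝ}

theorem measurableEmbedding_config_val :
    MeasurableEmbedding (Subtype.val : Config G σ → Fin (m + 1) → ℕ) :=
  ⟨Subtype.val_injective, measurable_subtype_coe, fun _ _ => (Set.to_countable _).measurableSet⟩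

theorem map_interpolatingMeasure (hβ : ∀ x, interp θL θR (β x) ∈ scaleSet σ) :
    (interpolatingMeasure G σ θL θR β).map Subtype.val =
      Measure.pi fun x => marginal σ (G.α x) (interp θL θR (β x)) := by
  have := fun x => isProbabilityMeasure_marginal (hβ x) (G.α_pos x)
  rw [interpolatingMeasure, measurableEmbedding_config_val.map_comap]
  refine Measure.restrict_eq_self_of_ae_mem ?_
  have h : ∀ᵐ f ∂(Measure.pi fun x => marginal σ (G.α x) (interp θL θR (β x))),
      ∀ x, σ = -1 → f x ≤ G.α x := by
    rw [eventually_countable_forall]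
    intro x
    by_cases hσ : σ = -1
    · have := (Measure.tendsto_eval_ae_ae (μ := fun x => marginal σ (G.α x) (interp θL θR (β x)))
        (i := x)).eventually (ae_marginal_le hσ)
      filter_upwards [this] with f hf _ using hf
    · exact Eventually.of_forall fun f h => absurd h hσ
  filter_upwards [h] with f hf
  exact ⟨⟨f, fun hs x => hf x hs⟩, rfl⟩

theorem isProbabilityMeasure_interpolatingMeasure
    (hβ : ∀ x, interp θL θR (β x) ∈ scaleSet σ) :
    IsProbabilityMeasure (interpolatingMeasure G σ θL θR β) := by
  have := fun x => isProbabilityMeasure_marginal (hβ x) (G.α_pos x)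
  refine ⟨?_⟩
  have h := congrArg (fun μ => μ Set.univ) (map_interpolatingMeasure (G := G) hβ)
  rw [Measure.map_apply measurable_subtype_coe MeasurableSet.univ, Set.preimage_univ] at h
  rw [h, measure_univ]

theorem integral_interpolatingMeasure (hβ : ∀ x, interp θL θR (β x) ∈ scaleSet σ) (θ : ℝ)
    (ξ : DualConfig G σ) :
    Integrable (dualityFn G σ θL θR θ ξ) (interpolatingMeasure G σ θL θR β) ∧
      ∫ η, dualityFn G σ θL θR θ ξ η ∂(interpolatingMeasure G σ θL θR β) =
        (θL - θ) ^ ξ.2.1 * (∏ x, (interp θL θR (β x) - θ) ^ ξ.1.1 x) * (θR - θ) ^ ξ.2.2 := by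
  have hp := fun x => isProbabilityMeasure_marginal (hβ x) (G.α_pos x)
  have hsite := fun x => integral_marginal_siteFn (hβ x) (G.α_pos x) θ fun hs => ξ.1.2 hs x
  set g : (Fin (m + 1) → ℕ) → ℝ := fun f =>
    (θL - θ) ^ ξ.2.1 * (∏ x, siteFn σ (G.α x) θ (ξ.1.1 x) (f x)) * (θR - θ) ^ ξ.2.2 with hg
  have hgi : Integrable g (Measure.pi fun x => marginal σ (G.α x) (interp θL θR (β x))) :=
    ((Integrable.fintype_prod_dep fun x => (hsite x).1).const_mul _).mul_const _
  have e : dualityFn G σ θL θR θ ξ = g ∘ Subtype.val := rfl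
  rw [← map_interpolatingMeasure hβ] at hgi
  refine ⟨measurableEmbedding_config_val.integrable_map_iff.1 hgi, ?_⟩
  have h2 := measurableEmbedding_config_val.integral_map
    (μ := interpolatingMeasure G σ θL θR β) g
  rw [e]
  refine h2.symm.trans ?_
  rw [map_interpolatingMeasure hβ, hg, integral_mul_const, integral_const_mul,
    integral_fintype_prod_eq_prod]
  simp_rw [(hsite _).2]

end Product

section Expansion

variable {m : ℕ} {G : Geometry m} {σ : SignType} {θL θR : ℝ}

theorem mem_below {ξ ζ : DualConfig G σ} : ζ ∈ below ξ ↔ ζ ≤ ξ := by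
  simp [below]

theorem size_le_of_le {ξ ζ : DualConfig G σ} (h : ζ ≤ ξ) : size ζ ≤ size ξ :=
  add_le_add (add_le_add h.2.1 h.2.2) (Finset.sum_le_sum fun x _ => h.1 x)

/-- Change of the scale parameters of the orthogonal duality functions. -/
theorem prod_siteFn_add (θ : ℝ) (δ : Fin (m + 1) → ℝ) {ξ : DualConfig G σ} (hL : ξ.2.1 = 0)
    (hR : ξ.2.2 = 0) (η : Config G σ) :
    ∏ x, siteFn σ (G.α x) (θ + δ x) (ξ.1.1 x) (η.1 x) =
      ∑ ζ ∈ below ξ, (∏ x, ((ξ.1.1 x).choose (ζ.1.1 x) : ℝ) * (-δ x) ^ (ξ.1.1 x - ζ.1.1 x)) *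
        dualityFn G σ θL θR θ ζ η := by
  simp only [siteFn_add]
  unfold binomialShift
  rw [Finset.prod_univ_sum]
  symm
  refine Finset.sum_bij (fun ζ _ => ζ.1.1) ?_ ?_ ?_ ?_
  · intro ζ hζ
    rw [Fintype.mem_piFinset]
    exact fun x => Finset.mem_range.2 (Nat.lt_succ_of_le ((mem_below.1 hζ).1 x))
  · rintro ⟨⟨ζ, hζ'⟩, i, j⟩ hζ ⟨⟨ζ₂, hζ₂'⟩, i₂, j₂⟩ hζ₂ h
    have h1 := (mem_below.1 hζ).2
    have h2 := (mem_below.1 hζ₂).2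
    have e1 : i = 0 := Nat.le_zero.1 (h1.1.trans hL.le)
    have e2 : j = 0 := Nat.le_zero.1 (h1.2.trans hR.le)
    have e3 : i₂ = 0 := Nat.le_zero.1 (h2.1.trans hL.le)
    have e4 : j₂ = 0 := Nat.le_zero.1 (h2.2.trans hR.le)
    have e5 : ζ = ζ₂ := h
    subst e1 e2 e3 e4 e5
    rfl
  · intro p hp
    rw [Fintype.mem_piFinset] at hp
    have hle : ∀ x, p x ≤ ξ.1.1 x := fun x => Nat.lt_succ_iff.1 (Finset.mem_range.1 (hp x))
    refine ⟨(⟨p, fun hs x => (hle x).trans (ξ.1.2 hs x)⟩, 0, 0), ?_, rfl⟩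
    exact mem_below.2 ⟨hle, Nat.zero_le _, Nat.zero_le _⟩
  · intro ζ hζ
    have h1 := (mem_below.1 hζ).2
    have e1 : ζ.2.1 = 0 := Nat.le_zero.1 (h1.1.trans hL.le)
    have e2 : ζ.2.2 = 0 := Nat.le_zero.1 (h1.2.trans hR.le)
    rw [dualityFn, e1, e2, pow_zero, pow_zero, one_mul, mul_one, ← Finset.prod_mul_distrib]

theorem interpolatingFn_eq_sum (β' : Fin (m + 1) → ℝ) {ξ : DualConfig G σ} (hL : ξ.2.1 = 0)
    (hR : ξ.2.2 = 0) (η : Config G σ) :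
    interpolatingFn G σ θL θR β' ξ η =
      ∑ ζ ∈ below ξ, (-1) ^ (size ξ - size ζ) * (θL - θR) ^ (size ξ - size ζ) *
        binomialFactor β' ξ ζ * dualityFn G σ θL θR θR ζ η := by
  rw [interpolatingFn, hL, hR]
  simp only [boundaryFn, pow_zero, one_mul, mul_one, orthogonalFn_eq_siteFn σ (G.α_pos _), interp]
  rw [prod_siteFn_add (θL := θL) (θR := θR) θR (fun x => β' x * (θL - θR)) hL hR]
  refine Finset.sum_congr rfl fun ζ hζ => ?_
  congr 1
  have h := mem_below.1 hζ
  have e1 : ζ.2.1 = 0 := Nat.le_zero.1 (h.2.1.trans hL.le)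
  have e2 : ζ.2.2 = 0 := Nat.le_zero.1 (h.2.2.trans hR.le)
  have hsize : size ξ - size ζ = ∑ x, (ξ.1.1 x - ζ.1.1 x) := by
    rw [Finset.sum_tsub_distrib _ fun x _ => h.1 x, size, size, hL, hR, e1, e2]
    omega
  rw [hsize, binomialFactor, ← mul_pow, ← Finset.prod_pow_eq_pow_sum, ← Finset.prod_mul_distrib]
  refine Finset.prod_congr rfl fun x _ => ?_
  rw [show -(β' x * (θL - θR)) = (-1 * (θL - θR)) * β' x by ring, mul_pow (-1 * (θL - θR))]
  ring

end Expansion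

/-! ### Moments of the boundary driven process -/

section Moments

variable {m : ℕ} {G : Geometry m} {σ : SignType} {θL θR : ℝ}

variable (G σ θL θR) in
/-- The transition kernel of the boundary driven process. -/
def lawKernel (t : ℝ) : ProbabilityTheory.Kernel (Config G σ) (Config G σ) :=
  ⟨lawFrom (generator G σ θL θR) t, measurable_of_countable _⟩

theorem integrable_lawAt_iff {f : Config G σ → ℝ} {μ : Measure (Config G σ)} {t : ℝ} :
    Integrable f (lawAt (generator G σ θL θR) μ t) ↔
      (∀ᵐ η ∂μ, Integrable f (lawFrom (generator G σ θL θR) t η)) ∧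
        Integrable (fun η => ∫ η', ‖f η'‖ ∂(lawFrom (generator G σ θL θR) t η)) μ :=
  Measure.integrable_comp_iff (κ := lawKernel G σ θL θR t)
    (measurable_of_countable f).aestronglyMeasurable

theorem integral_lawAt {f : Config G σ → ℝ} {μ : Measure (Config G σ)} [SFinite μ] {t : ℝ}
    (hf : Integrable f (lawAt (generator G σ θL θR) μ t)) :
    ∫ η, f η ∂(lawAt (generator G σ θL θR) μ t) =
      ∫ η, ∫ η', f η' ∂(lawFrom (generator G σ θL θR) t η) ∂μ :=
  ProbabilityTheory.Kernel.integral_comp (η := lawKernel G σ θL θR t)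
    (κ := ProbabilityTheory.Kernel.const Unit μ) (a := ()) hf

/-- The duality functions for `θ ≠ 0` are integrable if the classical ones are. -/
theorem integrable_dualityFn {μ : Measure (Config G σ)}
    (h : ∀ ζ, Integrable (dualityFn G σ θL θR 0 ζ) μ) (θ : ℝ) (ξ : DualConfig G σ) :
    Integrable (dualityFn G σ θL θR θ ξ) μ := by
  have e : dualityFn G σ θL θR θ ξ = fun η => (θL - θ) ^ ξ.2.1 *
      (∑ ζ ∈ below ((ξ.1, 0, 0) : DualConfig G σ),
        (∏ x, ((ξ.1.1 x).choose (ζ.1.1 x) : ℝ) * (-θ) ^ (ξ.1.1 x - ζ.1.1 x)) *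
        dualityFn G σ θL θR 0 ζ η) * (θR - θ) ^ ξ.2.2 := by
    ext η
    have := prod_siteFn_add (G := G) (σ := σ) (θL := θL) (θR := θR) 0 (fun _ => θ)
      (ξ := (ξ.1, 0, 0)) rfl rfl η
    rw [dualityFn, ← this]
    simp
  rw [e]
  exact ((integrable_finsetSum _ fun ζ _ => (h ζ).const_mul _).const_mul _).mul_const _

theorem dualityFn_zero_nonneg (hθL : θL ∈ scaleSet σ) (hθR : θR ∈ scaleSet σ)
    (ξ : DualConfig G σ) (η : Config G σ) : 0 ≤ dualityFn G σ θL θR 0 ξ η := by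
  rw [dualityFn, sub_zero, sub_zero]
  have h : ∀ x, 0 ≤ siteFn σ (G.α x) 0 (ξ.1.1 x) (η.1 x) := fun x => by
    rw [siteFn_zero]
    exact classicalFn_nonneg _ _
  exact mul_nonneg (mul_nonneg (pow_nonneg hθL.1 _) (Finset.prod_nonneg fun x _ => h x))
    (pow_nonneg hθR.1 _)

theorem dualFlow_eq_sum {n : ℕ} (t : ℝ) (f : SizeClass G σ n → ℝ) (ξ : SizeClass G σ n) :
    dualFlow G σ n t f ξ =
      ∑ ζ, f ζ * dualFlow G σ n t (fun ζ' => if ζ = ζ' then 1 else 0) ξ := by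
  classical
  have h := (dualFlow G σ n t : (SizeClass G σ n → ℝ) →ₗ[ℝ] (SizeClass G σ n → ℝ)).pi_apply_eq_sum_univ
    f
  have h2 := congrFun h ξ
  simp only [ContinuousLinearMap.coe_coe, Finset.sum_apply, Pi.smul_apply, smul_eq_mul] at h2
  rw [h2]

/-- Dual expectations commute with integration over the configuration `η`. -/
theorem integral_integral_dualLaw {μ : Measure (Config G σ)} {D : DualConfig G σ → Config G σ → ℝ}
    (hD : ∀ ζ, Integrable (D ζ) μ) (ξ : DualConfig G σ) {t : ℝ} (ht : 0 ≤ t) :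
    Integrable (fun η => ∫ ζ, D ζ η ∂(lawFrom (dualGenerator G σ) t ξ)) μ ∧
      ∫ η, ∫ ζ, D ζ η ∂(lawFrom (dualGenerator G σ) t ξ) ∂μ =
        ∫ ζ, ∫ η, D ζ η ∂μ ∂(lawFrom (dualGenerator G σ) t ξ) := by
  obtain ⟨n, hn⟩ : ∃ n, size ξ = n := ⟨_, rfl⟩
  have h : ∀ f : DualConfig G σ → ℝ, ∫ ζ, f ζ ∂(lawFrom (dualGenerator G σ) t ξ) =
      ∑ ζ : SizeClass G σ n, f ζ.1 *
        dualFlow G σ n t (fun ζ' => if ζ = ζ' then 1 else 0) ⟨ξ, hn⟩ := by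
    intro f
    rw [(integral_dualLaw f ht ⟨ξ, hn⟩).2, dualFlow_eq_sum]
  simp only [h]
  constructor
  · exact integrable_finsetSum _ fun ζ _ => (hD ζ.1).mul_const _
  · rw [integral_finsetSum _ fun ζ _ => (hD ζ.1).mul_const _]
    exact Finset.sum_congr rfl fun ζ _ => integral_mul_const _ _

theorem integral_lawAt_dualityFn (hθL : θL ∈ scaleSet σ) (hθR : θR ∈ scaleSet σ)
    {μ : Measure (Config G σ)} [SFinite μ]
    (h : ∀ ζ, Integrable (dualityFn G σ θL θR 0 ζ) μ) (θ : ℝ) (ξ : DualConfig G σ) {t : ℝ}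
    (ht : 0 ≤ t) :
    Integrable (dualityFn G σ θL θR θ ξ) (lawAt (generator G σ θL θR) μ t) ∧
      ∫ η, dualityFn G σ θL θR θ ξ η ∂(lawAt (generator G σ θL θR) μ t) =
        ∫ ζ, ∫ η, dualityFn G σ θL θR θ ζ η ∂μ ∂(lawFrom (dualGenerator G σ) t ξ) := by
  have h0 : ∀ ζ, Integrable (dualityFn G σ θL θR 0 ζ) (lawAt (generator G σ θL θR) μ t) := by
    intro ζ
    rw [integrable_lawAt_iff]
    refine ⟨ae_of_all _ fun η => (integral_dualityFn hθL hθR 0 ζ η ht).1, ?_⟩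
    refine (integral_integral_dualLaw h ζ ht).1.congr (ae_of_all _ fun η => ?_)
    simp only [Real.norm_of_nonneg (dualityFn_zero_nonneg hθL hθR _ _)]
    exact (integral_dualityFn hθL hθR 0 ζ η ht).2.symm
  have hθ := integrable_dualityFn h0 θ ξ
  refine ⟨hθ, ?_⟩
  rw [integral_lawAt hθ, ← (integral_integral_dualLaw (integrable_dualityFn h θ) ξ ht).2]
  exact integral_congr_ae (ae_of_all _ fun η => (integral_dualityFn hθL hθR θ ξ η ht).2)

/-! ### Moments of stationary measures -/

/-- The classical duality functions of the absorbed configurations are bounded, which bounds the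
duality functions in terms of the number of bulk particles. -/
theorem exists_dualityFn_zero_le (hθL : θL ∈ scaleSet σ) (hθR : θR ∈ scaleSet σ) (n : ℕ) :
    ∃ K, 0 ≤ K ∧ ∀ η : Config G σ, ∃ C, 0 ≤ C ∧ ∀ ζ : DualConfig G σ, size ζ = n →
      dualityFn G σ θL θR 0 ζ η ≤ K + C * total ζ.1 := by
  refine ⟨∑ ζ : SizeClass G σ n, θL ^ ζ.1.2.1 * θR ^ ζ.1.2.2, ?_, fun η =>
    ⟨∑ ζ : SizeClass G σ n, dualityFn G σ θL θR 0 ζ.1 η, ?_, fun ζ hζ => ?_⟩⟩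
  · exact Finset.sum_nonneg fun ζ _ => mul_nonneg (pow_nonneg hθL.1 _) (pow_nonneg hθR.1 _)
  · exact Finset.sum_nonneg fun ζ _ => dualityFn_zero_nonneg hθL hθR _ _
  have hK0 : 0 ≤ ∑ ζ : SizeClass G σ n, θL ^ ζ.1.2.1 * θR ^ ζ.1.2.2 :=
    Finset.sum_nonneg fun ζ _ => mul_nonneg (pow_nonneg hθL.1 _) (pow_nonneg hθR.1 _)
  rcases Nat.eq_zero_or_pos (total ζ.1) with h0 | h0
  · have hbulk : ∀ x, ζ.1.1 x = 0 := fun x =>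
      (Finset.sum_eq_zero_iff.1 h0) x (Finset.mem_univ x)
    have e : dualityFn G σ θL θR 0 ζ η = θL ^ ζ.2.1 * θR ^ ζ.2.2 := by
      rw [dualityFn, Finset.prod_eq_one]
      · simp
      · intro x _
        rw [hbulk, siteFn_zero]
        rcases σ with _ | _ | _ <;> simp [classicalFn, weight]
    rw [e, h0, Nat.cast_zero, mul_zero, add_zero]
    exact Finset.single_le_sum (f := fun ζ : SizeClass G σ n => θL ^ ζ.1.2.1 * θR ^ ζ.1.2.2)
      (fun ζ _ => mul_nonneg (pow_nonneg hθL.1 _) (pow_nonneg hθR.1 _)) (Finset.mem_univ ⟨ζ, hζ⟩)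
  · have h1 : (1 : ℝ) ≤ total ζ.1 := by exact_mod_cast h0
    have h2 : dualityFn G σ θL θR 0 ζ η ≤ ∑ ζ : SizeClass G σ n, dualityFn G σ θL θR 0 ζ.1 η :=
      Finset.single_le_sum (f := fun ζ : SizeClass G σ n => dualityFn G σ θL θR 0 ζ.1 η)
        (fun ζ _ => dualityFn_zero_nonneg hθL hθR _ _) (Finset.mem_univ ⟨ζ, hζ⟩)
    have h3 := dualityFn_zero_nonneg hθL hθR ζ η
    nlinarith

theorem integrable_dualityFn_of_stationary (hG : 0 < max G.ωL G.ωR) (hθL : θL ∈ scaleSet σ)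
    (hθR : θR ∈ scaleSet σ) {μ : Measure (Config G σ)}
    (hμ : IsStationaryMeasure (generator G σ θL θR) μ) (ξ : DualConfig G σ) :
    Integrable (dualityFn G σ θL θR 0 ξ) μ := by
  have hprob := hμ.1
  set D := dualityFn G σ θL θR 0 ξ
  have hD0 : ∀ η, 0 ≤ D η := dualityFn_zero_nonneg hθL hθR ξ
  obtain ⟨K, hK0, hK⟩ := exists_dualityFn_zero_le (G := G) hθL hθR (size ξ)
  choose C hC0 hC using hK
  set N : ℝ → ℝ := fun t => dualFlow G σ (size ξ) t (fun ζ => (total ζ.1.1 : ℝ)) ⟨ξ, rfl⟩ with hN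
  have hNlim : Tendsto N atTop (𝓝 0) := tendsto_dualFlow_total hG ⟨ξ, rfl⟩
  -- the expectation of `D` at time `t`
  have hexp : ∀ (t : ℝ) (η : Config G σ), 0 ≤ t →
      ∫⁻ η', ENNReal.ofReal (D η') ∂(lawFrom (generator G σ θL θR) t η) ≤
        ENNReal.ofReal (K + C η * N t) := by
    intro t η ht
    have h1 := integral_dualityFn hθL hθR 0 ξ η ht
    rw [← ofReal_integral_eq_lintegral_ofReal h1.1 (ae_of_all _ hD0), h1.2]
    refine ENNReal.ofReal_le_ofReal ?_
    have := isProbabilityMeasure_dualLaw ht ξ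
    have i2 := integral_dualLaw (fun ζ => (total ζ.1 : ℝ)) ht (⟨ξ, rfl⟩ : SizeClass G σ (size ξ))
    have i1 := integral_dualLaw (fun ζ => dualityFn G σ θL θR 0 ζ η) ht
      (⟨ξ, rfl⟩ : SizeClass G σ (size ξ))
    calc _ ≤ ∫ ζ, K + C η * total ζ.1 ∂(lawFrom (dualGenerator G σ) t ξ) := by
          refine integral_mono_ae i1.1 ((integrable_const K).add (i2.1.const_mul _)) ?_
          filter_upwards [ae_size_eq ht ξ] with ζ hζ using hC η ζ hζ
      _ = K + C η * N t := by
          rw [integral_add (integrable_const K) (i2.1.const_mul _), integral_const_mul, i2.2]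
          simp [hN]
  have htrunc : ∀ M : ℕ, ∫⁻ η, min (ENNReal.ofReal (D η)) M ∂μ ≤ ENNReal.ofReal K := by
    intro M
    have hle : ∀ n : ℕ, ∫⁻ η, min (ENNReal.ofReal (D η)) M ∂μ ≤
        ∫⁻ η, min (ENNReal.ofReal (K + C η * N n)) M ∂μ := by
      intro n
      have hn : (0 : ℝ) ≤ n := Nat.cast_nonneg n
      conv_lhs => rw [← hμ.2 n hn]
      rw [lawAt, Measure.lintegral_bind (measurable_of_countable _).aemeasurable
        (measurable_of_countable _).aemeasurable]
      refine lintegral_mono fun η => ?_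
      have := isProbabilityMeasure_law hθL hθR η hn
      refine le_min ((lintegral_mono fun η' => min_le_left _ _).trans (hexp n η hn)) ?_
      refine (lintegral_mono fun η' => min_le_right _ _).trans ?_
      simp
    have hlim : Tendsto (fun n : ℕ => ∫⁻ η, min (ENNReal.ofReal (K + C η * N n)) M ∂μ) atTop
        (𝓝 (∫⁻ _, min (ENNReal.ofReal K) M ∂μ)) := by
      refine tendsto_lintegral_of_dominated_convergence (fun _ => (M : ℝ≥0∞))
        (fun n => measurable_of_countable _) (fun n => ae_of_all _ fun η => min_le_right _ _)
        (by simp) (ae_of_all _ fun η => ?_)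
      refine Tendsto.min (ENNReal.tendsto_ofReal ?_) tendsto_const_nhds
      have := ((hNlim.comp tendsto_natCast_atTop_atTop).const_mul (C η)).const_add K
      simpa using this
    refine (ge_of_tendsto' hlim hle).trans ?_
    simp
  refine ⟨(measurable_of_countable _).aestronglyMeasurable, ?_⟩
  rw [hasFiniteIntegral_iff_ofReal (ae_of_all _ hD0)]
  refine lt_of_le_of_lt ?_ (ENNReal.ofReal_lt_top (r := K))
  have hsup : ∀ η, ENNReal.ofReal (D η) = ⨆ M : ℕ, min (ENNReal.ofReal (D η)) M := by
    intro η
    refine le_antisymm ?_ (iSup_le fun M => min_le_left _ _)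
    obtain ⟨M, hM⟩ := exists_nat_ge (D η)
    refine le_iSup_of_le M (le_min le_rfl ?_)
    rw [← ENNReal.ofReal_natCast]
    exact ENNReal.ofReal_le_ofReal hM
  rw [lintegral_congr hsup, lintegral_iSup (fun M => measurable_of_countable _) fun M M' hMM' η => by
    dsimp only
    gcongr]
  exact iSup_le htrunc

theorem integral_dualityFn_of_stationary (hG : 0 < max G.ωL G.ωR) (hθL : θL ∈ scaleSet σ)
    (hθR : θR ∈ scaleSet σ) {μ : Measure (Config G σ)}
    (hμ : IsStationaryMeasure (generator G σ θL θR) μ) (ξ : DualConfig G σ) :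
    ∫ η, dualityFn G σ θL θR θR ξ η ∂μ = (θL - θR) ^ size ξ * probAllLeft ξ := by
  have hprob := hμ.1
  have h0 := integrable_dualityFn_of_stationary hG hθL hθR hμ
  have hlim := tendsto_integral_dualLaw hG ξ (fun ζ => ∫ η, dualityFn G σ θL θR θR ζ η ∂μ)
    ((θL - θR) ^ size ξ) (fun ζ hζ hbulk => by
      have hb : ∀ x, ζ.1.1 x = 0 := fun x =>
        (Finset.sum_eq_zero_iff.1 hbulk) x (Finset.mem_univ x)
      have e : ∀ η, dualityFn G σ θL θR θR ζ η = (θL - θR) ^ ζ.2.1 * 0 ^ ζ.2.2 := by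
        intro η
        rw [dualityFn, Finset.prod_eq_one, sub_self, mul_one]
        intro x _
        rw [hb]
        rcases σ with _ | _ | _ <;> simp [siteFn, binomialShift, classicalFn, weight]
      simp only [e, integral_const, probReal_univ, one_smul]
      have hs : ζ.2.1 + ζ.2.2 = size ξ := by
        rw [← hζ, size]
        simp [hb]
      split_ifs with h1
      · have : ζ.2.2 = 0 := by omega
        rw [this, h1, pow_zero, mul_one]
      · have : ζ.2.2 ≠ 0 := by omega
        simp [this])
  refine tendsto_nhds_unique (tendsto_const_nhds.congr' ?_) hlim
  filter_upwards [eventually_ge_atTop 0] with t ht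
  rw [← (integral_lawAt_dualityFn hθL hθR h0 θR ξ ht).2, hμ.2 t ht]

theorem integral_lawAt_interpolating (hθL : θL ∈ scaleSet σ) (hθR : θR ∈ scaleSet σ)
    {β : Fin (m + 1) → ℝ} (hβ : ∀ x, interp θL θR (β x) ∈ scaleSet σ) (ξ : DualConfig G σ) {t : ℝ}
    (ht : 0 ≤ t) :
    Integrable (dualityFn G σ θL θR θR ξ)
        (lawAt (generator G σ θL θR) (interpolatingMeasure G σ θL θR β) t) ∧
      ∫ η, dualityFn G σ θL θR θR ξ η
          ∂(lawAt (generator G σ θL θR) (interpolatingMeasure G σ θL θR β) t) =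
        (θL - θR) ^ size ξ * dualExpectation β t ξ := by
  have hprob := isProbabilityMeasure_interpolatingMeasure (G := G) hβ
  have h := integral_lawAt_dualityFn hθL hθR
    (fun ζ => (integral_interpolatingMeasure (G := G) hβ 0 ζ).1) θR ξ ht
  refine ⟨h.1, ?_⟩
  rw [h.2, dualExpectation, ← integral_const_mul]
  refine integral_congr_ae ?_
  filter_upwards [ae_size_eq ht ξ] with ζ hζ
  rw [(integral_interpolatingMeasure hβ θR ζ).2, sub_self, ← hζ]
  simp only [interp, add_sub_cancel_left, mul_pow, Finset.prod_mul_distrib]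
  rw [Finset.prod_pow_eq_pow_sum]
  split_ifs with h0
  · rw [h0, size, h0]
    ring
  · simp [h0]

end Moments

end BoundaryDriven
end

open BoundaryDriven
theorem mainTheorem2 {m : ℕ} (G : Geometry m) (σ : SignType) (θL θR : ℝ)
    (hθL : θL ∈ scaleSet σ) (hθR : θR ∈ scaleSet σ)
    (β β' : Fin (m + 1) → ℝ)
    (hβ : ∀ x, interp θL θR (β x) ∈ scaleSet σ)
    (hβ' : ∀ x, interp θL θR (β' x) ∈ scaleSet σ)
    (ξ : DualConfig G σ) (hξL : ξ.2.1 = 0) (hξR : ξ.2.2 = 0) :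
    (∀ t : ℝ, 0 ≤ t →
      Integrable (interpolatingFn G σ θL θR β' ξ)
        (lawAt (generator G σ θL θR) (interpolatingMeasure G σ θL θR β) t) ∧
      ∫ η, interpolatingFn G σ θL θR β' ξ η
          ∂(lawAt (generator G σ θL θR) (interpolatingMeasure G σ θL θR β) t) =
        (θL - θR) ^ size ξ * psiAt β β' t ξ) ∧
    (0 < max G.ωL G.ωR →
      Tendsto (fun t : ℝ => psiAt β β' t ξ) atTop (𝓝 (psiStationary β' ξ)) ∧
      ∀ μ : Measure (Config G σ), IsStationaryMeasure (generator G σ θL θR) μ →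
        Integrable (interpolatingFn G σ θL θR β' ξ) μ ∧
        ∫ η, interpolatingFn G σ θL θR β' ξ η ∂μ =
          (θL - θR) ^ size ξ * psiStationary β' ξ) := by
  have hfn : interpolatingFn G σ θL θR β' ξ = fun η => ∑ ζ ∈ below ξ,
      (-1) ^ (size ξ - size ζ) * (θL - θR) ^ (size ξ - size ζ) *
        binomialFactor β' ξ ζ * dualityFn G σ θL θR θR ζ η :=
    funext fun η => interpolatingFn_eq_sum β' hξL hξR η
  have hcombine : ∀ (ν : Measure (Config G σ)) (c : DualConfig G σ → ℝ),
      (∀ ζ, Integrable (dualityFn G σ θL θR θR ζ) ν ∧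
        ∫ η, dualityFn G σ θL θR θR ζ η ∂ν = (θL - θR) ^ size ζ * c ζ) →
      Integrable (interpolatingFn G σ θL θR β' ξ) ν ∧
        ∫ η, interpolatingFn G σ θL θR β' ξ η ∂ν = (θL - θR) ^ size ξ *
          ∑ ζ ∈ below ξ, (-1) ^ (size ξ - size ζ) * (binomialFactor β' ξ ζ * c ζ) := by
    intro ν c h
    rw [hfn]
    refine ⟨integrable_finsetSum _ fun ζ _ => (h ζ).1.const_mul _, ?_⟩
    rw [integral_finsetSum _ fun ζ _ => (h ζ).1.const_mul _, Finset.mul_sum]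
    refine Finset.sum_congr rfl fun ζ hζ => ?_
    rw [integral_const_mul, (h ζ).2,
      ← Nat.sub_add_cancel (size_le_of_le (mem_below.1 hζ)), pow_add (θL - θR),
      Nat.add_sub_cancel]
    ring
  refine ⟨fun t ht => hcombine _ _ fun ζ => integral_lawAt_interpolating hθL hθR hβ ζ ht,
    fun hG => ⟨?_, fun μ hμ => hcombine _ _ fun ζ => ⟨integrable_dualityFn
      (integrable_dualityFn_of_stationary hG hθL hθR hμ) θR ζ,
      integral_dualityFn_of_stationary hG hθL hθR hμ ζ⟩⟩⟩
  refine tendsto_finsetSum _ fun ζ _ => ((Tendsto.const_mul _ ?_).const_mul _)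
  have h := tendsto_integral_dualLaw hG ζ
    (fun ζ' => if ζ'.2.2 = 0 then ∏ x, β x ^ ζ'.1.1 x else 0) 1 (fun ζ' hs hbulk => by
      have hb : ∀ x, ζ'.1.1 x = 0 := fun x =>
        (Finset.sum_eq_zero_iff.1 hbulk) x (Finset.mem_univ x)
      have hs' : ζ'.2.1 + ζ'.2.2 = size ζ := by
        rw [← hs, size]
        simp [hb]
      simp only [hb, pow_zero, Finset.prod_const_one]
      congr 1
      rw [eq_iff_iff]
      omega)
  rwa [one_mul] at h
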